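/- **Asymptotic normality of the parametric specification test.** Let $(Y,Z,W)$ be a random vector with values in $\mathbb R\times\mathbb R^{d_z}\times\mathbb R^{d_w}$ satisfying the instrumental regression model $Y=\varphi(Z)+U$ with $\mathbb E[U\mid W]=0$ and $\mathbb E|\varphi(Z)|^2<\infty$, and let $(Y_i,Z_i,W_i)_{i\ge1}$ be independent copies of $(Y,Z,W)$. Let $\nu$ be a probability density on $\mathbb R^{d_w}$, let $(f_j)_{j\ge1}$ be an orthonormal basis of $L^2_\nu=\{\psi:\int\psi^2\nu<\infty\}$, and let $\tau=(\tau_j)_{j\ge1}$ be a sequence of weights. Assume: 1. There are $\eta_f,\eta_p\ge1$ with $\sup_{j}\int|f_j|^4\nu\le\eta_f$; $W$ has a Lebesgue density $p_W$; and on the support $\mathcal W$ of $W$, $\nu>0$ and $p_W/\nu\le\eta_p$. 2. There is $\sigma>0$ with $\mathbb E[U^4\mid W]\le\sigma^4$. 3. The operator $T:h\mapsto\mathbb E[h(Z)\mid W]$ from $L^2_Z$ to $L^2_W$ is nonsingular (injective). 4. $\tau$ is positive and nonincreasing, and $\tau_1=1$. 5. $\varTheta\subset\mathbb R^k$ is compact,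 $\phi:\mathbb R^{d_z}\times\mathbb R^k\to\mathbb R$ is a (measurable) function, $\vartheta_0\in\operatorname{int}(\varTheta)$, and: (i) $\hat\vartheta_n$ is an estimator with $\|\hat\vartheta_n-\vartheta_0\|=O_p(n^{-1/2})$, where $\varphi(Z)=\phi(Z,\vartheta_0)$ almost surely if the null hypothesis $H_p$ below holds; (ii) for every $z$, $\phi(z,\cdot)$ has all partial derivatives $\phi_{\vartheta_l}$ and $\phi_{\vartheta_j\vartheta_l}$ of first and second order on $\operatorname{int}(\varTheta)$, and for some $\eta_\phi\ge1$ $$\sup_{1\le l\le k}\mathbb E|\phi_{\vartheta_l}(Z,\vartheta_0)|^4\le\eta_\phi,\qquad \sup_{1\le j,l\le k}\mathbb E\sup_{\theta\in\operatorname{int}(\varTheta)}|\phi_{\vartheta_j\vartheta_l}(Z,\theta)|^4\le\eta_\phi .$$ Put $s_{jl}=\sqrt{\tau_j\tau_l}\,\mathbb E[U^2f_j(W)f_l(W)]$, $\mu_m=\sum_{j=1}^m s_{jj}$, $\varsigma_m=\big(\sum_{j,l=1}^m s_{jl}^2\big)^{1/2}$, and, for a sequence of integers $m_n$, $$S_n^p=\sum_{j=1}^{m_n}\tau_j\Big|\frac1n\sum_{i=1}^n\big(Y_i-\phi(Z_i,\hat\vartheta_n)\big)f_j(W_i)\Big|^2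 .$$ Suppose that $\varsigma_{m_n}^{-1}=o(1)$ (that is, $\varsigma_{m_n}\to\infty$) and $\big(\sum_{j=1}^{m_n}\tau_j\big)^3=o(n)$. Then, under the null hypothesis $H_p$ that there is $\vartheta\in\varTheta$ with $\varphi(Z)=\phi(Z,\vartheta)$ almost surely, $$(\sqrt2\,\varsigma_{m_n})^{-1}\big(nS_n^p-\mu_{m_n}\big)\xrightarrow{d}\mathcal N(0,1)\qquad(n\to\infty).$$ -/

import Mathlib

open MeasureTheory ProbabilityTheory Filter Topology

namespace IVTest

/-- Euclidean space `ℝ^d`. -/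
abbrev E (d : ℕ) : Type := EuclideanSpace ℝ (Fin d)

/-- `X n = O_p(r n)`: for every `ε > 0` there is `C` with `P(‖X n‖ > C r n) ≤ ε` for all
large `n`. -/
def IsBigOInProb {Ω V : Type*} [MeasurableSpace Ω] [NormedAddCommGroup V] (P : Measure Ω)
    (X : ℕ → Ω → V) (r : ℕ → ℝ) : Prop :=
  ∀ ε : ℝ, 0 < ε → ∃ C : ℝ, ∀ᶠ n in atTop, P {ω | C * r n < ‖X n ω‖} ≤ ENNReal.ofReal ε

/-- The sigma-algebra on `Ω` generated by the random vector `W`. -/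
abbrev sigmaOf {Ω : Type*} {d : ℕ} (W : Ω → E d) : MeasurableSpace Ω :=
  MeasurableSpace.comap W inferInstance

/-- The error term `U = Y - sol(Z)`. -/
def err {Ω : Type*} {dz : ℕ} (Y : Ω → ℝ) (Z : Ω → E dz) (sol : E dz → ℝ) (ω : Ω) : ℝ :=
  Y ω - sol (Z ω)

/-- The instrumental regression model `Y = sol(Z) + U`, `E[U | W] = 0`, with `sol(Z)` square
integrable. -/
structure IsIVModel {Ω : Type*} {mΩ : MeasurableSpace Ω} (P : Measure Ω) {dz dw : ℕ}
    (Y : Ω → ℝ) (Z : Ω → E dz) (W : Ω → E dw) (sol : E dz → ℝ) : Prop where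
  measurable_Y : Measurable Y
  measurable_Z : Measurable Z
  measurable_W : Measurable W
  measurable_sol : Measurable sol
  sol_sq_integrable : MemLp (fun ω => sol (Z ω)) 2 P
  err_integrable : Integrable (err Y Z sol) P
  err_condExp : P[err Y Z sol | sigmaOf W] =ᵐ[P] 0

/-- `(Ys i, Zs i, Ws i)`, `i = 0, 1, 2, …`, are independent copies of `(Y, Z, W)`. -/
structure IsIIDSample {Ω : Type*} {mΩ : MeasurableSpace Ω} (P : Measure Ω) {dz dw : ℕ}
    (Y : Ω → ℝ) (Z : Ω → E dz) (W : Ω → E dw)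
    (Ys : ℕ → Ω → ℝ) (Zs : ℕ → Ω → E dz) (Ws : ℕ → Ω → E dw) : Prop where
  indep : iIndepFun (fun (i : ℕ) (ω : Ω) => (Ys i ω, Zs i ω, Ws i ω)) P
  ident : ∀ i : ℕ, IdentDistrib (fun ω => (Ys i ω, Zs i ω, Ws i ω))
    (fun ω => (Y ω, Z ω, W ω)) P P

/-- The measure `ν(s) ds` on `ℝ^d`. -/
noncomputable def densityMeasure {d : ℕ} (ν : E d → ℝ) : Measure (E d) :=
  volume.withDensity (fun s => ENNReal.ofReal (ν s))

/-- `ν` is a probability density function on `ℝ^d`. -/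
structure IsProbDensity {d : ℕ} (ν : E d → ℝ) : Prop where
  measurable : Measurable ν
  nonneg : ∀ s, 0 ≤ ν s
  total : IsProbabilityMeasure (densityMeasure ν)

/-- The functions `f 0, f 1, …` form an orthonormal basis of `L²(ν(s) ds)`. -/
def IsONB {d : ℕ} (ν : E d → ℝ) (f : ℕ → E d → ℝ) : Prop :=
  (∀ j, Measurable (f j)) ∧
  ∃ b : HilbertBasis ℕ ℝ (Lp ℝ 2 (densityMeasure ν)),
    ∀ j, (b j : E d → ℝ) =ᵐ[densityMeasure ν] f j

/-- The basis has uniformly bounded fourth moments with respect to `ν`, and the law of `W` has a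
density `pW` with `pW / ν` bounded on the support of `W`, where `ν` is strictly positive. -/
def AssumptionBasis {Ω : Type*} {mΩ : MeasurableSpace Ω} (P : Measure Ω) {dw : ℕ}
    (W : Ω → E dw) (ν : E dw → ℝ) (f : ℕ → E dw → ℝ) : Prop :=
  (∃ ηf : ℝ, 1 ≤ ηf ∧ ∀ j, ∫⁻ s, ‖f j s‖ₑ ^ 4 ∂(densityMeasure ν) ≤ ENNReal.ofReal ηf) ∧
  (∀ w ∈ (P.map W).support, 0 < ν w) ∧
  ∃ pW : E dw → ℝ, Measurable pW ∧ (∀ w, 0 ≤ pW w) ∧ P.map W = densityMeasure pW ∧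
    ∃ ηp : ℝ, 1 ≤ ηp ∧ ∀ w ∈ (P.map W).support, pW w / ν w ≤ ηp

/-- `E[U⁴ | W] ≤ σ⁴` for some `σ > 0`. -/
def AssumptionMoment {Ω : Type*} {mΩ : MeasurableSpace Ω} (P : Measure Ω) {dw : ℕ}
    (U : Ω → ℝ) (W : Ω → E dw) : Prop :=
  ∃ σ : ℝ, 0 < σ ∧ Integrable (fun ω => U ω ^ 4) P ∧
    P[fun ω => U ω ^ 4 | sigmaOf W] ≤ᵐ[P] fun _ => σ ^ 4

/-- The conditional expectation operator `h ↦ E[h(Z) | W]` from `L²_Z` to `L²_W` is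
nonsingular (injective). -/
def AssumptionNonsingular {Ω : Type*} {mΩ : MeasurableSpace Ω} (P : Measure Ω) {dz dw : ℕ}
    (Z : Ω → E dz) (W : Ω → E dw) : Prop :=
  ∀ h : E dz → ℝ, Measurable h → MemLp (fun ω => h (Z ω)) 2 P →
    P[fun ω => h (Z ω) | sigmaOf W] =ᵐ[P] 0 → (fun ω => h (Z ω)) =ᵐ[P] 0

/-- The weights are positive and nonincreasing with first element `1`. -/
structure AssumptionWeights (τ : ℕ → ℝ) : Prop where
  pos : ∀ j, 0 < τ j
  antitone : Antitone τ
  first : τ 0 = 1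

/-- The entry `s_{jl} = E[U² f_j^τ(W) f_l^τ(W)]`, where `f_j^τ = √τ_j f_j`. -/
noncomputable def covEntry {Ω : Type*} {mΩ : MeasurableSpace Ω} (P : Measure Ω) {dw : ℕ}
    (U : Ω → ℝ) (W : Ω → E dw) (f : ℕ → E dw → ℝ) (τ : ℕ → ℝ) (j l : ℕ) : ℝ :=
  ∫ ω, U ω ^ 2 * (√(τ j) * f j (W ω)) * (√(τ l) * f l (W ω)) ∂P

/-- `μ_m`, the trace of the `m × m` covariance matrix. -/
noncomputable def covTrace {Ω : Type*} {mΩ : MeasurableSpace Ω} (P : Measure Ω) {dw : ℕ}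
    (U : Ω → ℝ) (W : Ω → E dw) (f : ℕ → E dw → ℝ) (τ : ℕ → ℝ) (m : ℕ) : ℝ :=
  ∑ j ∈ Finset.range m, covEntry P U W f τ j j

/-- `ς_m`, the Frobenius norm of the `m × m` covariance matrix. -/
noncomputable def covFrob {Ω : Type*} {mΩ : MeasurableSpace Ω} (P : Measure Ω) {dw : ℕ}
    (U : Ω → ℝ) (W : Ω → E dw) (f : ℕ → E dw → ℝ) (τ : ℕ → ℝ) (m : ℕ) : ℝ :=
  √(∑ j ∈ Finset.range m, ∑ l ∈ Finset.range m, covEntry P U W f τ j l ^ 2)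

/-- The null hypothesis `H_p`: the structural function is `φ(·, ϑ)` for some `ϑ ∈ Θ`, as
elements of `L²_Z`. -/
def ParametricNull {Ω : Type*} {mΩ : MeasurableSpace Ω} (P : Measure Ω) {dz k : ℕ}
    (Z : Ω → E dz) (sol : E dz → ℝ) (Θ : Set (E k)) (φ : E dz → E k → ℝ) : Prop :=
  ∃ ϑ ∈ Θ, ∀ᵐ ω ∂P, sol (Z ω) = φ (Z ω) ϑ

/-- The partial derivative `∂g/∂ϑ_l` at `ϑ`. -/
noncomputable def partialDeriv {k : ℕ} (g : E k → ℝ) (l : Fin k) (ϑ : E k) : ℝ :=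
  lineDeriv ℝ g ϑ (EuclideanSpace.single l 1)

/-- `g` has all first and second order partial derivatives at every point of the open set `O`. -/
def TwicePartialDiffOn {k : ℕ} (g : E k → ℝ) (O : Set (E k)) : Prop :=
  ∀ ϑ ∈ O, (∀ l : Fin k, LineDifferentiableAt ℝ g ϑ (EuclideanSpace.single l 1)) ∧
    ∀ j l : Fin k, LineDifferentiableAt ℝ (partialDeriv g l) ϑ (EuclideanSpace.single j 1)

/-- The conditions on the parametric family `φ`, the true parameter `ϑ₀` and its estimators
`ϑhat n`. -/
structure AssumptionParametric {Ω : Type*} {mΩ : MeasurableSpace Ω} (P : Measure Ω) {dz k : ℕ}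
    (Z : Ω → E dz) (sol : E dz → ℝ) (Θ : Set (E k)) (φ : E dz → E k → ℝ)
    (ϑ₀ : E k) (ϑhat : ℕ → Ω → E k) : Prop where
  measurable_φ : Measurable (fun q : E dz × E k => φ q.1 q.2)
  measurable_ϑhat : ∀ n, Measurable (ϑhat n)
  mem_interior : ϑ₀ ∈ interior Θ
  rate : IsBigOInProb P (fun n ω => ϑhat n ω - ϑ₀) (fun n => (√(n : ℝ))⁻¹)
  eq_of_null : ParametricNull P Z sol Θ φ → ∀ᵐ ω ∂P, sol (Z ω) = φ (Z ω) ϑ₀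
  twice_diff : ∀ z, TwicePartialDiffOn (φ z) (interior Θ)
  moments : ∃ ηφ : ℝ, 1 ≤ ηφ ∧
    (∀ l : Fin k, ∫⁻ ω, ‖partialDeriv (φ (Z ω)) l ϑ₀‖ₑ ^ 4 ∂P ≤ ENNReal.ofReal ηφ) ∧
    ∀ j l : Fin k,
      AEMeasurable
        (fun ω => ⨆ ϑ ∈ interior Θ, ‖partialDeriv (partialDeriv (φ (Z ω)) l) j ϑ‖ₑ ^ 4) P ∧
      ∫⁻ ω, ⨆ ϑ ∈ interior Θ, ‖partialDeriv (partialDeriv (φ (Z ω)) l) j ϑ‖ₑ ^ 4 ∂P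
        ≤ ENNReal.ofReal ηφ

/-- The statistic
`∑_{j ≤ m} τ_j |n⁻¹ ∑_{i ≤ n} (Y_i - φ(Z_i, ϑhat)) f_j(W_i)|²`. -/
noncomputable def testStat {Ω : Type*} {dz dw k : ℕ}
    (Ys : ℕ → Ω → ℝ) (Zs : ℕ → Ω → E dz) (Ws : ℕ → Ω → E dw)
    (f : ℕ → E dw → ℝ) (τ : ℕ → ℝ) (φ : E dz → E k → ℝ) (ϑhat : Ω → E k)
    (m n : ℕ) (ω : Ω) : ℝ :=
  ∑ j ∈ Finset.range m, τ j *
    |(n : ℝ)⁻¹ * ∑ i ∈ Finset.range n,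
      (Ys i ω - φ (Zs i ω) (ϑhat ω)) * f j (Ws i ω)| ^ 2

end IVTest

open IVTest

/-! Let `ξ i` be the weighted score vector of the `i`-th observation, with coordinates `√(τ j) * U *
f j (W)`, `j < m`, and let `a` be the mean of the first `n` of them. These vectors are independent
and centred with covariance matrix `Σ = (s_jl)`. Up to the effect of estimating the parameter, the
statistic is `‖a‖²`, and `n‖a‖² = n⁻¹ ∑ ‖ξ i‖² + (2/n) ∑_{j<i} ⟪ξ j, ξ i⟫`.

The diagonal part has mean `μ_m` and a fluctuation bounded in mean square, so it vanishes after
division by `ς_m → ∞` (`integral_sq_diag_le`). The off-diagonal part is a martingale with increments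
`⟪S_k, ξ k⟫`, where `S_k` is the partial sum. The conditional variance of an increment is `⟪Σ S_k,
S_k⟫`, whose mean is `k ς_m²`. It concentrates because the operator norm of `Σ` is bounded uniformly
in `m` while its Hilbert-Schmidt norm `ς_m` diverges (`integral_quad_sub_sq_le`). Comparing
characteristic functions one increment at a time then gives the normal limit
(`norm_charFun_step_le`, `tendstoInDistribution_offDiag`).

Under the null, Taylor expansion at `ϑ₀` turns the estimation effect into a perturbation of `a`: a
linear term in `ϑhat - ϑ₀` and a quadratic remainder. The mean gradient vectors have norm bounded in
`m` by Bessel's inequality, so their inner products with `a` are of order `n^(-1/2)`; the centred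
gradient noise and the remainder are handled by Cauchy-Schwarz, using that `(∑ τ j)²` is at most
`n`. The effect on `n` times the statistic is therefore `O_p(1)` (`abs_norm_sq_perturb_le`,
`integral_remBound_le`), again negligible against `ς_m`. Slutsky's lemma concludes. -/

namespace IVTest

set_option linter.unusedSectionVars false

open scoped RealInnerProductSpace

/-! ### Independence, elementary inequalities and moments of sums of two variables. -/

section Tools

variable {Ω : Type*} {mΩ : MeasurableSpace Ω} {P : Measure Ω}

/-- Fubini's theorem for a function of two independent variables. -/
lemma integral_comp_indepFun [IsProbabilityMeasure P] {α β G : Type*} [MeasurableSpace α]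
    [MeasurableSpace β] [NormedAddCommGroup G] [NormedSpace ℝ G] {X : Ω → α} {ξ : Ω → β}
    (hX : AEMeasurable X P) (hξ : AEMeasurable ξ P) (h : IndepFun X ξ P) {F : α × β → G}
    (hF : StronglyMeasurable F) (hi : Integrable (fun ω => F (X ω, ξ ω)) P) :
    ∫ ω, F (X ω, ξ ω) ∂P = ∫ ω, ∫ z, F (X ω, z) ∂(P.map ξ) ∂P := by
  have hp := (indepFun_iff_map_prod_eq_prod_map_map hX hξ).1 h
  have := Measure.isProbabilityMeasure_map hX
  have := Measure.isProbabilityMeasure_map hξ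
  have h1 : ∫ ω, F (X ω, ξ ω) ∂P = ∫ p, F p ∂(P.map fun ω => (X ω, ξ ω)) :=
    (integral_map (hX.prodMk hξ) hF.aestronglyMeasurable).symm
  have hi' : Integrable F ((P.map X).prod (P.map ξ)) := by
    rw [← hp]
    exact (integrable_map_measure hF.aestronglyMeasurable (hX.prodMk hξ)).2 hi
  rw [h1, hp, integral_prod _ hi', integral_map hX]
  exact hi'.aestronglyMeasurable.integral_prod_right'

/-- A function of the variables with index less than `k` is independent of the `k`-th one. -/
lemma indepFun_of_past {V β : Type*} [MeasurableSpace V] [Zero V] [MeasurableSpace β]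
    {ξ : ℕ → Ω → V}
    (hξ : iIndepFun ξ P) (hm : ∀ i, AEMeasurable (ξ i) P) {k : ℕ} {g : (ℕ → V) → β}
    (hg : Measurable g) (hdep : ∀ x y : ℕ → V, (∀ i < k, x i = y i) → g x = g y) :
    IndepFun (fun ω => g fun i => ξ i ω) (ξ k) P := by
  have h := hξ.indepFun_finset₀ (Finset.range k) {k} (by simp) hm
  -- Extension by zero: `g` ignores the coordinates from `k` on, so `g ∘ e` is a function of the
  -- first `k` variables alone.
  let e : (Finset.range k → V) → ℕ → V := fun v i =>
    if hi : i ∈ Finset.range k then v ⟨i, hi⟩ else 0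
  have he : Measurable e := by
    refine measurable_pi_lambda _ fun i => ?_
    by_cases hi : i ∈ Finset.range k
    · simp only [e, hi, dite_true]; fun_prop
    · simp only [e, hi, dite_false]; fun_prop
  have h2 := h.comp (hg.comp he)
    (measurable_pi_apply (⟨k, Finset.mem_singleton_self k⟩ : ({k} : Finset ℕ)))
  have e1 : (fun ω => g fun i => ξ i ω) = (g ∘ e) ∘ fun a (i : Finset.range k) => ξ i a := by
    funext ω
    refine hdep _ _ fun i hi => ?_
    simp [e, hi]
  rw [e1]
  exact h2

/-- For `|x| ≤ 1` this is the exponential series remainder with `e ≤ 4`; for `|x| > 1` the terms are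
bounded one by one by powers of `|x|`. -/
lemma norm_exp_mul_I_sub_le (x : ℝ) :
    ‖Complex.exp (x * Complex.I) - (1 + x * Complex.I - x ^ 2 / 2)‖ ≤ 4 * |x| ^ 3 := by
  rcases le_or_gt |x| 1 with hx | hx
  · have h := Complex.norm_exp_sub_sum_le_norm_mul_exp (x * Complex.I) 3
    have e : (∑ m ∈ Finset.range 3, (x * Complex.I) ^ m / (m.factorial : ℂ))
        = 1 + x * Complex.I - x ^ 2 / 2 := by
      simp [Finset.sum_range_succ, Nat.factorial, mul_pow]; ring
    rw [e] at h
    have hn : ‖(x : ℂ) * Complex.I‖ = |x| := by simp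
    rw [hn] at h
    refine h.trans ?_
    have h3 : Real.exp |x| ≤ 4 := by
      refine (Real.exp_le_exp.2 hx).trans ?_
      have := Real.exp_one_lt_d9; linarith
    have := pow_nonneg (abs_nonneg x) 3
    nlinarith
  · have h1 : ‖Complex.exp (x * Complex.I)‖ = 1 := Complex.norm_exp_ofReal_mul_I x
    calc _ ≤ ‖Complex.exp (x * Complex.I)‖ + ‖(1 + x * Complex.I - x ^ 2 / 2 : ℂ)‖ :=
          norm_sub_le _ _
      _ ≤ 1 + (1 + |x| + |x| ^ 2 / 2) := by
          rw [h1]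
          gcongr
          refine (norm_sub_le _ _).trans ?_
          gcongr
          · refine (norm_add_le _ _).trans ?_
            simp
          · simp
      _ ≤ _ := by nlinarith [sq_nonneg (|x| - 1), mul_pos (sub_pos.2 hx) (sub_pos.2 hx),
            mul_pos (mul_pos (sub_pos.2 hx) (sub_pos.2 hx)) (sub_pos.2 hx)]

lemma abs_exp_neg_sub_le {a : ℝ} (ha : 0 ≤ a) : |Real.exp (-a) - (1 - a)| ≤ a ^ 2 := by
  rcases le_or_gt a 1 with h | h
  · have := Real.norm_exp_sub_one_sub_id_le (x := -a) (by simpa [abs_of_nonneg ha] using h)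
    simp only [Real.norm_eq_abs, abs_neg, sq_abs] at this
    convert this using 2; ring
  · have h1 := Real.exp_pos (-a)
    have h2 : Real.exp (-a) ≤ 1 := Real.exp_le_one_iff.2 (by linarith)
    rw [abs_of_nonneg (by linarith)]
    nlinarith

/-- Third absolute moments are thus reduced to even ones, which can be computed by independence. The
free `ε` later makes the second-moment share small. -/
lemma abs_cube_le {ε : ℝ} (hε : 0 < ε) (y : ℝ) : |y| ^ 3 ≤ ε * y ^ 2 + y ^ 4 / ε := by
  have h : |y| ^ 3 * ε ≤ (ε * y ^ 2 + y ^ 4 / ε) * ε := by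
    have e : (ε * y ^ 2 + y ^ 4 / ε) * ε = ε ^ 2 * |y| ^ 2 + |y| ^ 4 := by
      rw [sq_abs, (by decide : Even 4).pow_abs]; field_simp
    rw [e]
    nlinarith [mul_nonneg (sq_nonneg |y|) (sq_nonneg (ε - |y|)),
      mul_nonneg (sq_nonneg |y|) (mul_nonneg hε.le (abs_nonneg y))]
  exact le_of_mul_le_mul_right h hε

lemma integrable_pow_of_memLp [IsFiniteMeasure P] {X : Ω → ℝ} {p : ℕ} (hX : MemLp X p P)
    {q : ℕ} (hq : q ≤ p) : Integrable (fun ω => X ω ^ q) P := by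
  have h := (hX.mono_exponent (p := q) (by exact_mod_cast hq)).integrable_norm_pow'
  refine h.mono' (by have := hX.aestronglyMeasurable; fun_prop) (ae_of_all _ fun ω => ?_)
  simp

/-- Moments of a sum of two independent variables, the second one centred. -/
lemma integral_add_sq_of_indepFun [IsProbabilityMeasure P] {A B : Ω → ℝ} (h : IndepFun A B P)
    (hA : MemLp A 4 P) (hB : MemLp B 4 P) (h0 : ∫ ω, B ω ∂P = 0) :
    ∫ ω, (A ω + B ω) ^ 2 ∂P = ∫ ω, A ω ^ 2 ∂P + ∫ ω, B ω ^ 2 ∂P := by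
  have hA' : MemLp A (4 : ℕ) P := by simpa using hA
  have hB' : MemLp B (4 : ℕ) P := by simpa using hB
  have a1 : Integrable A P := by simpa using integrable_pow_of_memLp hA' (q := 1) (by norm_num)
  have b1 : Integrable B P := by simpa using integrable_pow_of_memLp hB' (q := 1) (by norm_num)
  have a2 := integrable_pow_of_memLp hA' (q := 2) (by norm_num)
  have b2 := integrable_pow_of_memLp hB' (q := 2) (by norm_num)
  have hab : Integrable (fun ω => A ω * B ω) P := h.integrable_mul a1 b1
  have e : ∫ ω, A ω * B ω ∂P = 0 := by
    rw [h.integral_fun_mul_eq_mul_integral a1.aestronglyMeasurable b1.aestronglyMeasurable, h0,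
      mul_zero]
  calc _ = ∫ ω, (A ω ^ 2 + 2 * (A ω * B ω)) + B ω ^ 2 ∂P := by congr with ω; ring
    _ = _ := by
      rw [integral_add (by fun_prop) b2, integral_add a2 (by fun_prop), integral_const_mul, e]
      ring

/-- In the binomial expansion `A³B` has mean zero, and `4AB³ ≤ 2A²B² + 2B⁴` removes the other odd
term; hence the constants `8 = 6 + 2` and `3 = 1 + 2`. -/
lemma integral_add_pow_four_of_indepFun [IsProbabilityMeasure P] {A B : Ω → ℝ}
    (h : IndepFun A B P) (hA : MemLp A 4 P) (hB : MemLp B 4 P) (h0 : ∫ ω, B ω ∂P = 0) :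
    ∫ ω, (A ω + B ω) ^ 4 ∂P ≤ ∫ ω, A ω ^ 4 ∂P + 8 * (∫ ω, A ω ^ 2 ∂P) * (∫ ω, B ω ^ 2 ∂P)
      + 3 * ∫ ω, B ω ^ 4 ∂P := by
  have hA' : MemLp A (4 : ℕ) P := by simpa using hA
  have hB' : MemLp B (4 : ℕ) P := by simpa using hB
  have b1 : Integrable B P := by simpa using integrable_pow_of_memLp hB' (q := 1) (by norm_num)
  have a2 := integrable_pow_of_memLp hA' (q := 2) (by norm_num)
  have b2 := integrable_pow_of_memLp hB' (q := 2) (by norm_num)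
  have a3 := integrable_pow_of_memLp hA' (q := 3) (by norm_num)
  have a4 := integrable_pow_of_memLp hA' (q := 4) (by norm_num)
  have b4 := integrable_pow_of_memLp hB' (q := 4) (by norm_num)
  have h31 : IndepFun (fun ω => A ω ^ 3) B P :=
    h.comp (φ := fun x => x ^ 3) (ψ := id) (by fun_prop) measurable_id
  have h22 : IndepFun (fun ω => A ω ^ 2) (fun ω => B ω ^ 2) P :=
    h.comp (φ := fun x => x ^ 2) (ψ := fun x => x ^ 2) (by fun_prop) (by fun_prop)
  have i31 : Integrable (fun ω => A ω ^ 3 * B ω) P := h31.integrable_mul a3 b1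
  have i22 : Integrable (fun ω => A ω ^ 2 * B ω ^ 2) P := h22.integrable_mul a2 b2
  have e31 : ∫ ω, A ω ^ 3 * B ω ∂P = 0 := by
    rw [h31.integral_fun_mul_eq_mul_integral a3.aestronglyMeasurable b1.aestronglyMeasurable, h0,
      mul_zero]
  have e22 := h22.integral_fun_mul_eq_mul_integral a2.aestronglyMeasurable b2.aestronglyMeasurable
  have hAB : MemLp (fun ω => A ω + B ω) (4 : ℕ) P := hA'.add hB'
  calc _ ≤ ∫ ω, A ω ^ 4 + 4 * (A ω ^ 3 * B ω) + 8 * (A ω ^ 2 * B ω ^ 2) + 3 * B ω ^ 4 ∂P := by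
        refine integral_mono (integrable_pow_of_memLp hAB le_rfl)
          (((a4.add (i31.const_mul 4)).add (i22.const_mul 8)).add (b4.const_mul 3)) fun ω => ?_
        simp only
        nlinarith [mul_nonneg (sq_nonneg (B ω)) (sq_nonneg (A ω - B ω))]
    _ = _ := by
      rw [integral_add (by fun_prop) (by fun_prop), integral_add (by fun_prop) (by fun_prop),
        integral_add a4 (by fun_prop), integral_const_mul, integral_const_mul,
        integral_const_mul, e31, e22]
      ring

end Tools

/-! ### The covariance operator of a law on a Hilbert space. -/

section Covariance

variable {V : Type*} [NormedAddCommGroup V] [InnerProductSpace ℝ V] [CompleteSpace V]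
  [MeasurableSpace V] [BorelSpace V] [SecondCountableTopology V]

/-- The uncentred covariance operator of `μ`. -/
noncomputable def covOp (μ : Measure V) : V →L[ℝ] V := ∫ z, (innerSL ℝ z).smulRight z ∂μ

/-- The variance `∫ ⟪x, z⟫² dμ(z)` of a centred `μ` in the direction `x`. -/
noncomputable def quad (μ : Measure V) (x : V) : ℝ := ⟪covOp μ x, x⟫

/-- The squared Hilbert-Schmidt norm of the covariance operator. -/
noncomputable def covHS (μ : Measure V) : ℝ := ∫ z, quad μ z ∂μ

@[fun_prop]
lemma continuous_quad (μ : Measure V) : Continuous (quad μ) := by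
  unfold quad; fun_prop

variable {μ : Measure V} [IsProbabilityMeasure μ]

lemma integrable_norm_pow (hμ : MemLp id 4 μ) {q : ℕ} (hq : q ≤ 4) :
    Integrable (fun z => ‖z‖ ^ q) μ :=
  integrable_pow_of_memLp (X := fun z : V => ‖z‖) (p := 4) (by simpa using hμ.norm) hq

lemma integrable_inner_pow (hμ : MemLp id 4 μ) (x : V) {q : ℕ} (hq : q ≤ 4) :
    Integrable (fun z => ⟪x, z⟫ ^ q) μ := by
  refine ((integrable_norm_pow hμ hq).const_mul (‖x‖ ^ q)).mono' (by fun_prop)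
    (ae_of_all _ fun z => ?_)
  rw [norm_pow, ← mul_pow]
  gcongr
  exact norm_inner_le_norm x z

lemma integrable_inner_mul_inner (hμ : MemLp id 4 μ) (x y : V) :
    Integrable (fun z => ⟪x, z⟫ * ⟪y, z⟫) μ := by
  refine ((integrable_norm_pow hμ (q := 2) (by norm_num)).const_mul (‖x‖ * ‖y‖)).mono'
    (by fun_prop) (ae_of_all _ fun z => ?_)
  rw [norm_mul]
  calc _ ≤ (‖x‖ * ‖z‖) * (‖y‖ * ‖z‖) := by
        gcongr <;> exact norm_inner_le_norm _ z
    _ = _ := by ring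

lemma inner_covOp (hμ : MemLp id 4 μ) (x y : V) :
    ⟪covOp μ x, y⟫ = ∫ z, ⟪x, z⟫ * ⟪y, z⟫ ∂μ := by
  have hi : Integrable (fun z : V => (innerSL ℝ z).smulRight z) μ := by
    refine (integrable_norm_pow hμ (q := 2) (by norm_num)).mono' ?_ (ae_of_all _ fun z => ?_)
    · exact Continuous.aestronglyMeasurable (by fun_prop)
    · refine ContinuousLinearMap.opNorm_le_bound _ (by positivity) fun w => ?_
      simp only [ContinuousLinearMap.smulRight_apply, norm_smul, innerSL_apply_apply]
      calc _ ≤ ‖z‖ * ‖w‖ * ‖z‖ := by gcongr; exact norm_inner_le_norm z w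
        _ = _ := by ring
  have hx : Integrable (fun z : V => ⟪z, x⟫ • z) μ := by
    simpa using hi.apply_continuousLinearMap x
  rw [covOp, ContinuousLinearMap.integral_apply hi, real_inner_comm]
  simp only [ContinuousLinearMap.smulRight_apply, innerSL_apply_apply]
  rw [← integral_inner hx]
  congr with z
  rw [inner_smul_right, real_inner_comm]

lemma quad_eq (hμ : MemLp id 4 μ) (x : V) : quad μ x = ∫ z, ⟪x, z⟫ ^ 2 ∂μ := by
  rw [quad, inner_covOp hμ]; simp only [sq]

lemma quad_nonneg (hμ : MemLp id 4 μ) (x : V) : 0 ≤ quad μ x := by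
  rw [quad_eq hμ]; positivity

lemma quad_add (hμ : MemLp id 4 μ) (x y : V) :
    quad μ (x + y) = quad μ x + 2 * ⟪covOp μ x, y⟫ + quad μ y := by
  have : ⟪covOp μ y, x⟫ = ⟪covOp μ x, y⟫ := by
    rw [inner_covOp hμ, inner_covOp hμ]; congr with z; ring
  simp only [quad, map_add, inner_add_left, inner_add_right, this]; ring

lemma covHS_nonneg (hμ : MemLp id 4 μ) : 0 ≤ covHS μ :=
  integral_nonneg fun z => quad_nonneg hμ z

variable {lam : ℝ}

/-- This is `Σ² ≤ lam Σ`, obtained without spectral theory: write `‖Σx‖²` as the mean of `⟪x, z⟫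
⟪Σx, z⟫`, apply Young's inequality with weight `lam`, and absorb the variance in direction `Σx`,
which costs at most half of the left side. -/
lemma norm_covOp_sq_le (hμ : MemLp id 4 μ) (h0 : 0 < lam) (hl : ∀ x, quad μ x ≤ lam * ‖x‖ ^ 2)
    (x : V) : ‖covOp μ x‖ ^ 2 ≤ lam * quad μ x := by
  have h1 : ‖covOp μ x‖ ^ 2 = ∫ z, ⟪x, z⟫ * ⟪covOp μ x, z⟫ ∂μ := by
    rw [← inner_covOp hμ, real_inner_self_eq_norm_sq]
  have h2 : ∫ z, ⟪x, z⟫ * ⟪covOp μ x, z⟫ ∂μ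
      ≤ ∫ z, lam / 2 * ⟪x, z⟫ ^ 2 + 1 / (2 * lam) * ⟪covOp μ x, z⟫ ^ 2 ∂μ := by
    refine integral_mono (integrable_inner_mul_inner hμ _ _)
      (((integrable_inner_pow hμ x (by norm_num)).const_mul _).add
        ((integrable_inner_pow hμ _ (by norm_num)).const_mul _)) fun z => ?_
    have : (0 : ℝ) ≤ (lam * ⟪x, z⟫ - ⟪covOp μ x, z⟫) ^ 2 / (2 * lam) := by positivity
    have e : lam / 2 * ⟪x, z⟫ ^ 2 + 1 / (2 * lam) * ⟪covOp μ x, z⟫ ^ 2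
        - ⟪x, z⟫ * ⟪covOp μ x, z⟫ = (lam * ⟪x, z⟫ - ⟪covOp μ x, z⟫) ^ 2 / (2 * lam) := by
      field_simp; ring
    simp only
    linarith
  rw [integral_add ((integrable_inner_pow hμ x (by norm_num)).const_mul _)
      ((integrable_inner_pow hμ _ (by norm_num)).const_mul _), integral_const_mul,
      integral_const_mul, ← quad_eq hμ, ← quad_eq hμ, ← h1] at h2
  have h3 : 1 / (2 * lam) * quad μ (covOp μ x) ≤ ‖covOp μ x‖ ^ 2 / 2 := by
    calc _ ≤ 1 / (2 * lam) * (lam * ‖covOp μ x‖ ^ 2) := by gcongr; exact hl _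
      _ = _ := by field_simp
  linarith

end Covariance

/-! ### Moments of partial sums and of the martingale increments. -/

section PartialSums

variable {Ω : Type*} {mΩ : MeasurableSpace Ω} {P : Measure Ω} [IsProbabilityMeasure P]
variable {V : Type*} [NormedAddCommGroup V] [InnerProductSpace ℝ V] [CompleteSpace V]
  [MeasurableSpace V] [BorelSpace V] [SecondCountableTopology V]

/-- Independent centred random vectors with common law `μ` and finite fourth moments. -/
structure IsCenteredIID (P : Measure Ω) (ξ : ℕ → Ω → V) (μ : Measure V) : Prop where
  indep : iIndepFun ξ P
  aemeasurable : ∀ i, AEMeasurable (ξ i) P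
  map_eq : ∀ i, P.map (ξ i) = μ
  memLp : MemLp id 4 μ
  mean : ∀ x : V, ∫ z, ⟪x, z⟫ ∂μ = 0

/-- Partial sums. -/
def psum (ξ : ℕ → V) (k : ℕ) : V := ∑ i ∈ Finset.range k, ξ i

/-- The off-diagonal sums `∑_{j < i < k} ⟪ξ j, ξ i⟫`. -/
def offDiag (ξ : ℕ → V) (k : ℕ) : ℝ := ∑ i ∈ Finset.range k, ⟪psum ξ i, ξ i⟫

@[fun_prop]
lemma measurable_psum (k : ℕ) : Measurable (fun ξ : ℕ → V => psum ξ k) := by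
  unfold psum; fun_prop

@[fun_prop]
lemma measurable_offDiag (k : ℕ) : Measurable (fun ξ : ℕ → V => offDiag ξ k) := by
  unfold offDiag; fun_prop

lemma psum_congr {ξ η : ℕ → V} {k : ℕ} (h : ∀ i < k, ξ i = η i) : psum ξ k = psum η k :=
  Finset.sum_congr rfl fun i hi => h i (Finset.mem_range.1 hi)

lemma offDiag_congr {ξ η : ℕ → V} {k : ℕ} (h : ∀ i < k, ξ i = η i) :
    offDiag ξ k = offDiag η k :=
  Finset.sum_congr rfl fun i hi => by
    have := Finset.mem_range.1 hi
    rw [h i this, psum_congr fun j hj => h j (hj.trans this)]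

lemma psum_succ (ξ : ℕ → V) (k : ℕ) : psum ξ (k + 1) = psum ξ k + ξ k :=
  Finset.sum_range_succ _ _

lemma offDiag_succ (ξ : ℕ → V) (k : ℕ) :
    offDiag ξ (k + 1) = offDiag ξ k + ⟪psum ξ k, ξ k⟫ :=
  Finset.sum_range_succ _ _

namespace IsCenteredIID

variable {ξ : ℕ → Ω → V} {μ : Measure V} (h : IsCenteredIID P ξ μ)
include h

lemma isProb : IsProbabilityMeasure μ := by
  rw [← h.map_eq 0]
  exact Measure.isProbabilityMeasure_map (h.aemeasurable 0)

lemma integral_comp (i : ℕ) {g : V → ℝ} (hg : StronglyMeasurable g) :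
    ∫ ω, g (ξ i ω) ∂P = ∫ z, g z ∂μ := by
  rw [← h.map_eq i, integral_map (h.aemeasurable i) hg.aestronglyMeasurable]

lemma aemeasurable_seq : AEMeasurable (fun ω i => ξ i ω) P :=
  aemeasurable_pi_lambda _ h.aemeasurable

lemma aemeasurable_psum (k : ℕ) : AEMeasurable (fun ω => psum (fun i => ξ i ω) k) P :=
  (measurable_psum k).comp_aemeasurable h.aemeasurable_seq

lemma aemeasurable_offDiag (k : ℕ) : AEMeasurable (fun ω => offDiag (fun i => ξ i ω) k) P :=
  (measurable_offDiag k).comp_aemeasurable h.aemeasurable_seq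

lemma memLp_apply (i : ℕ) : MemLp (ξ i) 4 P := by
  have := h.memLp
  rw [← h.map_eq i] at this
  exact this.comp_of_map (h.aemeasurable i)

lemma memLp_psum (k : ℕ) : MemLp (fun ω => psum (fun i => ξ i ω) k) 4 P := by
  unfold psum
  exact memLp_finsetSum _ fun i _ => h.memLp_apply i

lemma indepFun_psum (k : ℕ) : IndepFun (fun ω => psum (fun i => ξ i ω) k) (ξ k) P :=
  indepFun_of_past h.indep h.aemeasurable (measurable_psum k) fun _ _ h => psum_congr h

lemma indepFun_offDiag_psum (k : ℕ) :
    IndepFun (fun ω => (offDiag (fun i => ξ i ω) k, psum (fun i => ξ i ω) k)) (ξ k) P :=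
  indepFun_of_past (g := fun x => (offDiag x k, psum x k)) h.indep h.aemeasurable (by fun_prop)
    fun _ _ h => by rw [psum_congr h, offDiag_congr h]

lemma indepFun_inner_psum (x : V) (k : ℕ) :
    IndepFun (fun ω => ⟪x, psum (fun i => ξ i ω) k⟫) (fun ω => ⟪x, ξ k ω⟫) P :=
  (h.indepFun_psum k).comp (φ := fun z => ⟪x, z⟫) (ψ := fun z => ⟪x, z⟫) (by fun_prop)
    (by fun_prop)

lemma integral_inner_psum_sq (x : V) (k : ℕ) :
    ∫ ω, ⟪x, psum (fun i => ξ i ω) k⟫ ^ 2 ∂P = k * quad μ x := by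
  have := h.isProb
  induction k with
  | zero => simp [psum]
  | succ k ih =>
    simp only [psum_succ, inner_add_right]
    rw [integral_add_sq_of_indepFun (h.indepFun_inner_psum x k) ((h.memLp_psum k).const_inner x)
      ((h.memLp_apply k).const_inner x), ih,
      h.integral_comp k (g := fun z => ⟪x, z⟫ ^ 2) (Continuous.stronglyMeasurable (by fun_prop)),
      ← quad_eq h.memLp]
    · push_cast; ring
    · rw [h.integral_comp k (g := fun z => ⟪x, z⟫) (Continuous.stronglyMeasurable (by fun_prop)),
        h.mean]

/-- Induction on `k`: the cross term contributes `8k` times the squared variance, and `4k² + 8k ≤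
4(k + 1)²`. -/
lemma integral_inner_psum_pow_four_le (x : V) (k : ℕ) :
    ∫ ω, ⟪x, psum (fun i => ξ i ω) k⟫ ^ 4 ∂P
      ≤ 4 * k ^ 2 * quad μ x ^ 2 + 3 * k * ∫ z, ⟪x, z⟫ ^ 4 ∂μ := by
  have := h.isProb
  induction k with
  | zero => simp [psum]
  | succ k ih =>
    simp only [psum_succ, inner_add_right]
    refine (integral_add_pow_four_of_indepFun (h.indepFun_inner_psum x k)
      ((h.memLp_psum k).const_inner x) ((h.memLp_apply k).const_inner x) ?_).trans ?_
    · rw [h.integral_comp k (g := fun z => ⟪x, z⟫) (Continuous.stronglyMeasurable (by fun_prop)),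
        h.mean]
    · rw [h.integral_inner_psum_sq x k,
        h.integral_comp k (g := fun z => ⟪x, z⟫ ^ 2) (Continuous.stronglyMeasurable (by fun_prop)),
        h.integral_comp k (g := fun z => ⟪x, z⟫ ^ 4) (Continuous.stronglyMeasurable (by fun_prop)),
        ← quad_eq h.memLp]
      push_cast
      nlinarith [sq_nonneg (quad μ x)]

lemma integrable_norm_mul_norm_pow (k : ℕ) {q : ℕ} (hq : q ≤ 4) :
    Integrable (fun ω => (‖psum (fun i => ξ i ω) k‖ * ‖ξ k ω‖) ^ q) P := by
  have h1 : Integrable (fun ω => ‖psum (fun i => ξ i ω) k‖ ^ q) P :=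
    integrable_pow_of_memLp (X := fun ω => ‖psum (fun i => ξ i ω) k‖) (p := 4)
      (by simpa using (h.memLp_psum k).norm) hq
  have h2 : Integrable (fun ω => ‖ξ k ω‖ ^ q) P :=
    integrable_pow_of_memLp (X := fun ω => ‖ξ k ω‖) (p := 4)
      (by simpa using (h.memLp_apply k).norm) hq
  have hi : IndepFun (fun ω => ‖psum (fun i => ξ i ω) k‖ ^ q) (fun ω => ‖ξ k ω‖ ^ q) P :=
    (h.indepFun_psum k).comp (φ := fun z => ‖z‖ ^ q) (ψ := fun z => ‖z‖ ^ q) (by fun_prop)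
      (by fun_prop)
  simpa only [mul_pow] using! hi.integrable_mul h1 h2

lemma integrable_inner_pow (k : ℕ) {q : ℕ} (hq : q ≤ 4) :
    Integrable (fun ω => ⟪psum (fun i => ξ i ω) k, ξ k ω⟫ ^ q) P := by
  have a1 := h.aemeasurable_psum k
  have a2 := h.aemeasurable k
  refine (h.integrable_norm_mul_norm_pow k hq).mono' (by fun_prop) (ae_of_all _ fun ω => ?_)
  rw [norm_pow]
  gcongr
  exact norm_inner_le_norm _ _

/-- Freeze `ξ k` first: the inner integral is then the variance of the partial sum in that
direction. -/
lemma integral_inner_sq (k : ℕ) :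
    ∫ ω, ⟪psum (fun i => ξ i ω) k, ξ k ω⟫ ^ 2 ∂P = k * covHS μ := by
  have := h.isProb
  have a1 := h.aemeasurable_psum k
  rw [integral_congr_ae (g := fun ω => ⟪ξ k ω, psum (fun i => ξ i ω) k⟫ ^ 2)
    (ae_of_all _ fun ω => by simp only [real_inner_comm])]
  rw [integral_comp_indepFun (F := fun p : V × V => ⟪p.1, p.2⟫ ^ 2) (h.aemeasurable k) a1
    (h.indepFun_psum k).symm (Continuous.stronglyMeasurable (by fun_prop))]
  · simp only
    have e : ∀ x : V, ∫ z, ⟪x, z⟫ ^ 2 ∂(P.map fun ω => psum (fun i => ξ i ω) k) = k * quad μ x := by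
      intro x
      rw [integral_map a1 (by fun_prop), h.integral_inner_psum_sq]
    simp only [e]
    rw [integral_const_mul, h.integral_comp k (continuous_quad μ).stronglyMeasurable, covHS]
  · simpa only [real_inner_comm] using h.integrable_inner_pow k (q := 2) (by norm_num)

/-- The double integral of `integral_inner_sq` taken in the other order, freezing the partial sum.
-/
lemma integral_quad_psum (k : ℕ) :
    ∫ ω, quad μ (psum (fun i => ξ i ω) k) ∂P = k * covHS μ := by
  have := h.isProb
  have a1 := h.aemeasurable_psum k
  rw [← h.integral_inner_sq k]
  rw [integral_comp_indepFun (F := fun p : V × V => ⟪p.1, p.2⟫ ^ 2) a1 (h.aemeasurable k)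
    (h.indepFun_psum k) (Continuous.stronglyMeasurable (by fun_prop))
    (h.integrable_inner_pow k (by norm_num)), h.map_eq]
  simp only [quad_eq h.memLp]

variable {lam : ℝ} (hl : ∀ x, quad μ x ≤ lam * ‖x‖ ^ 2)
include hl

lemma integrable_quad_psum (k : ℕ) : Integrable (fun ω => quad μ (psum (fun i => ξ i ω) k)) P := by
  have := h.isProb
  have a1 := h.aemeasurable_psum k
  have hn : Integrable (fun ω => ‖psum (fun i => ξ i ω) k‖ ^ 2) P :=
    integrable_pow_of_memLp (X := fun ω => ‖psum (fun i => ξ i ω) k‖) (p := 4)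
      (by simpa using (h.memLp_psum k).norm) (by norm_num)
  refine (hn.const_mul lam).mono' ?_ (ae_of_all _ fun ω => ?_)
  · exact ((continuous_quad μ).measurable.comp_aemeasurable a1).aestronglyMeasurable
  · rw [Real.norm_of_nonneg (quad_nonneg h.memLp _)]
    exact hl _

/-- With `ξ k` frozen, the fourth-moment bound for partial sums applies in that direction, and both
its terms are multiples of `‖ξ k‖⁴`. -/
lemma integral_inner_pow_four_le (k : ℕ) :
    ∫ ω, ⟪psum (fun i => ξ i ω) k, ξ k ω⟫ ^ 4 ∂P
      ≤ 4 * k ^ 2 * lam ^ 2 * (∫ z, ‖z‖ ^ 4 ∂μ) + 3 * k * (∫ z, ‖z‖ ^ 4 ∂μ) ^ 2 := by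
  have := h.isProb
  have a1 := h.aemeasurable_psum k
  rw [integral_congr_ae (g := fun ω => ⟪ξ k ω, psum (fun i => ξ i ω) k⟫ ^ 4)
    (ae_of_all _ fun ω => by simp only [real_inner_comm])]
  have hi : Integrable (fun ω => ⟪ξ k ω, psum (fun i => ξ i ω) k⟫ ^ 4) P := by
    simpa only [real_inner_comm] using h.integrable_inner_pow k (q := 4) (by norm_num)
  rw [integral_comp_indepFun (F := fun p : V × V => ⟪p.1, p.2⟫ ^ 4) (h.aemeasurable k) a1
    (h.indepFun_psum k).symm (Continuous.stronglyMeasurable (by fun_prop)) hi]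
  simp only
  have e : ∀ x : V, ∫ z, ⟪x, z⟫ ^ 4 ∂(P.map fun ω => psum (fun i => ξ i ω) k)
      ≤ (4 * k ^ 2 * lam ^ 2 + 3 * k * (∫ z, ‖z‖ ^ 4 ∂μ)) * ‖x‖ ^ 4 := by
    intro x
    rw [integral_map a1 (by fun_prop)]
    refine (h.integral_inner_psum_pow_four_le x k).trans ?_
    have e1 : quad μ x ^ 2 ≤ (lam * ‖x‖ ^ 2) ^ 2 := by
      have := quad_nonneg h.memLp x
      gcongr
      exact hl x
    have e2 : ∫ z, ⟪x, z⟫ ^ 4 ∂μ ≤ ‖x‖ ^ 4 * ∫ z, ‖z‖ ^ 4 ∂μ := by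
      rw [← integral_const_mul]
      refine integral_mono (IVTest.integrable_inner_pow h.memLp x le_rfl)
        ((integrable_norm_pow h.memLp le_rfl).const_mul _) fun z => ?_
      simp only
      rw [← mul_pow, ← (by decide : Even 4).pow_abs]
      gcongr
      exact abs_real_inner_le_norm x z
    calc _ ≤ 4 * k ^ 2 * (lam * ‖x‖ ^ 2) ^ 2 + 3 * k * (‖x‖ ^ 4 * ∫ z, ‖z‖ ^ 4 ∂μ) := by gcongr
      _ = _ := by ring
  have hn : Integrable (fun ω => ‖ξ k ω‖ ^ 4) P :=
    integrable_pow_of_memLp (X := fun ω => ‖ξ k ω‖) (p := 4)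
      (by simpa using (h.memLp_apply k).norm) le_rfl
  calc _ ≤ ∫ ω, (4 * k ^ 2 * lam ^ 2 + 3 * k * (∫ z, ‖z‖ ^ 4 ∂μ)) * ‖ξ k ω‖ ^ 4 ∂P :=
        integral_mono_of_nonneg (ae_of_all _ fun ω => by positivity) (hn.const_mul _)
          (ae_of_all _ fun ω => e _)
    _ = _ := by
      rw [integral_const_mul, h.integral_comp k (g := fun z => ‖z‖ ^ 4)
        (Continuous.stronglyMeasurable (by fun_prop))]
      ring

end IsCenteredIID

end PartialSums

/-! ### Concentration of the conditional variances. -/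

section PartialSums

variable {Ω : Type*} {mΩ : MeasurableSpace Ω} {P : Measure Ω} [IsProbabilityMeasure P]
variable {V : Type*} [NormedAddCommGroup V] [InnerProductSpace ℝ V] [CompleteSpace V]
  [MeasurableSpace V] [BorelSpace V] [SecondCountableTopology V]

lemma memLp_two_of_abs_le_sq {X : Ω → V} (hX : MemLp X 4 P) {g : Ω → ℝ}
    (hg : AEStronglyMeasurable g P) {c : ℝ} (hle : ∀ ω, |g ω| ≤ c * ‖X ω‖ ^ 2) :
    MemLp g 2 P := by
  refine (memLp_two_iff_integrable_sq hg).2 ?_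
  have hn : Integrable (fun ω => ‖X ω‖ ^ 4) P :=
    integrable_pow_of_memLp (X := fun ω => ‖X ω‖) (p := 4) (by simpa using hX.norm) le_rfl
  refine (hn.const_mul (c ^ 2)).mono' (by fun_prop) (ae_of_all _ fun ω => ?_)
  rw [Real.norm_of_nonneg (sq_nonneg _), ← sq_abs]
  calc _ ≤ (c * ‖X ω‖ ^ 2) ^ 2 := by gcongr; exact hle ω
    _ = _ := by ring

namespace IsCenteredIID

variable {ξ : ℕ → Ω → V} {μ : Measure V} (h : IsCenteredIID P ξ μ)
include h

variable {lam : ℝ} (h0 : 0 < lam) (hl : ∀ x, quad μ x ≤ lam * ‖x‖ ^ 2)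
include hl

lemma memLp_quad {X : Ω → V} (hX : MemLp X 4 P) : MemLp (fun ω => quad μ (X ω)) 2 P := by
  have := h.isProb
  refine memLp_two_of_abs_le_sq hX
    ((continuous_quad μ).measurable.comp_aemeasurable hX.aestronglyMeasurable.aemeasurable
      ).aestronglyMeasurable (c := lam) fun ω => ?_
  rw [abs_of_nonneg (quad_nonneg h.memLp _)]
  exact hl _

lemma integral_quad_sq_le (k : ℕ) :
    ∫ ω, quad μ (ξ k ω) ^ 2 ∂P ≤ lam ^ 2 * ∫ z, ‖z‖ ^ 4 ∂μ := by
  have := h.isProb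
  have hn : Integrable (fun ω => ‖ξ k ω‖ ^ 4) P :=
    integrable_pow_of_memLp (X := fun ω => ‖ξ k ω‖) (p := 4)
      (by simpa using (h.memLp_apply k).norm) le_rfl
  rw [← h.integral_comp k (g := fun z => ‖z‖ ^ 4) (Continuous.stronglyMeasurable (by fun_prop)),
    ← integral_const_mul]
  refine integral_mono (h.memLp_quad hl (h.memLp_apply k)).integrable_sq (hn.const_mul _)
    fun ω => ?_
  have := quad_nonneg h.memLp (ξ k ω)
  calc _ ≤ (lam * ‖ξ k ω‖ ^ 2) ^ 2 := by gcongr; exact hl _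
    _ = _ := by ring

include h0

lemma memLp_inner_covOp (k : ℕ) :
    MemLp (fun ω => ⟪covOp μ (psum (fun i => ξ i ω) k), ξ k ω⟫) 2 P := by
  have a1 := h.aemeasurable_psum k
  have a2 := h.aemeasurable k
  refine (memLp_two_iff_integrable_sq (by fun_prop)).2 ?_
  refine ((h.integrable_norm_mul_norm_pow k (q := 2) (by norm_num)).const_mul
    (‖covOp μ‖ ^ 2)).mono' (by fun_prop) (ae_of_all _ fun ω => ?_)
  rw [norm_pow, ← mul_pow, ← mul_assoc]
  gcongr
  exact (norm_inner_le_norm _ _).trans (by gcongr; exact (covOp μ).le_opNorm _)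

/-- Integrating out `ξ k` leaves the variance in the direction `Σ S_k`, which is at most `lam² ⟪Σ
S_k, S_k⟫` by `norm_covOp_sq_le`. The result is linear in `covHS μ`, whereas the squared mean of the
conditional variance is quadratic in it. -/
lemma integral_inner_covOp_sq_le (k : ℕ) :
    ∫ ω, ⟪covOp μ (psum (fun i => ξ i ω) k), ξ k ω⟫ ^ 2 ∂P ≤ k * lam ^ 2 * covHS μ := by
  have := h.isProb
  have a1 := h.aemeasurable_psum k
  rw [integral_comp_indepFun (F := fun p : V × V => ⟪covOp μ p.1, p.2⟫ ^ 2) a1 (h.aemeasurable k)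
    (h.indepFun_psum k) (Continuous.stronglyMeasurable (by fun_prop))
    (h.memLp_inner_covOp h0 hl k).integrable_sq, h.map_eq]
  simp only [← quad_eq h.memLp]
  calc _ ≤ ∫ ω, lam ^ 2 * quad μ (psum (fun i => ξ i ω) k) ∂P := by
        refine integral_mono_of_nonneg (ae_of_all _ fun ω => quad_nonneg h.memLp _)
          ((h.integrable_quad_psum hl k).const_mul _) (ae_of_all _ fun ω => ?_)
        calc _ ≤ lam * ‖covOp μ (psum (fun i => ξ i ω) k)‖ ^ 2 := hl _
          _ ≤ lam * (lam * quad μ (psum (fun i => ξ i ω) k)) := by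
            gcongr; exact norm_covOp_sq_le h.memLp h0 hl _
          _ = _ := by ring
    _ = _ := by rw [integral_const_mul, h.integral_quad_psum]; ring

/-- The centred conditional variance `R` is itself a martingale. Its increment `Q` has mean zero
given the past, so second moments add, and the contributions `8k` of the bilinear part sum to at
most `4k²`. -/
lemma integral_quad_sub_sq_le (k : ℕ) :
    ∫ ω, (quad μ (psum (fun i => ξ i ω) k) - k * covHS μ) ^ 2 ∂P
      ≤ 4 * k ^ 2 * lam ^ 2 * covHS μ + 2 * k * (lam ^ 2 * ∫ z, ‖z‖ ^ 4 ∂μ) := by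
  have := h.isProb
  induction k with
  | zero => simp [psum, quad]
  | succ k ih =>
    have a1 := h.aemeasurable_psum k
    set R : Ω → ℝ := fun ω => quad μ (psum (fun i => ξ i ω) k) - k * covHS μ with hR
    set Q : Ω → ℝ := fun ω => 2 * ⟪covOp μ (psum (fun i => ξ i ω) k), ξ k ω⟫ +
      (quad μ (ξ k ω) - covHS μ) with hQ
    have hq2 : MemLp (fun ω => quad μ (ξ k ω) - covHS μ) 2 P :=
      (h.memLp_quad hl (h.memLp_apply k)).sub (memLp_const _)
    have hB := h.memLp_inner_covOp h0 hl k
    have mR : MemLp R 2 P := (h.memLp_quad hl (h.memLp_psum k)).sub (memLp_const _)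
    have mQ : MemLp Q 2 P := (hB.const_mul 2).add hq2
    have hRQ : Integrable (fun ω => R ω * Q ω) P := mR.integrable_mul mQ
    have e0 : ∫ ω, R ω * Q ω ∂P = 0 := by
      rw [integral_comp_indepFun (F := fun p : V × V => (quad μ p.1 - k * covHS μ) *
        (2 * ⟪covOp μ p.1, p.2⟫ + (quad μ p.2 - covHS μ))) a1 (h.aemeasurable k)
        (h.indepFun_psum k) (Continuous.stronglyMeasurable (by fun_prop)) hRQ, h.map_eq]
      -- Conditional mean of the increment with the past frozen: the linear part is centred, and
      -- `covHS μ` is by definition the mean of `quad μ`.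
      have e1 : ∀ x : V, ∫ z, 2 * ⟪covOp μ x, z⟫ + (quad μ z - covHS μ) ∂μ = 0 := by
        intro x
        have i1 : Integrable (fun z => ⟪covOp μ x, z⟫) μ := by
          simpa using IVTest.integrable_inner_pow h.memLp (covOp μ x) (q := 1) (by norm_num)
        have i2 : Integrable (quad μ) μ := by
          have h2 := (h.memLp_quad hl (h.memLp_apply 0)).integrable (by norm_num)
          rw [← h.map_eq 0]
          exact (integrable_map_measure (continuous_quad _).aestronglyMeasurable
            (h.aemeasurable 0)).2 (by rwa [h.map_eq 0])
        rw [integral_add (by fun_prop) (by fun_prop), integral_const_mul, h.mean,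
          integral_sub i2 (integrable_const _)]
        simp [covHS]
      simp only [integral_const_mul, e1, mul_zero, integral_zero]
    have eq : ∫ ω, (quad μ (psum (fun i => ξ i ω) (k + 1)) - (k + 1 : ℕ) * covHS μ) ^ 2 ∂P
        = ∫ ω, R ω ^ 2 ∂P + ∫ ω, Q ω ^ 2 ∂P := by
      calc _ = ∫ ω, R ω ^ 2 + 2 * (R ω * Q ω) + Q ω ^ 2 ∂P := by
            congr with ω
            rw [psum_succ, quad_add h.memLp]
            simp only [hR, hQ]
            push_cast; ring
        _ = _ := by
          have r2 := mR.integrable_sq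
          rw [integral_add (by fun_prop) mQ.integrable_sq, integral_add r2 (by fun_prop),
            integral_const_mul, e0]
          ring
    have hvar : ∫ ω, (quad μ (ξ k ω) - covHS μ) ^ 2 ∂P ≤ lam ^ 2 * ∫ z, ‖z‖ ^ 4 ∂μ := by
      refine le_trans ?_ (h.integral_quad_sq_le hl k)
      have m1 := h.memLp_quad hl (h.memLp_apply k)
      have i1 := m1.integrable (by norm_num)
      have e2 : ∫ ω, quad μ (ξ k ω) ∂P = covHS μ :=
        h.integral_comp k (continuous_quad μ).stronglyMeasurable
      calc _ = ∫ ω, quad μ (ξ k ω) ^ 2 - 2 * covHS μ * quad μ (ξ k ω) + covHS μ ^ 2 ∂P := by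
            congr with ω; ring
        _ = ∫ ω, quad μ (ξ k ω) ^ 2 ∂P - covHS μ ^ 2 := by
          have r2 := m1.integrable_sq
          rw [integral_add (by fun_prop) (integrable_const _), integral_sub r2 (by fun_prop),
            integral_const_mul, e2]
          simp; ring
        _ ≤ _ := by linarith [sq_nonneg (covHS μ)]
    have hQ2 : ∫ ω, Q ω ^ 2 ∂P ≤ 8 * (k * lam ^ 2 * covHS μ)
        + 2 * (lam ^ 2 * ∫ z, ‖z‖ ^ 4 ∂μ) := by
      calc _ ≤ ∫ ω, 8 * ⟪covOp μ (psum (fun i => ξ i ω) k), ξ k ω⟫ ^ 2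
            + 2 * (quad μ (ξ k ω) - covHS μ) ^ 2 ∂P := by
            refine integral_mono mQ.integrable_sq
              ((hB.integrable_sq.const_mul 8).add (hq2.integrable_sq.const_mul 2)) fun ω => ?_
            simp only [hQ]
            nlinarith [sq_nonneg (2 * ⟪covOp μ (psum (fun i => ξ i ω) k), ξ k ω⟫ -
              (quad μ (ξ k ω) - covHS μ))]
        _ = 8 * ∫ ω, ⟪covOp μ (psum (fun i => ξ i ω) k), ξ k ω⟫ ^ 2 ∂P
            + 2 * ∫ ω, (quad μ (ξ k ω) - covHS μ) ^ 2 ∂P := by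
          rw [integral_add (hB.integrable_sq.const_mul 8) (hq2.integrable_sq.const_mul 2),
            integral_const_mul, integral_const_mul]
        _ ≤ _ := by
          gcongr
          exact h.integral_inner_covOp_sq_le h0 hl k
    rw [eq]
    have := mul_nonneg (sq_nonneg lam) (covHS_nonneg h.memLp)
    push_cast
    nlinarith

/-- Cauchy-Schwarz, in the form that `|R|` has nonnegative variance, with `k` enlarged to `n` so
that one bound serves every step. -/
lemma integral_abs_quad_sub_le {k n : ℕ} (hk : k ≤ n) :
    ∫ ω, |quad μ (psum (fun i => ξ i ω) k) - k * covHS μ| ∂P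
      ≤ √(4 * n ^ 2 * lam ^ 2 * covHS μ + 2 * n * (lam ^ 2 * ∫ z, ‖z‖ ^ 4 ∂μ)) := by
  have := h.isProb
  have mR : MemLp (fun ω => |quad μ (psum (fun i => ξ i ω) k) - k * covHS μ|) 2 P :=
    ((h.memLp_quad hl (h.memLp_psum k)).sub (memLp_const (k * covHS μ))).abs
  refine Real.le_sqrt_of_sq_le ?_
  have hv := variance_nonneg (fun ω => |quad μ (psum (fun i => ξ i ω) k) - k * covHS μ|) P
  rw [variance_eq_sub mR] at hv
  simp only [Pi.pow_apply, sq_abs] at hv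
  have h1 := h.integral_quad_sub_sq_le h0 hl k
  have hq : 0 ≤ lam ^ 2 * ∫ z, ‖z‖ ^ 4 ∂μ := by positivity
  have hF := covHS_nonneg h.memLp
  have hk' : (k : ℝ) ≤ n := by exact_mod_cast hk
  calc _ ≤ _ := sub_nonneg.1 hv
    _ ≤ _ := h1
    _ ≤ _ := by gcongr

end IsCenteredIID

end PartialSums

/-! ### Characteristic function of the off-diagonal sum, one increment at a time. -/

section CharFun

variable {Ω : Type*} {mΩ : MeasurableSpace Ω} {P : Measure Ω} [IsProbabilityMeasure P]
variable {V : Type*} [NormedAddCommGroup V] [InnerProductSpace ℝ V] [CompleteSpace V]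
  [MeasurableSpace V] [BorelSpace V] [SecondCountableTopology V]

lemma norm_integral_mul_le {e : Ω → ℂ} (he : ∀ ω, ‖e ω‖ = 1) {g : Ω → ℂ} {b : Ω → ℝ}
    (hb : Integrable b P) (hg : ∀ ω, ‖g ω‖ ≤ b ω) :
    ‖∫ ω, e ω * g ω ∂P‖ ≤ ∫ ω, b ω ∂P :=
  norm_integral_le_of_norm_le hb (ae_of_all _ fun ω => by rw [norm_mul, he, one_mul]; exact hg ω)

namespace IsCenteredIID

variable {ξ : ℕ → Ω → V} {μ : Measure V} (h : IsCenteredIID P ξ μ)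
include h

/-- The exponential and the partial sum depend only on the past; integrating the independent centred
`ξ k` first kills the product. -/
lemma integral_cexp_mul_inner (s : ℝ) (k : ℕ) :
    ∫ ω, Complex.exp ((s * offDiag (fun i => ξ i ω) k : ℝ) * Complex.I) *
      (⟪psum (fun i => ξ i ω) k, ξ k ω⟫ : ℝ) ∂P = 0 := by
  have := h.isProb
  have a1 := h.aemeasurable_psum k
  have a2 := h.aemeasurable_offDiag k
  have a3 := h.aemeasurable k
  have hi : Integrable (fun ω => ⟪psum (fun i => ξ i ω) k, ξ k ω⟫) P := by
    simpa using h.integrable_inner_pow k (q := 1) (by norm_num)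
  rw [integral_comp_indepFun (F := fun p : (ℝ × V) × V =>
    Complex.exp ((s * p.1.1 : ℝ) * Complex.I) * (⟪p.1.2, p.2⟫ : ℝ)) (a2.prodMk a1) a3
    (h.indepFun_offDiag_psum k) (Continuous.stronglyMeasurable (by fun_prop)), h.map_eq]
  · simp only [integral_const_mul, integral_complex_ofReal, h.mean]
    simp
  · refine hi.norm.mono' (Measurable.comp_aemeasurable (g := fun p : (ℝ × V) × V =>
      Complex.exp ((s * p.1.1 : ℝ) * Complex.I) * (⟪p.1.2, p.2⟫ : ℝ)) (by fun_prop)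
      ((a2.prodMk a1).prodMk a3)).aestronglyMeasurable (ae_of_all _ fun ω => ?_)
    rw [norm_mul, Complex.norm_exp_ofReal_mul_I, one_mul, Complex.norm_real]

/-- Same conditioning as for the linear term: the squared increment is replaced by its conditional
variance. -/
lemma integral_cexp_mul_inner_sq (s : ℝ) (k : ℕ) :
    ∫ ω, Complex.exp ((s * offDiag (fun i => ξ i ω) k : ℝ) * Complex.I) *
      ((⟪psum (fun i => ξ i ω) k, ξ k ω⟫ ^ 2 : ℝ)) ∂P
    = ∫ ω, Complex.exp ((s * offDiag (fun i => ξ i ω) k : ℝ) * Complex.I) *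
      (quad μ (psum (fun i => ξ i ω) k) : ℝ) ∂P := by
  have := h.isProb
  have a1 := h.aemeasurable_psum k
  have a2 := h.aemeasurable_offDiag k
  have a3 := h.aemeasurable k
  have hi := h.integrable_inner_pow k (q := 2) (by norm_num)
  rw [integral_comp_indepFun (F := fun p : (ℝ × V) × V =>
    Complex.exp ((s * p.1.1 : ℝ) * Complex.I) * ((⟪p.1.2, p.2⟫ ^ 2 : ℝ) : ℂ)) (a2.prodMk a1) a3
    (h.indepFun_offDiag_psum k) (Continuous.stronglyMeasurable (by fun_prop)), h.map_eq]
  · simp only [integral_const_mul, integral_complex_ofReal, quad_eq h.memLp]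
  · refine hi.norm.mono' (Measurable.comp_aemeasurable (g := fun p : (ℝ × V) × V =>
      Complex.exp ((s * p.1.1 : ℝ) * Complex.I) * ((⟪p.1.2, p.2⟫ ^ 2 : ℝ) : ℂ)) (by fun_prop)
      ((a2.prodMk a1).prodMk a3)).aestronglyMeasurable (ae_of_all _ fun ω => ?_)
    rw [norm_mul, Complex.norm_exp_ofReal_mul_I, one_mul, Complex.norm_real]

variable {lam : ℝ} (h0 : 0 < lam) (hl : ∀ x, quad μ x ≤ lam * ‖x‖ ^ 2)
include hl h0

/-- One step of the telescoping comparison with the Gaussian characteristic function. -/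
lemma norm_charFun_step_le (s : ℝ) (k : ℕ) :
    ‖∫ ω, Complex.exp ((s * offDiag (fun i => ξ i ω) (k + 1) : ℝ) * Complex.I) ∂P
      - (Real.exp (-(s ^ 2 * (k * covHS μ) / 2)) : ℝ) *
        ∫ ω, Complex.exp ((s * offDiag (fun i => ξ i ω) k : ℝ) * Complex.I) ∂P‖
    ≤ s ^ 2 / 2 * ∫ ω, |quad μ (psum (fun i => ξ i ω) k) - k * covHS μ| ∂P
      + 4 * ∫ ω, |s * ⟪psum (fun i => ξ i ω) k, ξ k ω⟫| ^ 3 ∂P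
      + (s ^ 2 * (k * covHS μ) / 2) ^ 2 := by
  have := h.isProb
  have a1 := h.aemeasurable_psum k
  have a2 := h.aemeasurable_offDiag k
  have a3 := h.aemeasurable k
  -- Half of `s²` times the mean of the conditional variance, that is, the Gaussian exponent due to
  -- this increment.
  set a : ℝ := s ^ 2 * (k * covHS μ) / 2 with ha
  have ha0 : 0 ≤ a := by have := covHS_nonneg h.memLp; positivity
  set e : Ω → ℂ := fun ω => Complex.exp ((s * offDiag (fun i => ξ i ω) k : ℝ) * Complex.I) with he
  set X : Ω → ℝ := fun ω => ⟪psum (fun i => ξ i ω) k, ξ k ω⟫ with hX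
  have ame : AEMeasurable e P := by fun_prop
  have amX : AEMeasurable X P := by fun_prop
  have ne : ∀ ω, ‖e ω‖ = 1 := fun ω => Complex.norm_exp_ofReal_mul_I _
  have ie : Integrable e P :=
    (integrable_const (1 : ℝ)).mono' (by fun_prop) (ae_of_all _ fun ω => (ne ω).le)
  have iX1 : Integrable X P := by simpa using h.integrable_inner_pow k (q := 1) (by norm_num)
  have iX2 : Integrable (fun ω => X ω ^ 2) P := h.integrable_inner_pow k (by norm_num)
  have iX3 : Integrable (fun ω => |s * X ω| ^ 3) P := by
    have := ((h.integrable_inner_pow k (q := 3) (by norm_num)).const_mul (s ^ 3)).abs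
    simpa only [abs_mul, abs_pow, mul_pow] using this
  have iq := h.integrable_quad_psum hl k
  have bdd : ∀ g : Ω → ℝ, Integrable g P → Integrable (fun ω => e ω * (g ω : ℂ)) P := fun g hg =>
    hg.norm.mono' (ame.aestronglyMeasurable.mul
      (Complex.continuous_ofReal.comp_aestronglyMeasurable hg.aestronglyMeasurable))
      (ae_of_all _ fun ω => by rw [norm_mul, ne, one_mul, Complex.norm_real])
  set ρ : Ω → ℂ := fun ω => Complex.exp ((s * X ω : ℝ) * Complex.I)
    - (1 + (s * X ω : ℝ) * Complex.I - ((s * X ω : ℝ) : ℂ) ^ 2 / 2) with hρ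
  have nρ : ∀ ω, ‖ρ ω‖ ≤ 4 * |s * X ω| ^ 3 := fun ω => norm_exp_mul_I_sub_le _
  have iρ : Integrable (fun ω => e ω * ρ ω) P := by
    refine (iX3.const_mul 4).mono' ?_ (ae_of_all _ fun ω => by
      rw [norm_mul, ne, one_mul]; exact nρ ω)
    exact AEMeasurable.aestronglyMeasurable (by fun_prop)
  -- Second-order expansion of the new factor. After integration the linear term vanishes and the
  -- quadratic one becomes the conditional variance. What remains is its deviation from the mean,
  -- the cubic error `ρ` and the gap between `exp (-a)` and `1 - a`.
  have key : ∀ ω, Complex.exp ((s * offDiag (fun i => ξ i ω) (k + 1) : ℝ) * Complex.I)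
      - (Real.exp (-a) : ℝ) * e ω
      = e ω * ρ ω + (s * Complex.I) * (e ω * (X ω : ℂ)) - (s ^ 2 / 2 : ℂ) * (e ω * (X ω ^ 2 : ℝ))
        + (1 - (Real.exp (-a) : ℝ)) * e ω := by
    intro ω
    have : Complex.exp ((s * offDiag (fun i => ξ i ω) (k + 1) : ℝ) * Complex.I)
        = e ω * Complex.exp ((s * X ω : ℝ) * Complex.I) := by
      simp only [he]
      rw [← Complex.exp_add, offDiag_succ]
      congr 1; push_cast; ring
    rw [this]; simp only [hρ]; push_cast; ring
  have ie' : Integrable (fun ω =>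
      Complex.exp ((s * offDiag (fun i => ξ i ω) (k + 1) : ℝ) * Complex.I)) P := by
    have := h.aemeasurable_offDiag (k + 1)
    exact (integrable_const (1 : ℝ)).mono' (AEMeasurable.aestronglyMeasurable (by fun_prop))
      (ae_of_all _ fun ω => (Complex.norm_exp_ofReal_mul_I _).le)
  have z1 : ∫ ω, e ω * (X ω : ℂ) ∂P = 0 := h.integral_cexp_mul_inner s k
  have z2 : ∫ ω, e ω * ((X ω ^ 2 : ℝ) : ℂ) ∂P
      = ∫ ω, e ω * (quad μ (psum (fun i => ξ i ω) k) : ℝ) ∂P := h.integral_cexp_mul_inner_sq s k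
  have b1 := bdd X iX1
  have b2 := bdd _ iX2
  have b3 := bdd _ iq
  have z3 : ∫ ω, e ω * ((quad μ (psum (fun i => ξ i ω) k) - k * covHS μ : ℝ) : ℂ) ∂P
      = ∫ ω, e ω * (quad μ (psum (fun i => ξ i ω) k) : ℝ) ∂P - (k * covHS μ : ℝ) * ∫ ω, e ω ∂P := by
    rw [← integral_const_mul, ← integral_sub b3 (ie.const_mul _)]
    congr with ω; push_cast; ring
  have total : ∫ ω, Complex.exp ((s * offDiag (fun i => ξ i ω) (k + 1) : ℝ) * Complex.I) ∂P
      - (Real.exp (-a) : ℝ) * ∫ ω, e ω ∂P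
      = ∫ ω, e ω * ρ ω ∂P
        - (s ^ 2 / 2 : ℂ) *
          ∫ ω, e ω * ((quad μ (psum (fun i => ξ i ω) k) - k * covHS μ : ℝ) : ℂ) ∂P
        - ((Real.exp (-a) - (1 - a) : ℝ) : ℂ) * ∫ ω, e ω ∂P := by
    rw [← integral_const_mul, ← integral_sub ie' (ie.const_mul _)]
    simp only [key]
    rw [integral_add (by fun_prop) (by fun_prop), integral_sub (by fun_prop) (by fun_prop),
      integral_add iρ (by fun_prop), integral_const_mul, integral_const_mul, integral_const_mul,
      z1, z2, z3]
    have : ((s ^ 2 / 2 : ℂ)) * (k * covHS μ : ℝ) = (a : ℝ) := by rw [ha]; push_cast; ring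
    push_cast at this ⊢
    linear_combination (-∫ ω, e ω ∂P) * this
  have ne1 : ‖∫ ω, e ω ∂P‖ ≤ 1 := by
    have := norm_integral_mul_le (P := P) ne (g := fun _ => 1) (b := fun _ => 1)
      (integrable_const _) (by simp)
    simpa using this
  rw [total]
  refine (norm_sub_le _ _).trans (add_le_add ((norm_sub_le _ _).trans ?_) ?_)
  · rw [add_comm]
    refine add_le_add ?_ ?_
    · rw [norm_mul]
      refine mul_le_mul ?_ (norm_integral_mul_le ne (iq.sub (integrable_const _)).abs fun ω => ?_)
        (norm_nonneg _) (by positivity)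
      · have : (s ^ 2 / 2 : ℂ) = ((s ^ 2 / 2 : ℝ) : ℂ) := by push_cast; ring
        rw [this, Complex.norm_real, Real.norm_of_nonneg (by positivity)]
      · rw [Complex.norm_real]; rfl
    · rw [← integral_const_mul]
      exact norm_integral_mul_le ne (iX3.const_mul 4) nρ
  · rw [norm_mul, Complex.norm_real]
    calc _ ≤ a ^ 2 * 1 := mul_le_mul (abs_exp_neg_sub_le ha0) ne1 (norm_nonneg _) (by positivity)
      _ = _ := mul_one _

/-- The distance of the characteristic function of the off-diagonal sum to a Gaussian one. -/
lemma norm_charFun_offDiag_sub_le (s : ℝ) (n : ℕ) {ε : ℝ} (hε : 0 < ε) {q : ℝ}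
    (hq : ∫ z, ‖z‖ ^ 4 ∂μ ≤ q) :
    ‖∫ ω, Complex.exp ((s * offDiag (fun i => ξ i ω) n : ℝ) * Complex.I) ∂P
      - (Real.exp (-(s ^ 2 * covHS μ / 2 * ∑ i ∈ Finset.range n, (i : ℝ))) : ℝ)‖
    ≤ n * (s ^ 2 / 2 * √(4 * n ^ 2 * lam ^ 2 * covHS μ + 2 * n * (lam ^ 2 * q))
      + 4 * (ε * (s ^ 2 * (n * covHS μ))
        + s ^ 4 * (4 * n ^ 2 * lam ^ 2 * q + 3 * n * q ^ 2) / ε)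
      + (s ^ 2 * (n * covHS μ) / 2) ^ 2) := by
  have := h.isProb
  have hF := covHS_nonneg h.memLp
  have hq0 : 0 ≤ q := le_trans (by positivity) hq
  set B : ℝ := s ^ 2 / 2 * √(4 * n ^ 2 * lam ^ 2 * covHS μ + 2 * n * (lam ^ 2 * q))
      + 4 * (ε * (s ^ 2 * (n * covHS μ))
        + s ^ 4 * (4 * n ^ 2 * lam ^ 2 * q + 3 * n * q ^ 2) / ε)
      + (s ^ 2 * (n * covHS μ) / 2) ^ 2 with hB
  have step : ∀ k < n,
      ‖∫ ω, Complex.exp ((s * offDiag (fun i => ξ i ω) (k + 1) : ℝ) * Complex.I) ∂P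
      - (Real.exp (-(s ^ 2 * (k * covHS μ) / 2)) : ℝ) *
        ∫ ω, Complex.exp ((s * offDiag (fun i => ξ i ω) k : ℝ) * Complex.I) ∂P‖ ≤ B := by
    intro k hk
    have hk' : (k : ℝ) ≤ n := by exact_mod_cast hk.le
    refine (h.norm_charFun_step_le h0 hl s k).trans ?_
    refine add_le_add (add_le_add ?_ ?_) ?_
    · gcongr
      refine (h.integral_abs_quad_sub_le h0 hl hk.le).trans ?_
      gcongr
    · refine mul_le_mul_of_nonneg_left ?_ (by norm_num)
      have i2 := h.integrable_inner_pow k (q := 2) (by norm_num)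
      have i4 := h.integrable_inner_pow k (q := 4) (by norm_num)
      -- The third moment is split by `abs_cube_le`: the second moment is known exactly and the
      -- fourth is bounded.
      calc _ ≤ ∫ ω, ε * s ^ 2 * ⟪psum (fun i => ξ i ω) k, ξ k ω⟫ ^ 2
            + s ^ 4 / ε * ⟪psum (fun i => ξ i ω) k, ξ k ω⟫ ^ 4 ∂P := by
            refine integral_mono_of_nonneg (ae_of_all _ fun ω => by positivity)
              ((i2.const_mul _).add (i4.const_mul _)) (ae_of_all _ fun ω => ?_)
            refine (abs_cube_le hε _).trans_eq ?_
            rw [mul_pow, mul_pow]; ring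
        _ = ε * s ^ 2 * (k * covHS μ)
            + s ^ 4 / ε * ∫ ω, ⟪psum (fun i => ξ i ω) k, ξ k ω⟫ ^ 4 ∂P := by
            rw [integral_add (by fun_prop) (by fun_prop), integral_const_mul, integral_const_mul,
              h.integral_inner_sq]
        _ ≤ ε * s ^ 2 * (n * covHS μ)
            + s ^ 4 / ε * (4 * n ^ 2 * lam ^ 2 * q + 3 * n * q ^ 2) := by
            gcongr
            refine (h.integral_inner_pow_four_le hl k).trans ?_
            have : 0 ≤ ∫ z, ‖z‖ ^ 4 ∂μ := by positivity
            gcongr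
        _ = _ := by ring
    · gcongr
  -- Telescoping: each Gaussian factor lies in `[0, 1]`, so the errors of the individual steps add
  -- up without amplification.
  have main : ∀ k ≤ n,
      ‖∫ ω, Complex.exp ((s * offDiag (fun i => ξ i ω) k : ℝ) * Complex.I) ∂P
      - (Real.exp (-(s ^ 2 * covHS μ / 2 * ∑ i ∈ Finset.range k, (i : ℝ))) : ℝ)‖ ≤ k * B := by
    intro k
    induction k with
    | zero => intro _; simp [offDiag]
    | succ k ih =>
      intro hk
      have h1 := ih (by omega)
      have h2 := step k (by omega)
      rw [Finset.sum_range_succ]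
      have e : Real.exp (-(s ^ 2 * covHS μ / 2 * (∑ i ∈ Finset.range k, (i : ℝ) + k)))
          = Real.exp (-(s ^ 2 * (k * covHS μ) / 2)) *
            Real.exp (-(s ^ 2 * covHS μ / 2 * ∑ i ∈ Finset.range k, (i : ℝ))) := by
        rw [← Real.exp_add]; congr 1; ring
      have hexp : ‖((Real.exp (-(s ^ 2 * (k * covHS μ) / 2)) : ℝ) : ℂ)‖ ≤ 1 := by
        rw [Complex.norm_real, Real.norm_of_nonneg (Real.exp_pos _).le]
        exact Real.exp_le_one_iff.2 (by have : 0 ≤ s ^ 2 * (k * covHS μ) / 2 := by positivity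
                                        linarith)
      rw [e]
      set c : ℂ := ((Real.exp (-(s ^ 2 * (k * covHS μ) / 2)) : ℝ) : ℂ)
      calc _ = ‖(∫ ω, Complex.exp ((s * offDiag (fun i => ξ i ω) (k + 1) : ℝ) * Complex.I) ∂P
            - c * ∫ ω, Complex.exp ((s * offDiag (fun i => ξ i ω) k : ℝ) * Complex.I) ∂P)
            + c * (∫ ω, Complex.exp ((s * offDiag (fun i => ξ i ω) k : ℝ) * Complex.I) ∂P
            - (Real.exp (-(s ^ 2 * covHS μ / 2 * ∑ i ∈ Finset.range k, (i : ℝ))) : ℝ))‖ := by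
            congr 1; rw [Complex.ofReal_mul]; ring
        _ ≤ B + 1 * (k * B) := by
            refine (norm_add_le _ _).trans (add_le_add h2 ?_)
            rw [norm_mul]
            exact mul_le_mul hexp h1 (norm_nonneg _) zero_le_one
        _ = _ := by push_cast; ring
  exact main n le_rfl

end IsCenteredIID

end CharFun

/-! ### The central limit theorem for the off-diagonal sum. -/

section CLT

variable {Ω : Type*} {mΩ : MeasurableSpace Ω} {P : Measure Ω} [IsProbabilityMeasure P]

lemma sum_range_cast (n : ℕ) : ∑ i ∈ Finset.range n, (i : ℝ) = n * (n - 1) / 2 := by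
  induction n with
  | zero => simp
  | succ n ih => rw [Finset.sum_range_succ, ih]; push_cast; ring

/-- The error bound of the normal approximation, in terms of `u = 1 / F`, `w = q / n`,
`v = 1 / n`. -/
lemma approx_bound_eq {t F q lam ε : ℝ} {n : ℕ} (hn : 0 < n) (hF : 0 < F) (hε : 0 < ε)
    (s : ℝ) (hs : s ^ 2 = 2 * t ^ 2 / (n ^ 2 * F)) :
    n * (s ^ 2 / 2 * √(4 * n ^ 2 * lam ^ 2 * F + 2 * n * (lam ^ 2 * q))
      + 4 * (ε * (s ^ 2 * (n * F)) + s ^ 4 * (4 * n ^ 2 * lam ^ 2 * q + 3 * n * q ^ 2) / ε)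
      + (s ^ 2 * (n * F) / 2) ^ 2)
    = t ^ 2 * √(4 * lam ^ 2 * F⁻¹ + 2 * lam ^ 2 * (q / n) * F⁻¹ ^ 2) + 8 * ε * t ^ 2
      + 16 * t ^ 4 / ε * (4 * lam ^ 2 * (q / n) + 3 * (q / n) ^ 2) * F⁻¹ ^ 2
      + t ^ 4 * (n : ℝ)⁻¹ := by
  have hn' : (0 : ℝ) < n := by exact_mod_cast hn
  have e : 4 * n ^ 2 * lam ^ 2 * F + 2 * n * (lam ^ 2 * q)
      = (n * F) ^ 2 * (4 * lam ^ 2 * F⁻¹ + 2 * lam ^ 2 * (q / n) * F⁻¹ ^ 2) := by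
    field_simp
  have h4 : s ^ 4 = (2 * t ^ 2 / (n ^ 2 * F)) ^ 2 := by rw [← hs]; ring
  rw [e, Real.sqrt_mul (by positivity), Real.sqrt_sq (by positivity), hs, h4]
  set S := √(4 * lam ^ 2 * F⁻¹ + 2 * lam ^ 2 * (q / n) * F⁻¹ ^ 2)
  field_simp
  ring

/-- Central limit theorem for degenerate quadratic forms in a triangular array. -/
theorem tendstoInDistribution_offDiag {m : ℕ → ℕ} {μ : ∀ n, Measure (E (m n))}
    {ξ : ∀ n, ℕ → Ω → E (m n)} (h : ∀ n, IsCenteredIID P (ξ n) (μ n)) {lam : ℝ} (h0 : 0 < lam)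
    (hl : ∀ n x, quad (μ n) x ≤ lam * ‖x‖ ^ 2) {q : ℕ → ℝ}
    (hq : ∀ n, ∫ z, ‖z‖ ^ 4 ∂(μ n) ≤ q n) (hqn : Tendsto (fun n => q n / n) atTop (𝓝 0))
    (hF : Tendsto (fun n => covHS (μ n)) atTop atTop) :
    TendstoInDistribution
      (fun (n : ℕ) ω => √2 / (n * √(covHS (μ n))) * offDiag (fun i => ξ n i ω) n)
      atTop (id : ℝ → ℝ) (fun _ => P) (gaussianReal 0 1) where
  forall_aemeasurable n := ((h n).aemeasurable_offDiag n).const_mul _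
  tendsto := by
    refine ProbabilityMeasure.tendsto_iff_tendsto_charFun.2 fun t => ?_
    simp only [ProbabilityMeasure.coe_mk, Measure.map_id, charFun_gaussianReal]
    -- Since `∑_{i<n} i = n(n-1)/2`, the approximating Gaussian exponent is `t²/2` only up to the
    -- factor `1 - 1/n`.
    have hlim : Tendsto (fun n : ℕ => ((Real.exp (-(t ^ 2 / 2 * (1 - (n : ℝ)⁻¹))) : ℝ) : ℂ)) atTop
        (𝓝 (Complex.exp (t * (0 : ℝ) * Complex.I - ((1 : NNReal) : ℝ) * t ^ 2 / 2))) := by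
      have : Complex.exp (t * (0 : ℝ) * Complex.I - ((1 : NNReal) : ℝ) * t ^ 2 / 2)
          = ((Real.exp (-(t ^ 2 / 2 * (1 - 0))) : ℝ) : ℂ) := by
        push_cast; congr 1; simp
      rw [this]
      refine (Complex.continuous_ofReal.tendsto _).comp ((Real.continuous_exp.tendsto _).comp ?_)
      exact ((tendsto_const_nhds.sub tendsto_inv_atTop_nhds_zero_nat).const_mul _).neg
    have hdiff : Tendsto (fun n : ℕ =>
        charFun (P.map fun ω => √2 / (n * √(covHS (μ n))) * offDiag (fun i => ξ n i ω) n) t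
        - ((Real.exp (-(t ^ 2 / 2 * (1 - (n : ℝ)⁻¹))) : ℝ) : ℂ)) atTop (𝓝 0) := by
      rw [NormedAddGroup.tendsto_nhds_zero]
      intro δ hδ
      -- The term `8 * ε * t ^ 2` is the only part of the error bound that does not vanish as `n →
      -- ∞`, so `ε` is chosen before `n`.
      obtain ⟨ε, hε, hεδ⟩ : ∃ ε : ℝ, 0 < ε ∧ 8 * ε * t ^ 2 < δ := by
        refine ⟨δ / (8 * (t ^ 2 + 1)), by positivity, ?_⟩
        have : 8 * (δ / (8 * (t ^ 2 + 1))) * t ^ 2 = δ * (t ^ 2 / (t ^ 2 + 1)) := by field_simp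
        rw [this]
        have : t ^ 2 / (t ^ 2 + 1) < 1 := (div_lt_one (by positivity)).2 (by linarith)
        nlinarith
      have hu : Tendsto (fun n => (covHS (μ n))⁻¹) atTop (𝓝 0) := hF.inv_tendsto_atTop
      have hb : Tendsto (fun n : ℕ => t ^ 2 * √(4 * lam ^ 2 * (covHS (μ n))⁻¹
          + 2 * lam ^ 2 * (q n / n) * (covHS (μ n))⁻¹ ^ 2) + 8 * ε * t ^ 2
          + 16 * t ^ 4 / ε * (4 * lam ^ 2 * (q n / n) + 3 * (q n / n) ^ 2) * (covHS (μ n))⁻¹ ^ 2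
          + t ^ 4 * (n : ℝ)⁻¹) atTop (𝓝 (t ^ 2 * √(4 * lam ^ 2 * 0
          + 2 * lam ^ 2 * 0 * 0 ^ 2) + 8 * ε * t ^ 2
          + 16 * t ^ 4 / ε * (4 * lam ^ 2 * 0 + 3 * 0 ^ 2) * 0 ^ 2
          + t ^ 4 * 0)) := by
        refine Tendsto.add (Tendsto.add (Tendsto.add (Tendsto.const_mul _ (Tendsto.sqrt
          ((hu.const_mul _).add ((hqn.const_mul _).mul (hu.pow 2))))) tendsto_const_nhds) ?_)
          (tendsto_inv_atTop_nhds_zero_nat.const_mul _)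
        exact (((hqn.const_mul _).add ((hqn.pow 2).const_mul _)).const_mul _).mul (hu.pow 2)
      have hb' := hb.eventually_lt_const (u := δ) (by simpa using hεδ)
      filter_upwards [hb', eventually_gt_atTop 0, hF.eventually_gt_atTop 0] with n hn hn0 hFn
      have hn' : (0 : ℝ) < n := by exact_mod_cast hn0
      refine lt_of_le_of_lt ?_ hn
      set s : ℝ := t * (√2 / (n * √(covHS (μ n)))) with hs
      have hs2 : s ^ 2 = 2 * t ^ 2 / (n ^ 2 * covHS (μ n)) := by
        rw [hs, mul_pow, div_pow, mul_pow, Real.sq_sqrt hFn.le, Real.sq_sqrt (by norm_num)]; ring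
      rw [← approx_bound_eq hn0 hFn hε s hs2]
      refine le_trans (le_of_eq ?_)
        ((h n).norm_charFun_offDiag_sub_le h0 (hl n) s n hε (hq n))
      have e1 : s ^ 2 * covHS (μ n) / 2 * ∑ i ∈ Finset.range n, (i : ℝ)
          = t ^ 2 / 2 * (1 - (n : ℝ)⁻¹) := by
        rw [sum_range_cast, hs2]; field_simp
      have am := (h n).aemeasurable_offDiag n
      rw [e1, charFun_apply_real, integral_map (am.const_mul _)
        (Continuous.aestronglyMeasurable (by fun_prop))]
      congr 4 with ω
      rw [hs]; push_cast; ring_nf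
    simpa using hdiff.add hlim

end CLT

/-! ### Taylor expansion from partial derivatives, with a measurable envelope for the remainder. -/

section Taylor

variable {k : ℕ}

/-- A function with bounded partial derivatives on a ball is Lipschitz from the centre. -/
lemma abs_sub_le_of_partialDeriv_le {h : E k → ℝ} {a x : E k} {C : ℝ} (hC : 0 ≤ C)
    (hd : ∀ p ∈ Metric.closedBall a ‖x - a‖, ∀ l : Fin k,
      LineDifferentiableAt ℝ h p (EuclideanSpace.single l 1) ∧ |partialDeriv h l p| ≤ C) :
    |h x - h a| ≤ k * C * ‖x - a‖ := by
  -- Coordinates in `s` come from `x`, the others from `a`. Only partial derivatives are available,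
  -- so the path from `a` to `x` changes one coordinate at a time. No coordinate ever moves further
  -- from `a` than that of `x`, so the path stays in the ball.
  let p : Finset (Fin k) → E k := fun s => WithLp.toLp 2 fun i => if i ∈ s then x i else a i
  have hp : ∀ s : Finset (Fin k), |h (p s) - h a| ≤ s.card * (C * ‖x - a‖) := by
    intro s
    induction s using Finset.induction with
    | empty =>
      have : p ∅ = a := by ext i; simp [p]
      simp [this]
    | insert l s hl ih =>
      set q : ℝ → E k := fun t => p s + t • EuclideanSpace.single l 1 with hq
      have hq1 : q (x l - a l) = p (insert l s) := by
        ext i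
        by_cases hi : i = l
        · subst hi; simp [q, p, hl]
        · simp [q, p, hi]
      have hq0 : q 0 = p s := by simp [q]
      have hmem : ∀ t ∈ Set.uIcc 0 (x l - a l), q t ∈ Metric.closedBall a ‖x - a‖ := by
        intro t ht
        have ht' : |t| ≤ |x l - a l| := by
          simpa using Set.abs_sub_left_of_mem_uIcc ht
        rw [Metric.mem_closedBall, dist_eq_norm, EuclideanSpace.norm_eq, EuclideanSpace.norm_eq]
        refine Real.sqrt_le_sqrt (Finset.sum_le_sum fun i _ => ?_)
        refine pow_le_pow_left₀ (norm_nonneg _) ?_ 2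
        by_cases hi : i = l
        · subst hi; simpa [q, p, hl] using ht'
        · by_cases his : i ∈ s
          · simp [q, p, hi, his]
          · simp [q, p, hi, his]
      have hder : ∀ t ∈ Set.uIcc 0 (x l - a l),
          HasDerivWithinAt (fun t => h (q t)) (partialDeriv h l (q t))
            (Set.uIcc 0 (x l - a l)) t := by
        intro t ht
        have h1 := (hd _ (hmem t ht) l).1.hasLineDerivAt
        have h2 : HasDerivAt (fun u => h (q t + (u - t) • EuclideanSpace.single l 1))
            (partialDeriv h l (q t)) t := by
          have h3 : HasDerivAt (fun u : ℝ => h (q t + u • EuclideanSpace.single l 1))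
            (partialDeriv h l (q t)) (t - t) := by
            rw [sub_self]; exact h1
          simpa using h3.comp_sub_const t t
        refine (h2.congr_of_eventuallyEq (Eventually.of_forall fun u => ?_)).hasDerivWithinAt
        simp only [q]
        congr 1
        rw [add_assoc, ← add_smul]; congr 2; ring
      have hmvt := (convex_uIcc (𝕜 := ℝ) 0 (x l - a l)).norm_image_sub_le_of_norm_hasDerivWithin_le
        hder (fun t ht => (hd _ (hmem t ht) l).2) Set.left_mem_uIcc Set.right_mem_uIcc
      rw [hq1, hq0, sub_zero] at hmvt
      have hcoord : ‖x l - a l‖ ≤ ‖x - a‖ := by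
        simpa using PiLp.norm_apply_le (x - a) l
      rw [Finset.card_insert_of_notMem hl]
      calc _ ≤ |h (p (insert l s)) - h (p s)| + |h (p s) - h a| := abs_sub_le _ _ _
        _ ≤ C * ‖x - a‖ + s.card * (C * ‖x - a‖) := by
          refine add_le_add (hmvt.trans ?_) ih
          gcongr
        _ = _ := by push_cast; ring
  have hu := hp Finset.univ
  have : p Finset.univ = x := by ext i; simp [p]
  rw [this] at hu
  simpa [mul_assoc] using hu

/-- The gradient assembled from the partial derivatives. -/
noncomputable def partialGrad (g : E k → ℝ) (a : E k) : E k :=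
  WithLp.toLp 2 fun l => partialDeriv g l a

lemma inner_partialGrad_single (g : E k → ℝ) (a : E k) (l : Fin k) :
    ⟪partialGrad g a, EuclideanSpace.single l 1⟫ = partialDeriv g l a := by
  simp [partialGrad, EuclideanSpace.inner_single_right]

/-- Second-order Taylor bound under bounds on the second-order partial derivatives. -/
lemma abs_taylor_remainder_le {g : E k → ℝ} {O : Set (E k)} (hg : TwicePartialDiffOn g O)
    {a : E k} {r : ℝ} (hO : Metric.ball a r ⊆ O) {H : ℝ} (hH0 : 0 ≤ H)
    (hH : ∀ j l : Fin k, ∀ θ ∈ O, |partialDeriv (partialDeriv g l) j θ| ≤ H)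
    {x : E k} (hx : x ∈ Metric.ball a r) :
    |g x - g a - ⟪partialGrad g a, x - a⟫| ≤ (k ^ 2 + 1) * H * ‖x - a‖ ^ 2 := by
  have hsub : ∀ y ∈ Metric.ball a r, Metric.closedBall a ‖y - a‖ ⊆ O := fun y hy p hp =>
    hO (Metric.mem_ball.2 (lt_of_le_of_lt (Metric.mem_closedBall.1 hp)
      (by rwa [← dist_eq_norm, ← Metric.mem_ball])))
  have h1 : ∀ y ∈ Metric.ball a r, ∀ l,
      |partialDeriv g l y - partialDeriv g l a| ≤ k * H * ‖y - a‖ := fun y hy l =>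
    abs_sub_le_of_partialDeriv_le hH0 fun p hp j =>
      ⟨(hg p (hsub y hy hp)).2 j l, hH j l p (hsub y hy hp)⟩
  -- Subtracting the linear part makes the partial derivatives of the difference at most `k * H * ‖x
  -- - a‖` by `h1`, and the first-order bound applies a second time.
  have h2 := abs_sub_le_of_partialDeriv_le (h := fun θ => g θ - ⟪partialGrad g a, θ⟫) (a := a)
    (x := x) (C := k * H * ‖x - a‖) (by positivity) fun p hp l => by
      have hl : HasLineDerivAt ℝ (fun θ => ⟪partialGrad g a, θ⟫) (partialDeriv g l a) p
          (EuclideanSpace.single l 1) := by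
        have := ((innerSL ℝ (partialGrad g a)).hasFDerivAt (x := p)).hasLineDerivAt
          (EuclideanSpace.single l 1)
        rwa [innerSL_apply_apply, inner_partialGrad_single] at this
      have hd := (hg p (hsub x hx hp)).1 l
      have hs : HasLineDerivAt ℝ (fun θ => g θ - ⟪partialGrad g a, θ⟫)
          (partialDeriv g l p - partialDeriv g l a) p (EuclideanSpace.single l 1) :=
        hd.hasLineDerivAt.sub hl
      refine ⟨hs.lineDifferentiableAt, ?_⟩
      rw [partialDeriv, hs.lineDeriv]
      have hp' : p ∈ Metric.ball a r := Metric.mem_ball.2 (lt_of_le_of_lt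
        (Metric.mem_closedBall.1 hp) (by rwa [← dist_eq_norm, ← Metric.mem_ball]))
      refine (h1 p hp' l).trans ?_
      gcongr
      rw [← dist_eq_norm]; exact hp
  calc _ = |g x - ⟪partialGrad g a, x⟫ - (g a - ⟪partialGrad g a, a⟫)| := by
        rw [inner_sub_right]; congr 1; ring
    _ ≤ k * (k * H * ‖x - a‖) * ‖x - a‖ := h2
    _ = k ^ 2 * H * ‖x - a‖ ^ 2 := by ring
    -- The extra `1` keeps the constant positive for every `k`, as needed when it multiplies an
    -- infinite bound in `taylorEnvelope_pow_four_le`.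
    _ ≤ _ := by gcongr; linarith

/-- The point of the rational grid with coordinates `q`. -/
noncomputable def ratPoint (q : Fin k → ℚ) : E k := WithLp.toLp 2 fun i => (q i : ℝ)

/-- A closed condition on a function with first-order partial derivatives on a ball extends from
the rational points of the ball to the whole ball. -/
lemma le_of_forall_ratPoint {h b : E k → ℝ} {a : E k} {r : ℝ}
    (hd : ∀ θ ∈ Metric.ball a r, ∀ l : Fin k,
      LineDifferentiableAt ℝ h θ (EuclideanSpace.single l 1)) (hb : Continuous b)
    (hq : ∀ q : Fin k → ℚ, ratPoint q ∈ Metric.ball a r → |h (ratPoint q)| ≤ b (ratPoint q))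
    {x : E k} (hx : x ∈ Metric.ball a r) : |h x| ≤ b x := by
  -- Partial differentiability gives continuity along coordinate lines but not joint continuity. The
  -- coordinates are therefore released from rationality one at a time, `s` being the set of those
  -- already free.
  have key : ∀ s : Finset (Fin k), ∀ y ∈ Metric.ball a r,
      (∀ i ∉ s, ∃ q : ℚ, y i = q) → |h y| ≤ b y := by
    intro s
    induction s using Finset.induction with
    | empty =>
      intro y hy hrat
      choose q hq' using fun i => hrat i (by simp)
      have : y = ratPoint q := by ext i; simp [ratPoint, hq']
      rw [this] at hy ⊢
      exact hq q hy
    | insert l s hl ih =>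
      intro y hy hrat
      set e : E k := EuclideanSpace.single l 1 with he
      have hc : ContinuousAt (fun t : ℝ => h (y + t • e)) 0 :=
        HasDerivAt.continuousAt (hd y hy l).hasLineDerivAt
      have hcy : Continuous fun t : ℝ => y + t • e := by fun_prop
      obtain ⟨u, -, hu, hut⟩ := Real.exists_seq_rat_strictMono_tendsto (y l)
      have hv : Tendsto (fun n => (u n : ℝ) - y l) atTop (𝓝 0) := by
        simpa using hut.sub_const (y l)
      have hy0 : y + (0 : ℝ) • e = y := by simp
      have l1 : Tendsto (fun n => |h (y + ((u n : ℝ) - y l) • e)|) atTop (𝓝 |h y|) := by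
        have := (hc.tendsto.comp hv).abs
        simpa only [hy0] using! this
      have l2 : Tendsto (fun n => b (y + ((u n : ℝ) - y l) • e)) atTop (𝓝 (b y)) := by
        have := ((hb.comp hcy).tendsto' 0 (b y) (by simp)).comp hv
        exact this
      have l3 : ∀ᶠ n in atTop, y + ((u n : ℝ) - y l) • e ∈ Metric.ball a r := by
        have := (hcy.tendsto 0).comp hv
        rw [hy0] at this
        exact this.eventually (Metric.isOpen_ball.mem_nhds hy)
      refine le_of_tendsto_of_tendsto l1 l2 (l3.mono fun n hn => ih _ hn fun i hi => ?_)
      by_cases hil : i = l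
      · subst hil; exact ⟨u n, by simp [he]⟩
      · obtain ⟨q, hq⟩ := hrat i (by simp [hil, hi])
        exact ⟨q, by simp [he, hil, hq]⟩
  exact key Finset.univ x hx (by simp)

/-- The derivative is a pointwise limit of difference quotients with steps `1 / (n + 1)`, each
measurable in `z`. -/
lemma measurable_partialDeriv {dz : ℕ} {φ : E dz → E k → ℝ}
    (hφ : Measurable (fun q : E dz × E k => φ q.1 q.2)) {a : E k} {l : Fin k}
    (hd : ∀ z, LineDifferentiableAt ℝ (φ z) a (EuclideanSpace.single l 1)) :
    Measurable fun z => partialDeriv (φ z) l a := by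
  have hm : ∀ θ, Measurable fun z => φ z θ := fun θ => hφ.comp measurable_prodMk_right
  refine measurable_of_tendsto_metrizable (f := fun (n : ℕ) z =>
    ((n : ℝ) + 1) * (φ z (a + ((n : ℝ) + 1)⁻¹ • EuclideanSpace.single l 1) - φ z a)) ?_ ?_
  · intro n
    exact ((hm _).sub (hm _)).const_mul _
  · refine tendsto_pi_nhds.2 fun z => ?_
    have h1 := HasDerivAt.tendsto_slope_zero (hd z).hasLineDerivAt
    have h2 : Tendsto (fun n : ℕ => ((n : ℝ) + 1)⁻¹) atTop (𝓝[≠] 0) := by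
      refine tendsto_nhdsWithin_iff.2 ⟨?_, Eventually.of_forall fun n => ?_⟩
      · simpa using tendsto_one_div_add_atTop_nhds_zero_nat (𝕜 := ℝ)
      · simp only [Set.mem_compl_iff, Set.mem_singleton_iff, inv_eq_zero]; positivity
    simpa [Function.comp_def, partialDeriv] using h1.comp h2

/-- The second-order Taylor remainder of `φ z` at `a`. -/
noncomputable def taylorRem {dz : ℕ} (φ : E dz → E k → ℝ) (a : E k) (z : E dz) (θ : E k) : ℝ :=
  φ z θ - φ z a - ⟪partialGrad (φ z) a, θ - a⟫

/-- The supremum of the normalized Taylor remainder over the rational points of a ball. -/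
noncomputable def taylorEnvelope {dz : ℕ} (φ : E dz → E k → ℝ) (a : E k) (r : ℝ) (z : E dz) :
    ENNReal :=
  open scoped Classical in
  ⨆ q : Fin k → ℚ, if ratPoint q ∈ Metric.ball a r then
    ENNReal.ofReal (|taylorRem φ a z (ratPoint q)| / ‖ratPoint q - a‖ ^ 2) else 0

/-- A supremum over rational points is countable, so the envelope is measurable in `z` itself and
its moments carry over to each copy of `Z`. For the supremum of second derivatives, measurability is
assumed only along `Z`. -/
lemma measurable_taylorEnvelope {dz : ℕ} {φ : E dz → E k → ℝ}
    (hφ : Measurable (fun q : E dz × E k => φ q.1 q.2)) {a : E k} (r : ℝ)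
    (hd : ∀ z l, LineDifferentiableAt ℝ (φ z) a (EuclideanSpace.single l 1)) :
    Measurable (taylorEnvelope φ a r) := by
  have hm : ∀ θ, Measurable fun z => φ z θ := fun θ => hφ.comp measurable_prodMk_right
  have hg : Measurable fun z => partialGrad (φ z) a :=
    (PiLp.continuous_toLp 2 _).measurable.comp
      (measurable_pi_lambda _ fun l => measurable_partialDeriv hφ fun z => hd z l)
  refine Measurable.iSup fun q => ?_
  split_ifs
  · refine ENNReal.measurable_ofReal.comp (Measurable.div_const (Measurable.abs ?_) _)
    exact ((hm _).sub (hm _)).sub (by fun_prop)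
  · exact measurable_const

/-- At rational points the bound is the definition of the envelope; the remainder is partially
differentiable in the parameter, so `le_of_forall_ratPoint` extends it to the ball. -/
lemma abs_taylorRem_le_taylorEnvelope {dz : ℕ} {φ : E dz → E k → ℝ} {a : E k} {r : ℝ}
    {O : Set (E k)} {z : E dz} (hg : TwicePartialDiffOn (φ z) O) (hO : Metric.ball a r ⊆ O)
    (hz : taylorEnvelope φ a r z < ⊤) {x : E k} (hx : x ∈ Metric.ball a r) :
    |taylorRem φ a z x| ≤ (taylorEnvelope φ a r z).toReal * ‖x - a‖ ^ 2 := by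
  refine le_of_forall_ratPoint (h := taylorRem φ a z)
    (b := fun x => (taylorEnvelope φ a r z).toReal * ‖x - a‖ ^ 2) ?_ (by fun_prop) ?_ hx
  · intro θ hθ l
    have hl := ((innerSL ℝ (partialGrad (φ z) a)).hasFDerivAt (x := θ)).hasLineDerivAt
      (EuclideanSpace.single l 1)
    have hs : HasLineDerivAt ℝ (fun θ => φ z θ - ⟪partialGrad (φ z) a, θ⟫) _ θ
      (EuclideanSpace.single l 1) := ((hg θ (hO hθ)).1 l).hasLineDerivAt.sub hl
    have hs' : HasLineDerivAt ℝ (fun θ => φ z θ - ⟪partialGrad (φ z) a, θ⟫ -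
      (φ z a - ⟪partialGrad (φ z) a, a⟫)) _ θ (EuclideanSpace.single l 1) :=
      HasDerivAt.sub_const _ hs
    have e : taylorRem φ a z = fun θ => φ z θ - ⟪partialGrad (φ z) a, θ⟫ -
      (φ z a - ⟪partialGrad (φ z) a, a⟫) := by
      funext θ; simp only [taylorRem, inner_sub_right]; ring
    rw [e]
    exact hs'.lineDifferentiableAt
  · intro q hq
    -- At the centre the normalized remainder is `0 / 0 = 0`, but there the remainder vanishes
    -- anyway.
    rcases eq_or_ne (ratPoint q) a with h | h
    · simp [h, taylorRem]
    · have hn : 0 < ‖ratPoint q - a‖ ^ 2 := by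
        have := norm_pos_iff.2 (sub_ne_zero.2 h); positivity
      rw [← div_le_iff₀ hn]
      refine (ENNReal.ofReal_le_iff_le_toReal hz.ne).1 ?_
      refine le_trans ?_ (le_iSup _ q)
      rw [if_pos hq]

/-- This carries the moment assumption on second derivatives over to the envelope. If the sum is
finite, its fourth root bounds every second derivative on `O`, and Taylor's bound applies. -/
lemma taylorEnvelope_pow_four_le {dz : ℕ} {φ : E dz → E k → ℝ} {a : E k} {r : ℝ}
    {O : Set (E k)} {z : E dz} (hg : TwicePartialDiffOn (φ z) O) (hO : Metric.ball a r ⊆ O) :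
    taylorEnvelope φ a r z ^ 4 ≤ ENNReal.ofReal ((k ^ 2 + 1) ^ 4) *
      ∑ j : Fin k, ∑ l : Fin k, ⨆ ϑ ∈ O, ‖partialDeriv (partialDeriv (φ z) l) j ϑ‖ₑ ^ 4 := by
  set S : ENNReal :=
    ∑ j : Fin k, ∑ l : Fin k, ⨆ ϑ ∈ O, ‖partialDeriv (partialDeriv (φ z) l) j ϑ‖ₑ ^ 4 with hS
  rcases eq_or_ne S ⊤ with h | h
  · rw [h, ENNReal.mul_top (by simp; positivity)]; exact le_top
  set H : ℝ := √√S.toReal with hH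
  have hH4 : H ^ 4 = S.toReal := by
    rw [hH, show (4 : ℕ) = 2 * 2 from rfl, pow_mul, Real.sq_sqrt (by positivity),
      Real.sq_sqrt (by positivity)]
  have hb : ∀ j l : Fin k, ∀ θ ∈ O, |partialDeriv (partialDeriv (φ z) l) j θ| ≤ H := by
    intro j l θ hθ
    have h1 : ‖partialDeriv (partialDeriv (φ z) l) j θ‖ₑ ^ 4 ≤ S := by
      refine le_trans (le_iSup₂ (f := fun ϑ (_ : ϑ ∈ O) =>
        ‖partialDeriv (partialDeriv (φ z) l) j ϑ‖ₑ ^ 4) θ hθ) ?_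
      refine le_trans (Finset.single_le_sum (f := fun l => ⨆ ϑ ∈ O,
        ‖partialDeriv (partialDeriv (φ z) l) j ϑ‖ₑ ^ 4) (fun _ _ => zero_le)
        (Finset.mem_univ l)) ?_
      exact Finset.single_le_sum (f := fun j => ∑ l : Fin k, ⨆ ϑ ∈ O,
        ‖partialDeriv (partialDeriv (φ z) l) j ϑ‖ₑ ^ 4) (fun _ _ => zero_le)
        (Finset.mem_univ j)
    have h2 := ENNReal.toReal_mono h h1
    rw [ENNReal.toReal_pow, toReal_enorm, ← hH4] at h2
    exact le_of_pow_le_pow_left₀ (by norm_num) (by positivity) h2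
  have hG : taylorEnvelope φ a r z ≤ ENNReal.ofReal ((k ^ 2 + 1) * H) := by
    refine iSup_le fun q => ?_
    split_ifs with hq
    · refine ENNReal.ofReal_le_ofReal ?_
      refine div_le_of_le_mul₀ (by positivity) (by positivity) ?_
      exact abs_taylor_remainder_le hg hO (by positivity) hb hq
    · exact zero_le
  calc _ ≤ ENNReal.ofReal ((k ^ 2 + 1) * H) ^ 4 := by gcongr
    _ = _ := by
      rw [← ENNReal.ofReal_pow (by positivity), mul_pow, hH4,
        ENNReal.ofReal_mul (by positivity), ENNReal.ofReal_toReal h]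

end Taylor

/-! ### Moment bounds derived from the model assumptions. -/

section Model

variable {Ω : Type*} {mΩ : MeasurableSpace Ω} {P : Measure Ω} [IsProbabilityMeasure P]
  {dz dw k : ℕ}

/-- Moment bounds for regression scores `V j` and instruments `b j` under the law `L`. -/
structure ScoreBounds {S : Type*} [MeasurableSpace S] (L : Measure S) (V b : ℕ → S → ℝ)
    (κ : ℝ) : Prop where
  one_le : 1 ≤ κ
  measurable_V : ∀ j, Measurable (V j)
  measurable_b : ∀ j, Measurable (b j)
  memLp_V : ∀ j, MemLp (V j) 4 L
  memLp_b : ∀ j, MemLp (b j) 4 L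
  mean : ∀ j, ∫ v, V j v ∂L = 0
  pow_four_V : ∀ j, ∫ v, V j v ^ 4 ∂L ≤ κ
  pow_four_b : ∀ j, ∫ v, b j v ^ 4 ∂L ≤ κ
  sq_V : ∀ (m : ℕ) (x : ℕ → ℝ), ∫ v, (∑ j ∈ Finset.range m, x j * V j v) ^ 2 ∂L
    ≤ κ * ∑ j ∈ Finset.range m, x j ^ 2
  sq_b : ∀ (m : ℕ) (x : ℕ → ℝ), ∫ v, (∑ j ∈ Finset.range m, x j * b j v) ^ 2 ∂L
    ≤ κ * ∑ j ∈ Finset.range m, x j ^ 2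

/-- The instrument `f_j(w)` as a function of the observation `(y, z, w)`. -/
def instr (f : ℕ → E dw → ℝ) (j : ℕ) (v : ℝ × E dz × E dw) : ℝ := f j v.2.2

/-- The score `(y - sol(z)) f_j(w)` of the observation `(y, z, w)`. -/
def score (sol : E dz → ℝ) (f : ℕ → E dw → ℝ) (j : ℕ) (v : ℝ × E dz × E dw) : ℝ :=
  (v.1 - sol v.2.1) * f j v.2.2

/-- A density ratio bounded on the support gives a bound between the measures. -/
lemma map_le_smul_densityMeasure {W : Ω → E dw} {ν pW : E dw → ℝ} (hν : Measurable ν)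
    (hpos : ∀ w ∈ (P.map W).support, 0 < ν w) (hp : P.map W = densityMeasure pW)
    {ηp : ℝ}
    (hle : ∀ w ∈ (P.map W).support, pW w / ν w ≤ ηp) (hη : 0 ≤ ηp) :
    P.map W ≤ ENNReal.ofReal ηp • densityMeasure ν := by
  refine Measure.le_iff.2 fun s hs => ?_
  have hc : MeasurableSet (P.map W).support := (Measure.isClosed_support).measurableSet
  -- The ratio is controlled only on the support of the law of `W`; the support is conull, so
  -- nothing is lost by restricting to it.
  calc P.map W s = P.map W (s ∩ (P.map W).support) :=
        (measure_inter_conull Measure.support_mem_ae).symm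
    _ = ∫⁻ w in s ∩ (P.map W).support, ENNReal.ofReal (pW w) := by
        conv_lhs => rw [hp]
        rw [densityMeasure, withDensity_apply _ (hs.inter (by
          rw [← densityMeasure, ← hp]; exact hc)),
          ← densityMeasure, ← hp]
    _ ≤ ∫⁻ w in s ∩ (P.map W).support, ENNReal.ofReal ηp * ENNReal.ofReal (ν w) := by
        refine setLIntegral_mono' (hs.inter hc) fun w hw => ?_
        rw [← ENNReal.ofReal_mul hη]
        exact ENNReal.ofReal_le_ofReal ((div_le_iff₀ (hpos w hw.2)).1 (hle w hw.2))
    _ ≤ ∫⁻ w in s, ENNReal.ofReal ηp * ENNReal.ofReal (ν w) :=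
        lintegral_mono_set Set.inter_subset_left
    _ = _ := by
        rw [lintegral_const_mul _ (by fun_prop), Measure.smul_apply, smul_eq_mul, densityMeasure,
          withDensity_apply _ hs]

/-- Conditional moment bounds in integrated form. -/
lemma lintegral_pow_four_mul_le {U : Ω → ℝ} {W : Ω → E dw} (hU : Measurable U)
    (hW : Measurable W) {σ : ℝ} (hi : Integrable (fun ω => U ω ^ 4) P)
    (hc : P[fun ω => U ω ^ 4 | sigmaOf W] ≤ᵐ[P] fun _ => σ ^ 4) {g : E dw → ENNReal}
    (hg : Measurable g) :
    ∫⁻ ω, ENNReal.ofReal (U ω ^ 4) * g (W ω) ∂P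
      ≤ ENNReal.ofReal (σ ^ 4) * ∫⁻ ω, g (W ω) ∂P := by
  have hmeas : Measurable fun ω => ENNReal.ofReal (U ω ^ 4) := by fun_prop
  -- The conditional bound says that the law of `W` under the measure with density `U⁴` is at most
  -- `σ⁴` times its law under `P`; it is tested on the sets `W ⁻¹' s`, where conditional expectation
  -- preserves integrals.
  have hle : (P.withDensity fun ω => ENNReal.ofReal (U ω ^ 4)).map W
      ≤ ENNReal.ofReal (σ ^ 4) • P.map W := by
    refine Measure.le_iff.2 fun s hs => ?_
    have hs' : MeasurableSet[sigmaOf W] (W ⁻¹' s) := ⟨s, hs, rfl⟩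
    rw [Measure.map_apply hW hs, withDensity_apply _ (hW hs), Measure.smul_apply,
      Measure.map_apply hW hs, smul_eq_mul,
      ← ofReal_integral_eq_lintegral_ofReal hi.integrableOn (ae_of_all _ fun ω => by positivity),
      ← setIntegral_condExp hW.comap_le hi hs']
    have h1 : ∫ ω in W ⁻¹' s, (P[fun ω => U ω ^ 4 | sigmaOf W]) ω ∂P
        ≤ ∫ _ in W ⁻¹' s, σ ^ 4 ∂P :=
      setIntegral_mono_ae integrable_condExp.integrableOn (integrable_const _).integrableOn hc
    refine (ENNReal.ofReal_le_ofReal h1).trans ?_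
    rw [setIntegral_const, smul_eq_mul, mul_comm, ENNReal.ofReal_mul (by positivity),
      ofReal_measureReal]
  calc _ = ∫⁻ w, g w ∂((P.withDensity fun ω => ENNReal.ofReal (U ω ^ 4)).map W) := by
        rw [lintegral_map hg hW]
        exact (lintegral_withDensity_eq_lintegral_mul _ hmeas (hg.comp hW)).symm
    _ ≤ ∫⁻ w, g w ∂(ENNReal.ofReal (σ ^ 4) • P.map W) := lintegral_mono' hle le_rfl
    _ = _ := by rw [lintegral_smul_measure, lintegral_map hg hW, smul_eq_mul]

lemma integrable_pow_four_mul {U : Ω → ℝ} {W : Ω → E dw} (hU : Measurable U)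
    (hW : Measurable W) {σ : ℝ} (hi : Integrable (fun ω => U ω ^ 4) P)
    (hc : P[fun ω => U ω ^ 4 | sigmaOf W] ≤ᵐ[P] fun _ => σ ^ 4) {g : E dw → ℝ}
    (hg : Measurable g) (hg0 : ∀ w, 0 ≤ g w) (hgi : Integrable (fun ω => g (W ω)) P) :
    Integrable (fun ω => U ω ^ 4 * g (W ω)) P ∧
      ∫ ω, U ω ^ 4 * g (W ω) ∂P ≤ σ ^ 4 * ∫ ω, g (W ω) ∂P := by
  have hm : Measurable fun ω => U ω ^ 4 * g (W ω) := by fun_prop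
  have h0 : ∀ ω, 0 ≤ U ω ^ 4 * g (W ω) := fun ω => mul_nonneg (by positivity) (hg0 _)
  have h1 := lintegral_pow_four_mul_le hU hW hi hc (g := fun w => ENNReal.ofReal (g w))
    (by fun_prop)
  simp only [← ENNReal.ofReal_mul' (hg0 _)] at h1
  rw [← ofReal_integral_eq_lintegral_ofReal hgi (ae_of_all _ fun ω => hg0 _),
    ← ENNReal.ofReal_mul (by positivity)] at h1
  have hint : Integrable (fun ω => U ω ^ 4 * g (W ω)) P :=
    (lintegral_ofReal_ne_top_iff_integrable hm.aestronglyMeasurable (ae_of_all _ h0)).1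
      (ne_top_of_le_ne_top ENNReal.ofReal_ne_top h1)
  refine ⟨hint, ?_⟩
  rw [← ofReal_integral_eq_lintegral_ofReal hint (ae_of_all _ h0)] at h1
  exact (ENNReal.ofReal_le_ofReal_iff
    (mul_nonneg (by positivity) (integral_nonneg fun ω => hg0 _))).1 h1

/-- `U² ≤ U⁴ / (2σ²) + σ² / 2` passes from the fourth conditional moment to the second; each half
contributes `σ² / 2`. -/
lemma integrable_sq_mul {U : Ω → ℝ} {W : Ω → E dw} (hU : Measurable U)
    (hW : Measurable W) {σ : ℝ} (hσ : 0 < σ) (hi : Integrable (fun ω => U ω ^ 4) P)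
    (hc : P[fun ω => U ω ^ 4 | sigmaOf W] ≤ᵐ[P] fun _ => σ ^ 4) {g : E dw → ℝ}
    (hg : Measurable g) (hg0 : ∀ w, 0 ≤ g w) (hgi : Integrable (fun ω => g (W ω)) P) :
    Integrable (fun ω => U ω ^ 2 * g (W ω)) P ∧
      ∫ ω, U ω ^ 2 * g (W ω) ∂P ≤ σ ^ 2 * ∫ ω, g (W ω) ∂P := by
  obtain ⟨i4, h4⟩ := integrable_pow_four_mul hU hW hi hc hg hg0 hgi
  have hp : ∀ ω, U ω ^ 2 * g (W ω)
      ≤ 1 / (2 * σ ^ 2) * (U ω ^ 4 * g (W ω)) + σ ^ 2 / 2 * g (W ω) := by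
    intro ω
    have e : 1 / (2 * σ ^ 2) * (U ω ^ 4 * g (W ω)) + σ ^ 2 / 2 * g (W ω) - U ω ^ 2 * g (W ω)
        = (U ω ^ 2 - σ ^ 2) ^ 2 / (2 * σ ^ 2) * g (W ω) := by field_simp; ring
    have : 0 ≤ (U ω ^ 2 - σ ^ 2) ^ 2 / (2 * σ ^ 2) * g (W ω) :=
      mul_nonneg (by positivity) (hg0 _)
    linarith
  have ib : Integrable (fun ω => 1 / (2 * σ ^ 2) * (U ω ^ 4 * g (W ω)) + σ ^ 2 / 2 * g (W ω)) P :=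
    (i4.const_mul _).add (hgi.const_mul _)
  have i2 : Integrable (fun ω => U ω ^ 2 * g (W ω)) P := by
    refine ib.mono' (by fun_prop) (ae_of_all _ fun ω => ?_)
    rw [Real.norm_of_nonneg (mul_nonneg (sq_nonneg _) (hg0 _))]
    exact hp ω
  refine ⟨i2, (integral_mono i2 ib hp).trans ?_⟩
  rw [integral_add (i4.const_mul _) (hgi.const_mul _), integral_const_mul, integral_const_mul]
  calc _ ≤ 1 / (2 * σ ^ 2) * (σ ^ 4 * ∫ ω, g (W ω) ∂P) + σ ^ 2 / 2 * ∫ ω, g (W ω) ∂P := by gcongr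
    _ = _ := by field_simp; ring

lemma integral_sq_sum_basis {ν : E dw → ℝ} {f : ℕ → E dw → ℝ} (hf : IsONB ν f) (m : ℕ)
    (x : ℕ → ℝ) :
    Integrable (fun w => (∑ j ∈ Finset.range m, x j * f j w) ^ 2) (densityMeasure ν) ∧
    ∫ w, (∑ j ∈ Finset.range m, x j * f j w) ^ 2 ∂(densityMeasure ν)
      = ∑ j ∈ Finset.range m, x j ^ 2 := by
  obtain ⟨hfm, b, hb⟩ := hf
  have hm : ∀ j, MemLp (f j) 2 (densityMeasure ν) := fun j => (memLp_congr_ae (hb j)).1 (Lp.memLp _)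
  set g : Lp ℝ 2 (densityMeasure ν) := ∑ j ∈ Finset.range m, x j • b j with hg
  have hge : (g : E dw → ℝ) =ᵐ[densityMeasure ν] fun w => ∑ j ∈ Finset.range m, x j * f j w := by
    have h1 : (g : E dw → ℝ) =ᵐ[densityMeasure ν]
        ∑ j ∈ Finset.range m, ((x j • b j : Lp ℝ 2 (densityMeasure ν)) : E dw → ℝ) :=
      Lp.coeFn_finsetSum _ _
    have h2 : ∀ᵐ w ∂(densityMeasure ν), ∀ j ∈ Finset.range m,
        ((x j • b j : Lp ℝ 2 (densityMeasure ν)) : E dw → ℝ) w = x j * f j w := by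
      refine (Finset.eventually_all _).2 fun j _ => ?_
      filter_upwards [Lp.coeFn_smul (x j) (b j), hb j] with w h3 h4
      rw [h3, Pi.smul_apply, h4, smul_eq_mul]
    filter_upwards [h1, h2] with w h3 h4
    rw [h3, Finset.sum_apply]
    exact Finset.sum_congr rfl h4
  have hi : Integrable (fun w => (∑ j ∈ Finset.range m, x j * f j w) ^ 2) (densityMeasure ν) :=
    (memLp_finsetSum _ fun j _ => (hm j).const_mul (x j)).integrable_sq
  refine ⟨hi, ?_⟩
  have h1 : inner ℝ g g = ∫ w, (∑ j ∈ Finset.range m, x j * f j w) ^ 2 ∂(densityMeasure ν) := by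
    rw [L2.inner_def]
    refine integral_congr_ae (hge.mono fun w hw => ?_)
    simp [hw, sq]
  rw [← h1, hg, b.orthonormal.inner_sum]
  simp [sq]

/-- `g (W)` can be pulled out of the conditional expectation given `W`, leaving a factor that
vanishes. -/
lemma integral_mul_comp_eq_zero {U : Ω → ℝ} {W : Ω → E dw} (hW : Measurable W)
    (hU : Integrable U P) (hc : P[U | sigmaOf W] =ᵐ[P] 0) {g : E dw → ℝ} (hg : Measurable g)
    (hi : Integrable (fun ω => U ω * g (W ω)) P) : ∫ ω, U ω * g (W ω) ∂P = 0 := by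
  have hgm : StronglyMeasurable[sigmaOf W] fun ω => g (W ω) :=
    (hg.comp (comap_measurable W)).stronglyMeasurable
  have h1 := condExp_mul_of_stronglyMeasurable_right hgm hi hU
  rw [← integral_condExp hW.comap_le]
  have h2 : P[fun ω => U ω * g (W ω) | sigmaOf W] =ᵐ[P] 0 := by
    refine EventuallyEq.trans h1 ?_
    filter_upwards [hc] with ω hω
    simp [hω]
  rw [integral_congr_ae h2]; simp

lemma integrable_comp_of_map_le {W : Ω → E dw} (hW : Measurable W) {ν : E dw → ℝ} {ηp : ℝ}
    (hη : 0 ≤ ηp) (hle : P.map W ≤ ENNReal.ofReal ηp • densityMeasure ν) {g : E dw → ℝ}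
    (hg0 : ∀ w, 0 ≤ g w) (hi : Integrable g (densityMeasure ν)) :
    Integrable (fun ω => g (W ω)) P ∧ ∫ ω, g (W ω) ∂P ≤ ηp * ∫ w, g w ∂(densityMeasure ν) := by
  have hs := hi.smul_measure (c := ENNReal.ofReal ηp) ENNReal.ofReal_ne_top
  have h1 : Integrable g (P.map W) := hs.mono_measure hle
  refine ⟨h1.comp_measurable hW, ?_⟩
  rw [← integral_map hW.aemeasurable h1.aestronglyMeasurable]
  refine (integral_mono_measure hle (ae_of_all _ hg0) hs).trans_eq ?_
  rw [integral_smul_measure, ENNReal.toReal_ofReal hη, smul_eq_mul]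

lemma memLp_four_of_integrable_pow {X : Ω → ℝ} (hm : AEStronglyMeasurable X P)
    (hi : Integrable (fun ω => X ω ^ 4) P) : MemLp X 4 P := by
  refine (integrable_norm_rpow_iff hm (by norm_num) (by norm_num)).1 ?_
  refine hi.congr (ae_of_all _ fun ω => ?_)
  have : ((4 : ENNReal)).toReal = (4 : ℕ) := by norm_num
  simp only [this, Real.rpow_natCast]
  rw [Real.norm_eq_abs, (by decide : Even 4).pow_abs]

/-- The essential point is one constant for all `j` and `m`. The quadratic-form bounds come from
orthonormality in `L²(ν)`, the bounded density ratio and the conditional moment bound; they control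
the largest eigenvalue of every score covariance matrix. -/
theorem exists_scoreBounds {Y : Ω → ℝ} {Z : Ω → E dz} {W : Ω → E dw} {sol : E dz → ℝ}
    (hmodel : IsIVModel P Y Z W sol) {ν : E dw → ℝ} (hν : IsProbDensity ν)
    {f : ℕ → E dw → ℝ} (hf : IsONB ν f) (hA1 : AssumptionBasis P W ν f)
    (hA2 : AssumptionMoment P (err Y Z sol) W) :
    ∃ κ, ScoreBounds (P.map fun ω => (Y ω, Z ω, W ω)) (score sol f) (instr f) κ := by
  obtain ⟨⟨ηf, hηf, hf4⟩, hpos, pW, hpm, hp0, hpe, ηp, hηp, hratio⟩ := hA1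
  obtain ⟨σ, hσ, hU4, hUc⟩ := hA2
  have hY := hmodel.measurable_Y
  have hZ := hmodel.measurable_Z
  have hW := hmodel.measurable_W
  have hsol := hmodel.measurable_sol
  have hfm : ∀ j, Measurable (f j) := hf.1
  have hUm : Measurable (err Y Z sol) := by unfold err; fun_prop
  have hT : Measurable fun ω => (Y ω, Z ω, W ω) := by fun_prop
  have hVm : ∀ j, Measurable (score (dz := dz) sol f j) := fun j => by unfold score; fun_prop
  have hbm : ∀ j, Measurable (instr (dz := dz) f j) := fun j => by unfold instr; fun_prop
  have hle := map_le_smul_densityMeasure hν.measurable hpos hpe hratio (by linarith)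
  have hη0 : 0 ≤ ηp := by linarith
  have hfi : ∀ j, Integrable (fun w => f j w ^ 4) (densityMeasure ν) ∧
      ∫ w, f j w ^ 4 ∂(densityMeasure ν) ≤ ηf := by
    intro j
    have e : ∫⁻ w, ENNReal.ofReal (f j w ^ 4) ∂(densityMeasure ν) ≤ ENNReal.ofReal ηf := by
      refine le_trans (le_of_eq (lintegral_congr fun w => ?_)) (hf4 j)
      rw [← ofReal_norm, ← ENNReal.ofReal_pow (norm_nonneg _), Real.norm_eq_abs,
        (by decide : Even 4).pow_abs]
    have hi : Integrable (fun w => f j w ^ 4) (densityMeasure ν) :=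
      (lintegral_ofReal_ne_top_iff_integrable (by have := hfm j; fun_prop)
        (ae_of_all _ fun w => by positivity)).1 (ne_top_of_le_ne_top ENNReal.ofReal_ne_top e)
    refine ⟨hi, ?_⟩
    rw [← ofReal_integral_eq_lintegral_ofReal hi (ae_of_all _ fun w => by positivity)] at e
    exact (ENNReal.ofReal_le_ofReal_iff (by linarith)).1 e
  have hfW : ∀ j, Integrable (fun ω => f j (W ω) ^ 4) P ∧
      ∫ ω, f j (W ω) ^ 4 ∂P ≤ ηp * ηf := fun j => by
    obtain ⟨h1, h2⟩ := integrable_comp_of_map_le hW hη0 hle (g := fun w => f j w ^ 4)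
      (fun w => by positivity) (hfi j).1
    exact ⟨h1, h2.trans (by gcongr; exact (hfi j).2)⟩
  have hVW : ∀ j, Integrable (fun ω => err Y Z sol ω ^ 4 * f j (W ω) ^ 4) P ∧
      ∫ ω, err Y Z sol ω ^ 4 * f j (W ω) ^ 4 ∂P ≤ σ ^ 4 * (ηp * ηf) := fun j => by
    obtain ⟨h1, h2⟩ := integrable_pow_four_mul hUm hW hU4 hUc (g := fun w => f j w ^ 4)
      (by have := hfm j; fun_prop) (fun w => by positivity) (hfW j).1
    exact ⟨h1, h2.trans (by gcongr; exact (hfW j).2)⟩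
  have hsq : ∀ (m : ℕ) (x : ℕ → ℝ),
      Integrable (fun ω => (∑ j ∈ Finset.range m, x j * f j (W ω)) ^ 2) P ∧
      ∫ ω, (∑ j ∈ Finset.range m, x j * f j (W ω)) ^ 2 ∂P
        ≤ ηp * ∑ j ∈ Finset.range m, x j ^ 2 := fun m x => by
    obtain ⟨h1, h2⟩ := integral_sq_sum_basis hf m x
    rw [← h2]
    exact integrable_comp_of_map_le hW hη0 hle
      (g := fun w => (∑ j ∈ Finset.range m, x j * f j w) ^ 2) (fun w => by positivity) h1
  have hf4' : ∀ j, MemLp (fun ω => f j (W ω)) 4 P := fun j =>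
    memLp_four_of_integrable_pow ((hfm j).comp hW).aestronglyMeasurable (hfW j).1
  have hU4' : MemLp (err Y Z sol) 4 P := memLp_four_of_integrable_pow (by fun_prop) hU4
  have c1 : 0 ≤ ηp * ηf := by positivity
  have c2 : 0 ≤ σ ^ 4 * (ηp * ηf) := by positivity
  have c3 : 0 ≤ σ ^ 2 * ηp := by positivity
  refine ⟨1 + ηp + σ ^ 2 * ηp + ηp * ηf + σ ^ 4 * (ηp * ηf),
    ⟨by linarith, hVm, hbm, fun j => ?_, fun j => ?_, fun j => ?_, fun j => ?_, fun j => ?_,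
    fun m x => ?_, fun m x => ?_⟩⟩
  · refine (memLp_map_measure_iff (hVm j).aestronglyMeasurable hT.aemeasurable).2
      (memLp_four_of_integrable_pow ((hVm j).comp hT).aestronglyMeasurable ?_)
    exact (hVW j).1.congr (ae_of_all _ fun ω => by simp [score, err, mul_pow])
  · exact (memLp_map_measure_iff (hbm j).aestronglyMeasurable hT.aemeasurable).2 (hf4' j)
  · rw [integral_map hT.aemeasurable (hVm j).aestronglyMeasurable]
    refine integral_mul_comp_eq_zero hW hmodel.err_integrable hmodel.err_condExp (hfm j) ?_
    exact (hU4'.mono_exponent (p := 2) (by norm_num)).integrable_mul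
      ((hf4' j).mono_exponent (p := 2) (by norm_num))
  · rw [integral_map hT.aemeasurable (by have := hVm j; fun_prop)]
    simp only [score, mul_pow]
    exact (hVW j).2.trans (by linarith)
  · rw [integral_map hT.aemeasurable (by have := hbm j; fun_prop)]
    exact (hfW j).2.trans (by linarith)
  · have hm : Measurable fun v => (∑ j ∈ Finset.range m, x j * score (dz := dz) sol f j v) ^ 2 :=
      (Finset.measurable_fun_sum _ fun j _ => (hVm j).const_mul _).pow_const 2
    rw [integral_map hT.aemeasurable hm.aestronglyMeasurable]
    have h1 := (integrable_sq_mul hUm hW hσ hU4 hUc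
      (g := fun w => (∑ j ∈ Finset.range m, x j * f j w) ^ 2) (by fun_prop)
      (fun w => by positivity) (hsq m x).1).2
    have h0 : 0 ≤ ∑ j ∈ Finset.range m, x j ^ 2 := by positivity
    calc _ = ∫ ω, err Y Z sol ω ^ 2 * (∑ j ∈ Finset.range m, x j * f j (W ω)) ^ 2 ∂P := by
          congr with ω
          rw [← mul_pow, Finset.mul_sum]
          congr 1
          exact Finset.sum_congr rfl fun j _ => by simp only [score, err]; ring
      _ ≤ σ ^ 2 * (ηp * ∑ j ∈ Finset.range m, x j ^ 2) := h1.trans (by gcongr; exact (hsq m x).2)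
      _ ≤ _ := by rw [← mul_assoc]; gcongr; linarith
  · have hm : Measurable fun v => (∑ j ∈ Finset.range m, x j * instr (dz := dz) f j v) ^ 2 :=
      (Finset.measurable_fun_sum _ fun j _ => (hbm j).const_mul _).pow_const 2
    rw [integral_map hT.aemeasurable hm.aestronglyMeasurable]
    have h0 : 0 ≤ ∑ j ∈ Finset.range m, x j ^ 2 := by positivity
    refine (hsq m x).2.trans ?_
    gcongr
    linarith

/-- Moment bounds on the gradient and the Taylor envelope of the parametric family. -/
theorem exists_parametric_bounds {Z : Ω → E dz} (hZ : Measurable Z) {sol : E dz → ℝ}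
    {Θ : Set (E k)} {φ : E dz → E k → ℝ} {ϑ₀ : E k} {ϑhat : ℕ → Ω → E k}
    (hA5 : AssumptionParametric P Z sol Θ φ ϑ₀ ϑhat) :
    ∃ r > 0, Metric.ball ϑ₀ r ⊆ interior Θ ∧ Measurable (taylorEnvelope φ ϑ₀ r) ∧
      (∀ᵐ ω ∂P, taylorEnvelope φ ϑ₀ r (Z ω) < ⊤) ∧
      MemLp (fun ω => (taylorEnvelope φ ϑ₀ r (Z ω)).toReal) 4 P ∧
      (∀ l, Measurable fun z => partialDeriv (φ z) l ϑ₀) ∧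
      ∀ l, MemLp (fun ω => partialDeriv (φ (Z ω)) l ϑ₀) 4 P := by
  obtain ⟨r, hr, hball⟩ := Metric.isOpen_iff.1 isOpen_interior ϑ₀ hA5.mem_interior
  obtain ⟨η, hη, hm1, hm2⟩ := hA5.moments
  have hd : ∀ z l, LineDifferentiableAt ℝ (φ z) ϑ₀ (EuclideanSpace.single l 1) := fun z l =>
    (hA5.twice_diff z ϑ₀ hA5.mem_interior).1 l
  have hG := measurable_taylorEnvelope hA5.measurable_φ r hd
  have hpd : ∀ l, Measurable fun z => partialDeriv (φ z) l ϑ₀ := fun l =>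
    measurable_partialDeriv hA5.measurable_φ fun z => hd z l
  -- The fourth moment is finite by the pointwise comparison with the `k²` suprema of second
  -- derivatives; almost sure finiteness of the envelope follows.
  have hGi : ∫⁻ ω, taylorEnvelope φ ϑ₀ r (Z ω) ^ 4 ∂P ≠ ⊤ := by
    refine ne_top_of_le_ne_top ?_
      (lintegral_mono fun ω => taylorEnvelope_pow_four_le (hA5.twice_diff (Z ω)) hball)
    rw [lintegral_const_mul' _ _ ENNReal.ofReal_ne_top]
    refine ENNReal.mul_ne_top ENNReal.ofReal_ne_top ?_
    rw [lintegral_finsetSum' _ fun j _ => Finset.aemeasurable_fun_sum _ fun l _ => (hm2 j l).1]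
    refine (ENNReal.sum_lt_top.2 fun j _ => ?_).ne
    rw [lintegral_finsetSum' _ fun l _ => (hm2 j l).1]
    exact ENNReal.sum_lt_top.2 fun l _ => (hm2 j l).2.trans_lt ENNReal.ofReal_lt_top
  have hfin : ∀ᵐ ω ∂P, taylorEnvelope φ ϑ₀ r (Z ω) < ⊤ := by
    filter_upwards [ae_lt_top ((hG.comp hZ).pow_const 4) hGi] with ω hω
    by_contra h
    rw [not_lt_top_iff] at h
    simp [h] at hω
  refine ⟨r, hr, hball, hG, hfin, ?_, hpd, fun l => ?_⟩
  · have hGm : Measurable fun ω => (taylorEnvelope φ ϑ₀ r (Z ω)).toReal :=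
      (hG.comp hZ).ennreal_toReal
    refine memLp_four_of_integrable_pow hGm.aestronglyMeasurable ?_
    simpa only [ENNReal.toReal_pow] using!
      integrable_toReal_of_lintegral_ne_top ((hG.comp hZ).pow_const 4).aemeasurable hGi
  · have hpm := (hpd l).comp hZ
    refine memLp_four_of_integrable_pow hpm.aestronglyMeasurable ?_
    refine (lintegral_ofReal_ne_top_iff_integrable (hpm.pow_const 4).aestronglyMeasurable
      (ae_of_all _ fun ω => by simp only; positivity)).1
      (ne_top_of_le_ne_top ENNReal.ofReal_ne_top (le_trans (le_of_eq ?_) (hm1 l)))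
    refine lintegral_congr fun ω => ?_
    rw [← ofReal_norm, ← ENNReal.ofReal_pow (norm_nonneg _), Real.norm_eq_abs,
      (by decide : Even 4).pow_abs]
    rfl

end Model

/-! ### Sample means, weighted vectors and a deterministic perturbation bound. -/

section Sample

variable {Ω : Type*} {mΩ : MeasurableSpace Ω} {P : Measure Ω} [IsProbabilityMeasure P]
  {S : Type*} [MeasurableSpace S] {L : Measure S} {X : ℕ → Ω → S}

/-- Independent random elements with common law `L`. -/
structure IsIID (P : Measure Ω) (X : ℕ → Ω → S) (L : Measure S) : Prop where
  indep : iIndepFun X P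
  aemeasurable : ∀ i, AEMeasurable (X i) P
  map_eq : ∀ i, P.map (X i) = L

/-- The mean of `g` over the first `n` observations. -/
noncomputable def sampleMean (X : ℕ → Ω → S) (g : S → ℝ) (n : ℕ) (ω : Ω) : ℝ :=
  (n : ℝ)⁻¹ * ∑ i ∈ Finset.range n, g (X i ω)

namespace IsIID

variable (h : IsIID P X L)
include h

lemma isProb : IsProbabilityMeasure L := by
  rw [← h.map_eq 0]
  exact Measure.isProbabilityMeasure_map (h.aemeasurable 0)

lemma integral_comp {g : S → ℝ} (hg : Measurable g) (i : ℕ) :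
    ∫ ω, g (X i ω) ∂P = ∫ v, g v ∂L := by
  rw [← h.map_eq i, integral_map (h.aemeasurable i) hg.aestronglyMeasurable]

lemma memLp_comp {g : S → ℝ} {p : ENNReal} (hgp : MemLp g p L) (i : ℕ) :
    MemLp (fun ω => g (X i ω)) p P :=
  MemLp.comp_of_map (by rwa [h.map_eq i]) (h.aemeasurable i)

lemma ae_all {s : S → Prop} (hs : ∀ᵐ v ∂L, s v) : ∀ᵐ ω ∂P, ∀ i, s (X i ω) :=
  ae_all_iff.2 fun i => ae_of_ae_map (h.aemeasurable i) (by rwa [h.map_eq i])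

lemma memLp_sampleMean {g : S → ℝ} {p : ENNReal} (hgp : MemLp g p L) (n : ℕ) :
    MemLp (sampleMean X g n) p P :=
  (memLp_finsetSum _ fun i _ => h.memLp_comp hgp i).const_mul _

lemma integral_sampleMean {g : S → ℝ} (hg : Measurable g) (hgp : MemLp g 2 L) {n : ℕ}
    (hn : 0 < n) : ∫ ω, sampleMean X g n ω ∂P = ∫ v, g v ∂L := by
  unfold sampleMean
  rw [integral_const_mul, integral_finsetSum _ fun i _ =>
    (h.memLp_comp hgp i).integrable (by norm_num)]
  simp only [h.integral_comp hg, Finset.sum_const, Finset.card_range, nsmul_eq_mul]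
  have : (n : ℝ) ≠ 0 := by positivity
  field_simp

/-- Variances of independent variables add, which yields the factor `1 / n`. -/
lemma integral_sq_sampleMean_sub_le {g : S → ℝ} (hg : Measurable g) (hgp : MemLp g 2 L) {n : ℕ}
    (hn : 0 < n) :
    ∫ ω, (sampleMean X g n ω - ∫ v, g v ∂L) ^ 2 ∂P ≤ (n : ℝ)⁻¹ * ∫ v, g v ^ 2 ∂L := by
  have := h.isProb
  have hm := h.memLp_sampleMean hgp n
  rw [← h.integral_sampleMean hg hgp hn,
    ← variance_eq_integral hm.aestronglyMeasurable.aemeasurable]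
  have e1 : Var[sampleMean X g n; P]
      = (n : ℝ)⁻¹ ^ 2 * Var[∑ i ∈ Finset.range n, fun ω => g (X i ω); P] := by
    rw [← variance_const_mul]
    congr 1
    funext ω
    simp [sampleMean]
  have e2 : Var[∑ i ∈ Finset.range n, fun ω => g (X i ω); P]
      = ∑ i ∈ Finset.range n, Var[fun ω => g (X i ω); P] := by
    refine IndepFun.variance_sum (fun i _ => h.memLp_comp hgp i) fun i _ j _ hij => ?_
    exact (h.indep.indepFun hij).comp hg hg
  have e3 : ∀ i, Var[fun ω => g (X i ω); P] ≤ ∫ v, g v ^ 2 ∂L := fun i => by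
    refine (variance_le_expectation_sq (h.memLp_comp hgp i).aestronglyMeasurable).trans_eq ?_
    exact h.integral_comp (g := fun v => g v ^ 2) (hg.pow_const 2) i
  rw [e1, e2]
  calc _ ≤ (n : ℝ)⁻¹ ^ 2 * ∑ i ∈ Finset.range n, ∫ v, g v ^ 2 ∂L := by gcongr; exact e3 _
    _ = _ := by
      have : (n : ℝ) ≠ 0 := by positivity
      simp only [Finset.sum_const, Finset.card_range, nsmul_eq_mul]; field_simp

/-- Cauchy-Schwarz without centring and hence without a gain in `n`. This serves the quadratic
Taylor remainder, whose mean does not vanish. -/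
lemma integral_sq_sampleMean_le {g : S → ℝ} (hg : Measurable g) (hgp : MemLp g 2 L) {n : ℕ}
    (hn : 0 < n) : ∫ ω, sampleMean X g n ω ^ 2 ∂P ≤ ∫ v, g v ^ 2 ∂L := by
  have hn' : (0 : ℝ) < n := by exact_mod_cast hn
  calc _ ≤ ∫ ω, (n : ℝ)⁻¹ * ∑ i ∈ Finset.range n, g (X i ω) ^ 2 ∂P := by
        refine integral_mono (h.memLp_sampleMean hgp n).integrable_sq
          ((integrable_finsetSum _ fun i _ => (h.memLp_comp hgp i).integrable_sq).const_mul _)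
          fun ω => ?_
        have := sq_sum_le_card_mul_sum_sq (s := Finset.range n) (f := fun i => g (X i ω))
        rw [Finset.card_range] at this
        simp only [sampleMean, mul_pow]
        calc _ ≤ (n : ℝ)⁻¹ ^ 2 * (n * ∑ i ∈ Finset.range n, g (X i ω) ^ 2) := by gcongr
          _ = _ := by field_simp
    _ = _ := by
      rw [integral_const_mul, integral_finsetSum _ fun i _ => (h.memLp_comp hgp i).integrable_sq]
      simp only [h.integral_comp (g := fun v => g v ^ 2) (hg.pow_const 2), Finset.sum_const,
        Finset.card_range, nsmul_eq_mul]
      field_simp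

end IsIID

/-- The vector `(√τ_j u_j)_{j < m}`. -/
noncomputable def wvec (τ : ℕ → ℝ) (m : ℕ) (u : ℕ → ℝ) : E m :=
  WithLp.toLp 2 fun j => √(τ j) * u j

lemma inner_wvec {τ : ℕ → ℝ} (hτ : ∀ j, 0 ≤ τ j) (m : ℕ) (u v : ℕ → ℝ) :
    ⟪wvec τ m u, wvec τ m v⟫ = ∑ j ∈ Finset.range m, τ j * (u j * v j) := by
  simp only [wvec, PiLp.inner_apply, RCLike.inner_apply, conj_trivial]
  rw [Finset.sum_range]
  refine Finset.sum_congr rfl fun j _ => ?_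
  have := Real.mul_self_sqrt (hτ j)
  linear_combination (u j * v j) * this

lemma norm_sq_wvec {τ : ℕ → ℝ} (hτ : ∀ j, 0 ≤ τ j) (m : ℕ) (u : ℕ → ℝ) :
    ‖wvec τ m u‖ ^ 2 = ∑ j ∈ Finset.range m, τ j * u j ^ 2 := by
  rw [← real_inner_self_eq_norm_sq, inner_wvec hτ]
  simp only [sq]

lemma wvec_add (τ : ℕ → ℝ) (m : ℕ) (u v : ℕ → ℝ) :
    wvec τ m (fun j => u j + v j) = wvec τ m u + wvec τ m v := by
  ext j; simp [wvec]; ring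

lemma wvec_smul (τ : ℕ → ℝ) (m : ℕ) (c : ℝ) (u : ℕ → ℝ) :
    wvec τ m (fun j => c * u j) = c • wvec τ m u := by
  ext j; simp [wvec]; ring

lemma wvec_sum (τ : ℕ → ℝ) (m : ℕ) {ι : Type*} (s : Finset ι) (u : ι → ℕ → ℝ) :
    wvec τ m (fun j => ∑ l ∈ s, u l j) = ∑ l ∈ s, wvec τ m (u l) := by
  ext j
  simp [wvec, Finset.mul_sum]

lemma norm_wvec_le {τ : ℕ → ℝ} (hτ : ∀ j, 0 ≤ τ j) (m : ℕ) {u v : ℕ → ℝ}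
    (huv : ∀ j, |u j| ≤ v j) : ‖wvec τ m u‖ ≤ ‖wvec τ m v‖ := by
  refine (pow_le_pow_iff_left₀ (norm_nonneg _) (norm_nonneg _) two_ne_zero).1 ?_
  rw [norm_sq_wvec hτ, norm_sq_wvec hτ]
  refine Finset.sum_le_sum fun j _ => mul_le_mul_of_nonneg_left ?_ (hτ j)
  rw [← sq_abs]
  exact pow_le_pow_left₀ (abs_nonneg _) (huv j) 2

set_option maxHeartbeats 400000 in
/-- A deterministic bound for the effect of a small perturbation `b` of the vector `a` on its
squared norm. -/
lemma abs_norm_sq_perturb_le {V : Type*} [NormedAddCommGroup V] [InnerProductSpace ℝ V] {k : ℕ}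
    {a ρ γ : V} {g N : Fin k → V} {δ : Fin k → ℝ} {d K T : ℝ} {n : ℕ} (hn : 0 < n) (hT : 0 < T)
    (hd : 0 ≤ d) (hK : √n * d ≤ K) (hδ : ∀ l, |δ l| ≤ d) (hρ : ‖ρ‖ ≤ d ^ 2 * ‖γ‖) :
    n * |‖a - (∑ l, δ l • (g l + N l) + ρ)‖ ^ 2 - ‖a‖ ^ 2|
      ≤ 4 * (1 + K) ^ 4 * (1 + k * ∑ l, n * ⟪a, g l⟫ ^ 2 + k * ∑ l, ‖g l‖ ^ 2 + n * ‖a‖ ^ 2 / T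
        + (T + 1) * ((k + 1) * (∑ l, ‖N l‖ ^ 2 + ‖γ‖ ^ 2 / n))) := by
  have hn' : (0 : ℝ) < n := by exact_mod_cast hn
  set e : ℝ := √n with he
  have he0 : 0 < e := Real.sqrt_pos.2 hn'
  have he2 : (n : ℝ) = e ^ 2 := (Real.sq_sqrt hn'.le).symm
  set x : ℝ := ∑ l, e * |⟪a, g l⟫| with hx
  set y : ℝ := e * ‖a‖ with hy
  set w : ℝ := ∑ l, ‖N l‖ + ‖γ‖ / e with hw
  set cg : ℝ := ∑ l, ‖g l‖ with hcg
  have hx0 : 0 ≤ x := by positivity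
  have hy0 : 0 ≤ y := by positivity
  have hw0 : 0 ≤ w := by positivity
  have hcg0 : 0 ≤ cg := by positivity
  have hK0 : 0 ≤ K := le_trans (by positivity) hK
  set b : V := ∑ l, δ l • (g l + N l) + ρ with hb
  -- The two parts are treated differently: the vectors `g l` enter through `⟪a, g l⟫`, the noise
  -- `N` and the remainder `ρ` only through their norms.
  have hbsplit : b = ∑ l, δ l • g l + (∑ l, δ l • N l + ρ) := by
    rw [hb]; simp only [smul_add, Finset.sum_add_distrib]; abel
  have hNρ : e * ‖∑ l, δ l • N l + ρ‖ ≤ (K + K ^ 2) * w := by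
    have h1 : ‖∑ l, δ l • N l‖ ≤ d * ∑ l, ‖N l‖ := by
      refine (norm_sum_le _ _).trans ?_
      rw [Finset.mul_sum]
      refine Finset.sum_le_sum fun l _ => ?_
      rw [norm_smul]
      gcongr
      exact hδ l
    calc _ ≤ e * (d * ∑ l, ‖N l‖ + d ^ 2 * ‖γ‖) := by
          gcongr; exact (norm_add_le _ _).trans (add_le_add h1 hρ)
      _ = (e * d) * ∑ l, ‖N l‖ + (e * d) ^ 2 * (‖γ‖ / e) := by field_simp
      _ ≤ K * ∑ l, ‖N l‖ + K ^ 2 * (‖γ‖ / e) := by gcongr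
      _ ≤ (K + K ^ 2) * ∑ l, ‖N l‖ + (K + K ^ 2) * (‖γ‖ / e) := by
          gcongr
          · exact le_add_of_nonneg_right (by positivity)
          · exact le_add_of_nonneg_left (by positivity)
      _ = _ := by rw [hw]; ring
  have hab : e ^ 2 * |⟪a, b⟫| ≤ K * x + y * ((K + K ^ 2) * w) := by
    have h1 : |⟪a, ∑ l, δ l • g l⟫| ≤ d * ∑ l, |⟪a, g l⟫| := by
      rw [inner_sum, Finset.mul_sum]
      refine (Finset.abs_sum_le_sum_abs _ _).trans (Finset.sum_le_sum fun l _ => ?_)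
      rw [inner_smul_right, abs_mul]
      gcongr
      exact hδ l
    calc _ ≤ e ^ 2 * (d * ∑ l, |⟪a, g l⟫| + ‖a‖ * ‖∑ l, δ l • N l + ρ‖) := by
          gcongr
          rw [hbsplit, inner_add_right]
          exact (abs_add_le _ _).trans (add_le_add h1 (abs_real_inner_le_norm _ _))
      _ = (e * d) * x + y * (e * ‖∑ l, δ l • N l + ρ‖) := by
          rw [hx, ← Finset.mul_sum, hy]; ring
      _ ≤ _ := by gcongr
  have hbn : e * ‖b‖ ≤ K * cg + (K + K ^ 2) * w := by
    have h1 : ‖∑ l, δ l • g l‖ ≤ d * cg := by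
      refine (norm_sum_le _ _).trans ?_
      rw [hcg, Finset.mul_sum]
      refine Finset.sum_le_sum fun l _ => ?_
      rw [norm_smul]
      gcongr
      exact hδ l
    calc _ ≤ e * (d * cg + ‖∑ l, δ l • N l + ρ‖) := by
          gcongr
          rw [hbsplit]
          exact (norm_add_le _ _).trans (by gcongr)
      _ = (e * d) * cg + e * ‖∑ l, δ l • N l + ρ‖ := by ring
      _ ≤ _ := by gcongr
  have hbn2 : e ^ 2 * ‖b‖ ^ 2 ≤ 2 * (K * cg) ^ 2 + 2 * ((K + K ^ 2) * w) ^ 2 := by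
    have : (e * ‖b‖) ^ 2 ≤ (K * cg + (K + K ^ 2) * w) ^ 2 := by gcongr
    rw [mul_pow] at this
    linarith only [this, add_sq_le (a := K * cg) (b := (K + K ^ 2) * w)]
  have hdiff : |‖a - b‖ ^ 2 - ‖a‖ ^ 2| ≤ 2 * |⟪a, b⟫| + ‖b‖ ^ 2 := by
    rw [norm_sub_sq_real]
    calc _ = |-(2 * ⟪a, b⟫) + ‖b‖ ^ 2| := by congr 1; ring
      _ ≤ |-(2 * ⟪a, b⟫)| + |‖b‖ ^ 2| := abs_add_le _ _
      _ = _ := by rw [abs_neg, abs_mul, abs_two, abs_of_nonneg (sq_nonneg ‖b‖)]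
  have hx2 : x ^ 2 ≤ k * ∑ l, n * ⟪a, g l⟫ ^ 2 := by
    have := sq_sum_le_card_mul_sum_sq (s := Finset.univ) (f := fun l => e * |⟪a, g l⟫|)
    simpa [mul_pow, he2] using this
  have hcg2 : cg ^ 2 ≤ k * ∑ l, ‖g l‖ ^ 2 := by
    simpa using sq_sum_le_card_mul_sum_sq (s := Finset.univ) (f := fun l => ‖g l‖)
  have hw2 : w ^ 2 ≤ (k + 1) * (∑ l, ‖N l‖ ^ 2 + ‖γ‖ ^ 2 / n) := by
    have := sq_sum_le_card_mul_sum_sq (s := (Finset.univ : Finset (Option (Fin k))))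
      -- Indexing by `Option (Fin k)` handles the `k` noise norms and the remainder in a single
      -- Cauchy-Schwarz inequality, with constant `k + 1`.
      (f := fun o => o.elim (‖γ‖ / e) fun l => ‖N l‖)
    rw [Fintype.sum_option, Fintype.sum_option] at this
    simp only [Option.elim_none, Option.elim_some, Finset.card_univ, Fintype.card_option,
      Fintype.card_fin] at this
    rw [hw, he2]
    calc _ = (‖γ‖ / e + ∑ l, ‖N l‖) ^ 2 := by ring
      _ ≤ _ := this
      _ = _ := by push_cast; rw [div_pow]; ring
  have hyT : n * ‖a‖ ^ 2 / T = y ^ 2 / T := by rw [hy, he2]; ring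
  -- The weight `T` balances the orders. In the application `T` is the sum of the weights, `y²` has
  -- mean of order `T` and `w²` of order `T / n`, so both terms stay bounded when `T² ≤ n`.
  have hyw : 2 * (y * w) ≤ y ^ 2 / T + T * w ^ 2 := by
    have : 0 ≤ (y - T * w) ^ 2 / T := by positivity
    have e1 : (y - T * w) ^ 2 / T = y ^ 2 / T + T * w ^ 2 - 2 * (y * w) := by field_simp; ring
    linarith
  have hxx : 2 * x ≤ 1 + x ^ 2 := by
    linarith only [sq_nonneg (x - 1), (by ring : (x - 1) ^ 2 = x ^ 2 - 2 * x + 1)]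
  -- One constant dominating all the coefficients `K`, `K + K²`, `K²` and `(K + K²)²`.
  set M : ℝ := (1 + K) ^ 4 with hM
  have hMe : M = 1 + 4 * K + 6 * K ^ 2 + 4 * K ^ 3 + K ^ 4 := by rw [hM]; ring
  have hK2 := pow_nonneg hK0 2
  have hK3 := pow_nonneg hK0 3
  have hK4 := pow_nonneg hK0 4
  have hM1 : K ≤ M := by linarith
  have hM2 : K + K ^ 2 ≤ M := by linarith
  have hM3 : K ^ 2 ≤ M := by linarith
  have hM4 : (K + K ^ 2) ^ 2 ≤ M := by
    have : (K + K ^ 2) ^ 2 = K ^ 2 + 2 * K ^ 3 + K ^ 4 := by ring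
    linarith
  have hM0 : 0 ≤ M := by positivity
  rw [hyT]
  have hyT0 : 0 ≤ y ^ 2 / T := by positivity
  calc _ ≤ e ^ 2 * (2 * |⟪a, b⟫| + ‖b‖ ^ 2) := by rw [he2]; gcongr
    _ = 2 * (e ^ 2 * |⟪a, b⟫|) + e ^ 2 * ‖b‖ ^ 2 := by ring
    _ ≤ 2 * (K * x + y * ((K + K ^ 2) * w)) + (2 * (K * cg) ^ 2 + 2 * ((K + K ^ 2) * w) ^ 2) := by
        gcongr
    _ = K * (2 * x) + (K + K ^ 2) * (2 * (y * w)) + 2 * (K ^ 2 * cg ^ 2)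
        + 2 * ((K + K ^ 2) ^ 2 * w ^ 2) := by ring
    _ ≤ M * (1 + x ^ 2) + M * (y ^ 2 / T + T * w ^ 2) + 2 * (M * cg ^ 2) + 2 * (M * w ^ 2) := by
        gcongr
    _ ≤ 4 * M * (1 + x ^ 2 + cg ^ 2 + y ^ 2 / T + (T + 1) * w ^ 2) := by
        have h5 : 0 ≤ M * (T * w ^ 2) := by positivity
        have h1 : 0 ≤ M * (1 + x ^ 2) := by positivity
        have h2 : 0 ≤ M * (y ^ 2 / T + T * w ^ 2) := by positivity
        have h3 : 0 ≤ M * cg ^ 2 := by positivity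
        have h4 : 0 ≤ M * w ^ 2 := by positivity
        linarith only [h1, h2, h3, h4, h5]
    _ ≤ _ := by gcongr

end Sample

/-! ### Expectation of the parameter estimation effect. -/

section Remainder

variable {Ω : Type*} {mΩ : MeasurableSpace Ω} {P : Measure Ω} [IsProbabilityMeasure P]
  {S : Type*} [MeasurableSpace S] {L : Measure S} {X : ℕ → Ω → S}

lemma memLp_mul_of_memLp_four [IsFiniteMeasure L] {u v : S → ℝ} (hu : MemLp u 4 L)
    (hv : MemLp v 4 L) :
    MemLp (fun s => u s * v s) 2 L ∧
      ∫ s, (u s * v s) ^ 2 ∂L ≤ (∫ s, u s ^ 4 ∂L + ∫ s, v s ^ 4 ∂L) / 2 := by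
  have iu : Integrable (fun s => u s ^ 4) L := integrable_pow_of_memLp (p := 4) hu le_rfl
  have iv : Integrable (fun s => v s ^ 4) L := integrable_pow_of_memLp (p := 4) hv le_rfl
  have hm : AEStronglyMeasurable (fun s => u s * v s) L :=
    hu.aestronglyMeasurable.mul hv.aestronglyMeasurable
  have hle : ∀ s, (u s * v s) ^ 2 ≤ (u s ^ 4 + v s ^ 4) / 2 := fun s => by
    nlinarith [sq_nonneg (u s ^ 2 - v s ^ 2)]
  have ib : Integrable (fun s => (u s ^ 4 + v s ^ 4) / 2) L := (iu.add iv).div_const 2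
  have i2 : Integrable (fun s => (u s * v s) ^ 2) L :=
    ib.mono' (by fun_prop) (ae_of_all _ fun s => by
      rw [Real.norm_of_nonneg (sq_nonneg _)]; exact hle s)
  refine ⟨(memLp_two_iff_integrable_sq hm).2 i2, (integral_mono i2 ib hle).trans_eq ?_⟩
  rw [integral_div, integral_add iu iv]

lemma AssumptionWeights.le_one {τ : ℕ → ℝ} (hτ : AssumptionWeights τ) (j : ℕ) : τ j ≤ 1 := by
  rw [← hτ.first]; exact hτ.antitone (Nat.zero_le j)

namespace ScoreBounds

variable {V b : ℕ → S → ℝ} {κ : ℝ} (hS : ScoreBounds L V b κ)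
include hS

lemma integral_sq_le [IsProbabilityMeasure L] (j : ℕ) : ∫ v, V j v ^ 2 ∂L ≤ κ := by
  have h4 : Integrable (fun v => V j v ^ 4) L :=
    integrable_pow_of_memLp (p := 4) (hS.memLp_V j) le_rfl
  have h2 : Integrable (fun v => V j v ^ 2) L :=
    integrable_pow_of_memLp (p := 4) (hS.memLp_V j) (by norm_num)
  calc _ ≤ ∫ v, (1 + V j v ^ 4) / 2 ∂L := by
        refine integral_mono h2 (((integrable_const 1).add h4).div_const 2) fun v => ?_
        simp only
        nlinarith [sq_nonneg (V j v ^ 2 - 1)]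
    _ = (1 + ∫ v, V j v ^ 4 ∂L) / 2 := by
        rw [integral_div, integral_add (integrable_const 1) h4]; simp
    _ ≤ _ := by have := hS.pow_four_V j; have := hS.one_le; linarith

/-- Bessel's inequality for the instruments. -/
lemma sum_sq_integral_mul_le [IsProbabilityMeasure L] {p : S → ℝ} (hp : MemLp p 4 L) (m : ℕ) :
    ∑ j ∈ Finset.range m, (∫ v, p v * b j v ∂L) ^ 2 ≤ κ * ∫ v, p v ^ 2 ∂L := by
  have hκ := hS.one_le
  set g : ℕ → ℝ := fun j => ∫ v, p v * b j v ∂L with hg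
  have hpb : ∀ j, Integrable (fun v => p v * b j v) L := fun j =>
    (memLp_mul_of_memLp_four hp (hS.memLp_b j)).1.integrable (by norm_num)
  -- With the integrals `g j` themselves as coefficients, `∑ g j ^ 2 = ∫ p F`. Young's inequality
  -- with weight `κ` and the quadratic-form bound on `F` then absorb half of the left side.
  set F : S → ℝ := fun v => ∑ j ∈ Finset.range m, g j * b j v with hF
  have hF4 : MemLp F 4 L := memLp_finsetSum _ fun j _ => (hS.memLp_b j).const_mul _
  have hpF : Integrable (fun v => p v * F v) L :=
    (memLp_mul_of_memLp_four hp hF4).1.integrable (by norm_num)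
  have hp2 : Integrable (fun v => p v ^ 2) L :=
    integrable_pow_of_memLp (p := 4) hp (by norm_num)
  have hF2 : Integrable (fun v => F v ^ 2) L :=
    integrable_pow_of_memLp (p := 4) hF4 (by norm_num)
  have e : ∑ j ∈ Finset.range m, g j ^ 2 = ∫ v, p v * F v ∂L := by
    simp only [hF, Finset.mul_sum]
    rw [integral_finsetSum]
    · refine Finset.sum_congr rfl fun j _ => ?_
      rw [sq]
      nth_rewrite 2 [hg]
      simp only
      rw [← integral_const_mul]
      congr with v; ring
    · intro j _
      refine ((hpb j).const_mul (g j)).congr (ae_of_all _ fun v => ?_)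
      simp only; ring
  have h1 : ∫ v, p v * F v ∂L ≤ ∫ v, κ / 2 * p v ^ 2 + 1 / (2 * κ) * F v ^ 2 ∂L := by
    refine integral_mono hpF ((hp2.const_mul _).add (hF2.const_mul _)) fun v => ?_
    have : (0 : ℝ) ≤ (κ * p v - F v) ^ 2 / (2 * κ) := by positivity
    have e : κ / 2 * p v ^ 2 + 1 / (2 * κ) * F v ^ 2 - p v * F v
        = (κ * p v - F v) ^ 2 / (2 * κ) := by field_simp; ring
    simp only
    linarith
  rw [integral_add (hp2.const_mul _) (hF2.const_mul _), integral_const_mul, integral_const_mul,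
    ← e] at h1
  have h2 : 1 / (2 * κ) * ∫ v, F v ^ 2 ∂L ≤ (∑ j ∈ Finset.range m, g j ^ 2) / 2 := by
    calc _ ≤ 1 / (2 * κ) * (κ * ∑ j ∈ Finset.range m, g j ^ 2) := by
          gcongr; exact hS.sq_b m g
      _ = _ := by field_simp
  linarith

end ScoreBounds

variable {k : ℕ}

/-- The random bound for the effect of estimating the parameter. -/
noncomputable def remBound (L : Measure S) (X : ℕ → Ω → S) (V b : ℕ → S → ℝ) (p : Fin k → S → ℝ)
    (G : S → ℝ) (τ : ℕ → ℝ) (m n : ℕ) (T : ℝ) (ω : Ω) : ℝ :=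
  1 + k * ∑ l, n * ⟪wvec τ m fun j => sampleMean X (V j) n ω,
      wvec τ m fun j => ∫ v, p l v * b j v ∂L⟫ ^ 2
    + k * ∑ l, ‖wvec τ m fun j => ∫ v, p l v * b j v ∂L‖ ^ 2
    + n * ‖wvec τ m fun j => sampleMean X (V j) n ω‖ ^ 2 / T
    + (T + 1) * ((k + 1) * (∑ l, ‖wvec τ m fun j =>
        sampleMean X (fun v => p l v * b j v) n ω - ∫ v, p l v * b j v ∂L‖ ^ 2
      + ‖wvec τ m fun j => sampleMean X (fun v => G v * |b j v|) n ω‖ ^ 2 / n))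

lemma remBound_nonneg {V b : ℕ → S → ℝ} {p : Fin k → S → ℝ} {G : S → ℝ} {τ : ℕ → ℝ} {m n : ℕ}
    {T : ℝ} (hT : 0 ≤ T) (ω : Ω) : 0 ≤ remBound L X V b p G τ m n T ω := by
  unfold remBound; positivity

/-- A square-mean bound for the weighted norm of a random vector. -/
lemma integral_norm_sq_wvec_le {τ : ℕ → ℝ} (hτ : ∀ j, 0 ≤ τ j) (m : ℕ) {u : ℕ → Ω → ℝ}
    (hu : ∀ j, MemLp (u j) 2 P) {c : ℝ} (hc : ∀ j, ∫ ω, u j ω ^ 2 ∂P ≤ c) :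
    Integrable (fun ω => ‖wvec τ m fun j => u j ω‖ ^ 2) P ∧
      ∫ ω, ‖wvec τ m fun j => u j ω‖ ^ 2 ∂P ≤ (∑ j ∈ Finset.range m, τ j) * c := by
  simp only [norm_sq_wvec hτ]
  have hi : ∀ j, Integrable (fun ω => τ j * u j ω ^ 2) P := fun j =>
    (hu j).integrable_sq.const_mul _
  refine ⟨integrable_finsetSum _ fun j _ => hi j, ?_⟩
  rw [integral_finsetSum _ fun j _ => hi j, Finset.sum_mul]
  refine Finset.sum_le_sum fun j _ => ?_
  rw [integral_const_mul]
  exact mul_le_mul_of_nonneg_left (hc j) (hτ j)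

lemma integral_affine_combination {A B C D : Ω → ℝ} (hA : Integrable A P) (hB : Integrable B P)
    (hC : Integrable C P) (hD : Integrable D P) (a c e t s d : ℝ) :
    Integrable (fun ω => 1 + a * A ω + c + e * B ω / t + s * (d * (C ω + D ω / e))) P ∧
    ∫ ω, 1 + a * A ω + c + e * B ω / t + s * (d * (C ω + D ω / e)) ∂P
      = 1 + a * ∫ ω, A ω ∂P + c + e * (∫ ω, B ω ∂P) / t
        + s * (d * (∫ ω, C ω ∂P + (∫ ω, D ω ∂P) / e)) := by
  refine ⟨by fun_prop, ?_⟩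
  rw [integral_add (by fun_prop) (by fun_prop), integral_add (by fun_prop) (by fun_prop),
    integral_add (by fun_prop) (by fun_prop), integral_add (by fun_prop) (by fun_prop),
    integral_const_mul, integral_const_mul, integral_const_mul, integral_add hC (by fun_prop),
    integral_div, integral_div, integral_const_mul]
  simp

/-- The expectation of the remainder bound is bounded uniformly in the sample size. -/
lemma integral_remBound_le (h : IsIID P X L) {V b : ℕ → S → ℝ} {κ : ℝ}
    (hS : ScoreBounds L V b κ) {p : Fin k → S → ℝ} (hpm : ∀ l, Measurable (p l))
    (hp : ∀ l, MemLp (p l) 4 L) {G : S → ℝ} (hGm : Measurable G) (hG : MemLp G 4 L)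
    {τ : ℕ → ℝ} (hτ : AssumptionWeights τ) :
    ∃ C, ∀ m n : ℕ, 0 < n → 1 ≤ ∑ j ∈ Finset.range m, τ j →
      (∑ j ∈ Finset.range m, τ j) ^ 2 ≤ n →
      Integrable (remBound L X V b p G τ m n (∑ j ∈ Finset.range m, τ j)) P ∧
      ∫ ω, remBound L X V b p G τ m n (∑ j ∈ Finset.range m, τ j) ω ∂P ≤ C := by
  have := h.isProb
  have hκ := hS.one_le
  have hτ0 : ∀ j, 0 ≤ τ j := fun j => (hτ.pos j).le
  obtain ⟨π, hπ0, hπ1, hπ2, hπ3⟩ : ∃ π : ℝ, 0 ≤ π ∧ (∀ l, ∫ v, p l v ^ 2 ∂L ≤ π) ∧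
      (∀ l j, ∫ v, (p l v * b j v) ^ 2 ∂L ≤ π) ∧ ∀ j, ∫ v, (G v * |b j v|) ^ 2 ∂L ≤ π := by
    have n1 : ∀ l, 0 ≤ ∫ v, p l v ^ 2 ∂L := fun l => by positivity
    have n2 : ∀ l, 0 ≤ ∫ v, p l v ^ 4 ∂L := fun l => by positivity
    have n3 : 0 ≤ ∫ v, G v ^ 4 ∂L := by positivity
    have s1 : 0 ≤ ∑ l, ∫ v, p l v ^ 2 ∂L := by positivity
    have s2 : 0 ≤ ∑ l, ∫ v, p l v ^ 4 ∂L := by positivity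
    refine ⟨∑ l, ∫ v, p l v ^ 2 ∂L + ∑ l, ∫ v, p l v ^ 4 ∂L + ∫ v, G v ^ 4 ∂L + κ,
      by positivity, fun l => ?_, fun l j => ?_, fun j => ?_⟩
    · have := Finset.single_le_sum (f := fun l => ∫ v, p l v ^ 2 ∂L) (fun l _ => n1 l)
        (Finset.mem_univ l)
      linarith
    · have h1 := Finset.single_le_sum (f := fun l => ∫ v, p l v ^ 4 ∂L) (fun l _ => n2 l)
        (Finset.mem_univ l)
      have h2 := (memLp_mul_of_memLp_four (hp l) (hS.memLp_b j)).2
      have h3 := hS.pow_four_b j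
      have := n2 l
      linarith
    · have h2 := (memLp_mul_of_memLp_four hG (hS.memLp_b j)).2
      have h3 := hS.pow_four_b j
      simp only [mul_pow, sq_abs] at h2 ⊢
      linarith
  -- One summand for each term of `remBound`, verified by `b1` to `b6` below.
  refine ⟨1 + k * (k * (κ * (κ * π))) + k * (k * (κ * π)) + κ + 2 * ((k + 1) * (k * π + π)),
    fun m n hn hT hTn => ?_⟩
  set T := ∑ j ∈ Finset.range m, τ j with hTdef
  have hn' : (0 : ℝ) < n := by exact_mod_cast hn
  set g : Fin k → ℕ → ℝ := fun l j => ∫ v, p l v * b j v ∂L with hg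
  have hV2 : ∀ j, MemLp (V j) 2 L := fun j => (hS.memLp_V j).mono_exponent (by norm_num)
  have hgn : ∀ l, ‖wvec τ m (g l)‖ ^ 2 ≤ κ * π := by
    intro l
    rw [norm_sq_wvec hτ0]
    calc _ ≤ ∑ j ∈ Finset.range m, g l j ^ 2 :=
          Finset.sum_le_sum fun j _ => mul_le_of_le_one_left (sq_nonneg _) (hτ.le_one j)
      _ ≤ κ * ∫ v, p l v ^ 2 ∂L := hS.sum_sq_integral_mul_le (hp l) m
      _ ≤ _ := by gcongr; exact hπ1 l
  have ha : Integrable (fun ω => ‖wvec τ m fun j => sampleMean X (V j) n ω‖ ^ 2) P ∧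
      ∫ ω, ‖wvec τ m fun j => sampleMean X (V j) n ω‖ ^ 2 ∂P ≤ T * ((n : ℝ)⁻¹ * κ) := by
    refine integral_norm_sq_wvec_le hτ0 m (fun j => h.memLp_sampleMean (hV2 j) n) fun j => ?_
    have := h.integral_sq_sampleMean_sub_le (hS.measurable_V j) (hV2 j) hn
    simp only [hS.mean, sub_zero] at this
    exact this.trans (by gcongr; exact hS.integral_sq_le j)
  have hag : ∀ l, Integrable (fun ω => ⟪wvec τ m fun j => sampleMean X (V j) n ω,
        wvec τ m (g l)⟫ ^ 2) P ∧
      ∫ ω, ⟪wvec τ m fun j => sampleMean X (V j) n ω, wvec τ m (g l)⟫ ^ 2 ∂P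
        ≤ (n : ℝ)⁻¹ * (κ * (κ * π)) := by
    intro l
    -- The inner product is the sample mean of a single centred function, whose second moment is
    -- bounded through `sq_V`; no factor growing with `m` appears.
    set q : S → ℝ := fun v => ∑ j ∈ Finset.range m, (τ j * g l j) * V j v with hq
    have e : ∀ ω, ⟪wvec τ m fun j => sampleMean X (V j) n ω, wvec τ m (g l)⟫
        = sampleMean X q n ω := by
      intro ω
      rw [inner_wvec hτ0]
      simp only [sampleMean, hq]
      rw [Finset.sum_comm, Finset.mul_sum]
      refine Finset.sum_congr rfl fun j _ => ?_
      rw [← Finset.mul_sum]; ring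
    have hqm : Measurable q :=
      Finset.measurable_fun_sum _ fun j _ => (hS.measurable_V j).const_mul _
    have hq2 : MemLp q 2 L := memLp_finsetSum _ fun j _ => (hV2 j).const_mul _
    have hq0 : ∫ v, q v ∂L = 0 := by
      simp only [hq]
      rw [integral_finsetSum _ fun j _ => ((hV2 j).integrable (by norm_num)).const_mul _]
      simp [integral_const_mul, hS.mean]
    simp only [e]
    refine ⟨(h.memLp_sampleMean hq2 n).integrable_sq, ?_⟩
    have h1 := h.integral_sq_sampleMean_sub_le hqm hq2 hn
    simp only [hq0, sub_zero] at h1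
    refine h1.trans ?_
    gcongr
    refine (hS.sq_V m _).trans ?_
    gcongr
    have h2 := hgn l
    rw [norm_sq_wvec hτ0] at h2
    refine le_trans (Finset.sum_le_sum fun j _ => ?_) h2
    rw [mul_pow]
    refine mul_le_mul_of_nonneg_right ?_ (sq_nonneg _)
    rw [sq]
    exact mul_le_of_le_one_left (hτ0 j) (hτ.le_one j)
  have hN : ∀ l, Integrable (fun ω => ‖wvec τ m fun j =>
        sampleMean X (fun v => p l v * b j v) n ω - ∫ v, p l v * b j v ∂L‖ ^ 2) P ∧
      ∫ ω, ‖wvec τ m fun j =>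
        sampleMean X (fun v => p l v * b j v) n ω - ∫ v, p l v * b j v ∂L‖ ^ 2 ∂P
        ≤ T * ((n : ℝ)⁻¹ * π) := by
    intro l
    have hpb : ∀ j, MemLp (fun v => p l v * b j v) 2 L := fun j =>
      (memLp_mul_of_memLp_four (hp l) (hS.memLp_b j)).1
    refine integral_norm_sq_wvec_le (u := fun j ω => sampleMean X (fun v => p l v * b j v) n ω -
      ∫ v, p l v * b j v ∂L) hτ0 m
      (fun j => (h.memLp_sampleMean (hpb j) n).sub (memLp_const _)) fun j => ?_
    refine (h.integral_sq_sampleMean_sub_le ((hpm l).mul (hS.measurable_b j)) (hpb j) hn).trans ?_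
    gcongr
    exact hπ2 l j
  have hγ : Integrable (fun ω => ‖wvec τ m fun j =>
        sampleMean X (fun v => G v * |b j v|) n ω‖ ^ 2) P ∧
      ∫ ω, ‖wvec τ m fun j => sampleMean X (fun v => G v * |b j v|) n ω‖ ^ 2 ∂P ≤ T * π := by
    have hGb : ∀ j, MemLp (fun v => G v * |b j v|) 2 L := fun j =>
      (memLp_mul_of_memLp_four hG (hS.memLp_b j).abs).1
    refine integral_norm_sq_wvec_le hτ0 m (fun j => h.memLp_sampleMean (hGb j) n) fun j => ?_
    refine (h.integral_sq_sampleMean_le (hGm.mul (hS.measurable_b j).abs) (hGb j) hn).trans (hπ3 j)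
  have i1 : Integrable (fun ω => ∑ l, n * ⟪wvec τ m fun j => sampleMean X (V j) n ω,
      wvec τ m (g l)⟫ ^ 2) P := integrable_finsetSum _ fun l _ => (hag l).1.const_mul _
  have i2 : Integrable (fun ω => ∑ l, ‖wvec τ m fun j =>
      sampleMean X (fun v => p l v * b j v) n ω - ∫ v, p l v * b j v ∂L‖ ^ 2) P :=
    integrable_finsetSum _ fun l _ => (hN l).1
  obtain ⟨hint, heq⟩ := integral_affine_combination i1 ha.1 i2 hγ.1 k
    (k * ∑ l, ‖wvec τ m (g l)‖ ^ 2) n T (T + 1) (k + 1)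
  refine ⟨hint, heq.le.trans ?_⟩
  rw [integral_finsetSum _ fun l _ => (hag l).1.const_mul _,
    integral_finsetSum _ fun l _ => (hN l).1]
  simp only [integral_const_mul]
  have b1 : ∑ l, (n : ℝ) * ∫ ω, ⟪wvec τ m fun j => sampleMean X (V j) n ω, wvec τ m (g l)⟫ ^ 2 ∂P
      ≤ k * (κ * (κ * π)) := by
    calc _ ≤ ∑ _l : Fin k, (n : ℝ) * ((n : ℝ)⁻¹ * (κ * (κ * π))) := by
          gcongr with l; exact (hag l).2
      _ = _ := by simp [mul_inv_cancel_left₀ hn'.ne']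
  have b2 : ∑ l, ‖wvec τ m (g l)‖ ^ 2 ≤ k * (κ * π) := by
    calc _ ≤ ∑ _l : Fin k, κ * π := by gcongr with l; exact hgn l
      _ = _ := by simp
  have b3 : n * (∫ ω, ‖wvec τ m fun j => sampleMean X (V j) n ω‖ ^ 2 ∂P) / T ≤ κ := by
    calc _ ≤ n * (T * ((n : ℝ)⁻¹ * κ)) / T := by gcongr; exact ha.2
      _ = _ := by field_simp
  have b4 : ∑ l, ∫ ω, ‖wvec τ m fun j =>
        sampleMean X (fun v => p l v * b j v) n ω - ∫ v, p l v * b j v ∂L‖ ^ 2 ∂P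
      ≤ k * (T * ((n : ℝ)⁻¹ * π)) := by
    calc _ ≤ ∑ _l : Fin k, T * ((n : ℝ)⁻¹ * π) := by gcongr with l; exact (hN l).2
      _ = _ := by simp
  have b5 : (∫ ω, ‖wvec τ m fun j => sampleMean X (fun v => G v * |b j v|) n ω‖ ^ 2 ∂P) / n
      ≤ T * ((n : ℝ)⁻¹ * π) := by
    calc _ ≤ T * π / n := by gcongr; exact hγ.2
      _ = _ := by field_simp
  -- From `1 ≤ T` and `T² ≤ n` one gets `(T + 1) * T ≤ 2 * n`.
  have b6 : (T + 1) * ((k + 1) * (k * (T * ((n : ℝ)⁻¹ * π)) + T * ((n : ℝ)⁻¹ * π)))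
      ≤ 2 * ((k + 1) * (k * π + π)) := by
    have e : (T + 1) * ((k + 1) * (k * (T * ((n : ℝ)⁻¹ * π)) + T * ((n : ℝ)⁻¹ * π)))
        = ((T + 1) * T / n) * ((k + 1) * (k * π + π)) := by field_simp
    rw [e]
    gcongr
    rw [div_le_iff₀ hn']
    nlinarith
  refine add_le_add (add_le_add (add_le_add (add_le_add le_rfl ?_) ?_) b3) (le_trans ?_ b6)
  · gcongr
  · gcongr
  · gcongr

end Remainder

/-! ### The score vectors as an independent centred array, and convergence in probability. -/

section Scores

variable {Ω : Type*} {mΩ : MeasurableSpace Ω} {P : Measure Ω} [IsProbabilityMeasure P]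
  {S : Type*} [MeasurableSpace S] {L : Measure S} {X : ℕ → Ω → S}

lemma norm_sq_psum {V : Type*} [NormedAddCommGroup V] [InnerProductSpace ℝ V] (ξ : ℕ → V)
    (n : ℕ) : ‖psum ξ n‖ ^ 2 = ∑ i ∈ Finset.range n, ‖ξ i‖ ^ 2 + 2 * offDiag ξ n := by
  induction n with
  | zero => simp [psum, offDiag]
  | succ n ih =>
    have e1 : psum ξ (n + 1) = psum ξ n + ξ n := Finset.sum_range_succ _ _
    have e2 : offDiag ξ (n + 1) = offDiag ξ n + ⟪psum ξ n, ξ n⟫ := Finset.sum_range_succ _ _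
    rw [e1, e2, norm_add_sq_real, ih, Finset.sum_range_succ]; ring

/-- The weighted score vector. -/
noncomputable def scoreVec (V : ℕ → S → ℝ) (τ : ℕ → ℝ) (m : ℕ) (v : S) : E m :=
  wvec τ m fun j => V j v

lemma measurable_scoreVec {V : ℕ → S → ℝ} (hV : ∀ j, Measurable (V j)) (τ : ℕ → ℝ) (m : ℕ) :
    Measurable (scoreVec V τ m) :=
  (PiLp.continuous_toLp 2 _).measurable.comp
    (measurable_pi_lambda _ fun j => (hV j).const_mul _)

lemma wvec_sampleMean (V : ℕ → S → ℝ) (τ : ℕ → ℝ) (m n : ℕ) (ω : Ω) :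
    wvec τ m (fun j => sampleMean X (V j) n ω)
      = (n : ℝ)⁻¹ • psum (fun i => scoreVec V τ m (X i ω)) n := by
  simp only [sampleMean, wvec_smul, wvec_sum, psum, scoreVec]

namespace ScoreBounds

variable {V b : ℕ → S → ℝ} {κ : ℝ} (hS : ScoreBounds L V b κ) {τ : ℕ → ℝ}
  (hτ : AssumptionWeights τ)
include hS hτ

/-- Weighted Cauchy-Schwarz, `(∑ τ V²)² ≤ (∑ τ) (∑ τ V⁴)`. The fourth moment thus grows like the
squared sum of the weights, the quantity that must be `o(n)`. -/
lemma integral_norm_pow_four_le (m : ℕ) :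
    Integrable (fun v => ‖scoreVec V τ m v‖ ^ 4) L ∧
      ∫ v, ‖scoreVec V τ m v‖ ^ 4 ∂L ≤ κ * (∑ j ∈ Finset.range m, τ j) ^ 2 := by
  have hτ0 : ∀ j, 0 ≤ τ j := fun j => (hτ.pos j).le
  have hT0 : 0 ≤ ∑ j ∈ Finset.range m, τ j := Finset.sum_nonneg fun j _ => hτ0 j
  have i4 : ∀ j, Integrable (fun v => τ j * V j v ^ 4) L := fun j =>
    Integrable.const_mul (by
      refine ((hS.memLp_V j).integrable_norm_pow (p := 4) (by norm_num)).congr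
        (ae_of_all _ fun v => ?_)
      simp only [Real.norm_eq_abs]
      exact (by decide : Even 4).pow_abs _) _
  have hle : ∀ v, ‖scoreVec V τ m v‖ ^ 4
      ≤ (∑ j ∈ Finset.range m, τ j) * ∑ j ∈ Finset.range m, τ j * V j v ^ 4 := by
    intro v
    rw [show (4 : ℕ) = 2 * 2 from rfl, pow_mul, scoreVec, norm_sq_wvec hτ0]
    refine Finset.sum_sq_le_sum_mul_sum_of_sq_le_mul _ (fun j _ => hτ0 j)
      (fun j _ => mul_nonneg (hτ0 j) ((by decide : Even 4).pow_nonneg _)) fun j _ => le_of_eq ?_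
    ring
  have ib : Integrable (fun v => (∑ j ∈ Finset.range m, τ j) *
      ∑ j ∈ Finset.range m, τ j * V j v ^ 4) L :=
    (integrable_finsetSum _ fun j _ => i4 j).const_mul _
  have hm := measurable_scoreVec hS.measurable_V τ m
  have hi : Integrable (fun v => ‖scoreVec V τ m v‖ ^ 4) L :=
    ib.mono' (hm.norm.pow_const 4).aestronglyMeasurable (ae_of_all _ fun v => by
      rw [Real.norm_of_nonneg (by positivity)]; exact hle v)
  refine ⟨hi, (integral_mono hi ib hle).trans ?_⟩
  rw [integral_const_mul, integral_finsetSum _ fun j _ => i4 j]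
  calc _ ≤ (∑ j ∈ Finset.range m, τ j) * ∑ j ∈ Finset.range m, τ j * κ := by
        gcongr with j
        rw [integral_const_mul]
        exact mul_le_mul_of_nonneg_left (hS.pow_four_V j) (hτ0 j)
    _ = _ := by rw [← Finset.sum_mul]; ring

lemma isCenteredIID_scoreVec (h : IsIID P X L) (m : ℕ) :
    IsCenteredIID P (fun i ω => scoreVec V τ m (X i ω)) (L.map (scoreVec V τ m)) := by
  have := h.isProb
  have hm := measurable_scoreVec hS.measurable_V τ m
  refine ⟨h.indep.comp _ fun _ => hm, fun i => hm.comp_aemeasurable (h.aemeasurable i),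
    fun i => ?_, ?_, fun x => ?_⟩
  · rw [← h.map_eq i, AEMeasurable.map_map_of_aemeasurable hm.aemeasurable (h.aemeasurable i)]
    rfl
  · refine (memLp_map_measure_iff aestronglyMeasurable_id hm.aemeasurable).2 ?_
    exact (memLp_norm_iff hm.aestronglyMeasurable).1 (memLp_four_of_integrable_pow
      hm.norm.aestronglyMeasurable (hS.integral_norm_pow_four_le hτ m).1)
  · rw [integral_map hm.aemeasurable (Continuous.aestronglyMeasurable (by fun_prop))]
    simp only [scoreVec, wvec, PiLp.inner_apply, RCLike.inner_apply, conj_trivial]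
    rw [integral_finsetSum]
    · simp only [integral_mul_const, integral_const_mul, hS.mean]
      simp
    · intro j _
      exact ((((hS.memLp_V j).mono_exponent (p := 1) (by norm_num)).integrable le_rfl).const_mul
        _).mul_const _

/-- The bound on the operator norm is independent of `m`: since `τ j ≤ 1`, the weights only shrink
the coefficient vector fed to `sq_V`. -/
lemma quad_scoreVec_le [IsProbabilityMeasure L] (m : ℕ) (hmem : MemLp id 4 (L.map (scoreVec V τ m)))
    (x : E m) : quad (L.map (scoreVec V τ m)) x ≤ κ * ‖x‖ ^ 2 := by
  have hm := measurable_scoreVec hS.measurable_V τ m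
  have := Measure.isProbabilityMeasure_map (μ := L) hm.aemeasurable
  have hκ := hS.one_le
  rw [quad_eq hmem, integral_map hm.aemeasurable (Continuous.aestronglyMeasurable (by fun_prop))]
  set y : ℕ → ℝ := fun j => if hj : j < m then x ⟨j, hj⟩ * √(τ j) else 0 with hy
  have e1 : ∀ v, ⟪x, scoreVec V τ m v⟫ = ∑ j ∈ Finset.range m, y j * V j v := by
    intro v
    simp only [scoreVec, wvec, PiLp.inner_apply, RCLike.inner_apply, conj_trivial]
    rw [Finset.sum_range]
    refine Finset.sum_congr rfl fun j _ => ?_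
    simp [hy]; ring
  simp only [e1]
  refine (hS.sq_V m y).trans ?_
  gcongr
  rw [EuclideanSpace.norm_sq_eq, Finset.sum_range]
  refine Finset.sum_le_sum fun j _ => ?_
  simp only [hy, j.2, dite_true, mul_pow, Real.norm_eq_abs, sq_abs, Fin.eta]
  rw [Real.sq_sqrt (hτ.pos j).le]
  exact mul_le_of_le_one_right (sq_nonneg _) (hτ.le_one j)

/-- `covHS` is the mean of `⟪z, z'⟫²` over two independent draws; expanding the square into a double
sum, each factor integrates to the same covariance entry. -/
lemma covHS_scoreVec [IsProbabilityMeasure L] (m : ℕ) (hmem : MemLp id 4 (L.map (scoreVec V τ m))) :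
    covHS (L.map (scoreVec V τ m)) = ∑ j ∈ Finset.range m, ∑ l ∈ Finset.range m,
      τ j * τ l * (∫ v, V j v * V l v ∂L) ^ 2 := by
  have hm := measurable_scoreVec hS.measurable_V τ m
  have := Measure.isProbabilityMeasure_map (μ := L) hm.aemeasurable
  have hτ0 : ∀ j, 0 ≤ τ j := fun j => (hτ.pos j).le
  have hVV : ∀ j l, Integrable (fun v => V j v * V l v) L := fun j l =>
    (memLp_mul_of_memLp_four (hS.memLp_V j) (hS.memLp_V l)).1.integrable (by norm_num)
  have hq : ∀ v, quad (L.map (scoreVec V τ m)) (scoreVec V τ m v)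
      = ∑ j ∈ Finset.range m, ∑ l ∈ Finset.range m,
        τ j * τ l * (∫ v, V j v * V l v ∂L) * (V j v * V l v) := by
    intro v
    rw [quad_eq hmem, integral_map hm.aemeasurable (Continuous.aestronglyMeasurable (by fun_prop))]
    have e : ∀ w, ⟪scoreVec V τ m v, scoreVec V τ m w⟫ ^ 2
        = ∑ j ∈ Finset.range m, ∑ l ∈ Finset.range m,
          τ j * τ l * (V j v * V l v) * (V j w * V l w) := by
      intro w
      rw [scoreVec, scoreVec, inner_wvec hτ0, sq, Finset.sum_mul_sum]
      refine Finset.sum_congr rfl fun j _ => Finset.sum_congr rfl fun l _ => ?_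
      ring
    simp only [e]
    rw [integral_finsetSum _ fun j _ => integrable_finsetSum _ fun l _ => (hVV j l).const_mul _]
    refine Finset.sum_congr rfl fun j _ => ?_
    rw [integral_finsetSum _ fun l _ => (hVV j l).const_mul _]
    refine Finset.sum_congr rfl fun l _ => ?_
    rw [integral_const_mul]; ring
  rw [covHS, integral_map hm.aemeasurable (continuous_quad _).aestronglyMeasurable]
  simp only [hq]
  rw [integral_finsetSum _ fun j _ => integrable_finsetSum _ fun l _ => (hVV j l).const_mul _]
  refine Finset.sum_congr rfl fun j _ => ?_
  rw [integral_finsetSum _ fun l _ => (hVV j l).const_mul _]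
  refine Finset.sum_congr rfl fun l _ => ?_
  rw [integral_const_mul]; ring

end ScoreBounds

/-- Convergence to zero in probability of variables dominated, off events of small probability, by
a vanishing multiple of variables with bounded expectation. -/
lemma tendstoInMeasure_zero_of_le {R Q : ℕ → Ω → ℝ} {c : ℕ → ℝ} (hc : Tendsto c atTop (𝓝 0))
    {C : ℝ} (hQ : ∀ᶠ n in atTop, 0 ≤ c n ∧ (∀ ω, 0 ≤ Q n ω) ∧ Integrable (Q n) P ∧
      ∫ ω, Q n ω ∂P ≤ C)
    (hR : ∀ η : ℝ, 0 < η → ∃ K : ℝ, 0 ≤ K ∧ ∀ᶠ n in atTop, ∃ s : Set Ω,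
      P s ≤ ENNReal.ofReal η ∧ ∀ᵐ ω ∂P, ω ∉ s → |R n ω| ≤ c n * (K * Q n ω)) :
    TendstoInMeasure P R atTop 0 := by
  rw [tendstoInMeasure_iff_norm]
  intro ε hε
  simp only [Pi.zero_apply, sub_zero, Real.norm_eq_abs]
  rw [ENNReal.tendsto_nhds_zero]
  intro η' hη'
  -- Half of the allowed probability goes to the exceptional event, half to Markov's inequality for
  -- the dominating variable.
  obtain ⟨η, hη, hηη⟩ : ∃ η : ℝ, 0 < η ∧ ENNReal.ofReal η + ENNReal.ofReal η ≤ η' := by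
    obtain ⟨a, ha0, ha⟩ := ENNReal.lt_iff_exists_nnreal_btwn.1 (ENNReal.half_pos hη'.ne')
    refine ⟨a, by exact_mod_cast ha0, ?_⟩
    rw [ENNReal.ofReal_coe_nnreal]
    calc _ ≤ η' / 2 + η' / 2 := add_le_add ha.le ha.le
      _ = η' := ENNReal.add_halves _
  obtain ⟨K, hK, hev⟩ := hR η hη
  have hsmall : ∀ᶠ n in atTop, c n * (K * C) / ε < η := by
    have : Tendsto (fun n => c n * (K * C) / ε) atTop (𝓝 (0 * (K * C) / ε)) :=
      (hc.mul_const _).div_const _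
    exact this.eventually_lt_const (by simpa using hη)
  filter_upwards [hQ, hev, hsmall] with n ⟨hc0, hQ0, hQi, hQC⟩ ⟨s, hs, hb⟩ hn
  have hmark : P {ω | ε ≤ c n * (K * Q n ω)} ≤ ENNReal.ofReal η := by
    have h1 := mul_meas_ge_le_integral_of_nonneg (μ := P) (f := fun ω => c n * (K * Q n ω))
      (ae_of_all _ fun ω => mul_nonneg hc0 (mul_nonneg hK (hQ0 ω)))
      ((hQi.const_mul K).const_mul (c n)) ε
    rw [integral_const_mul, integral_const_mul] at h1
    have h2 : P.real {ω | ε ≤ c n * (K * Q n ω)} ≤ η := by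
      refine le_trans ?_ hn.le
      rw [le_div_iff₀ hε, mul_comm]
      exact h1.trans (by gcongr)
    rw [← ofReal_measureReal]
    exact ENNReal.ofReal_le_ofReal h2
  refine le_trans ?_ hηη
  calc P {ω | ε ≤ |R n ω|} ≤ P (s ∪ {ω | ε ≤ c n * (K * Q n ω)}) := by
        refine measure_mono_ae ?_
        filter_upwards [hb] with ω hω h
        by_cases hs : ω ∈ s
        · exact Or.inl hs
        · exact Or.inr (le_trans h (hω hs))
    _ ≤ _ := (measure_union_le _ _).trans (add_le_add hs hmark)

end Scores

/-! ### Pathwise comparison with the statistic at the true parameter. -/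

section Main

variable {Ω : Type*} {mΩ : MeasurableSpace Ω} {P : Measure Ω} [IsProbabilityMeasure P]
  {dz dw k : ℕ}

/-- The gradient component `∂φ/∂ϑ_l` at `ϑ₀` as a function of the observation. -/
noncomputable def gradObs (φ : E dz → E k → ℝ) (ϑ₀ : E k) (l : Fin k) (v : ℝ × E dz × E dw) : ℝ :=
  partialDeriv (φ v.2.1) l ϑ₀

/-- The Taylor envelope as a function of the observation. -/
noncomputable def envObs (φ : E dz → E k → ℝ) (ϑ₀ : E k) (r : ℝ) (v : ℝ × E dz × E dw) : ℝ :=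
  (taylorEnvelope φ ϑ₀ r v.2.1).toReal

lemma covEntry_eq {Y : Ω → ℝ} {Z : Ω → E dz} {W : Ω → E dw} {sol : E dz → ℝ}
    {f : ℕ → E dw → ℝ} {τ : ℕ → ℝ} (hT : Measurable fun ω => (Y ω, Z ω, W ω))
    (hV : ∀ j, Measurable (score (dz := dz) sol f j)) (j l : ℕ) :
    covEntry P (err Y Z sol) W f τ j l = √(τ j) * √(τ l) *
      ∫ v, score sol f j v * score sol f l v ∂(P.map fun ω => (Y ω, Z ω, W ω)) := by
  have hm : Measurable fun v => score (dz := dz) sol f j v * score sol f l v := (hV j).mul (hV l)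
  rw [integral_map hT.aemeasurable hm.aestronglyMeasurable, covEntry, ← integral_const_mul]
  congr with ω
  simp only [score, err]; ring

/-- The effect of replacing the true parameter by its estimator, for a single sample. -/
lemma abs_testStat_sub_le {sol : E dz → ℝ} {φ : E dz → E k → ℝ} {ϑ₀ : E k} {r : ℝ}
    {O : Set (E k)} (hg : ∀ z, TwicePartialDiffOn (φ z) O) (hO : Metric.ball ϑ₀ r ⊆ O)
    {f : ℕ → E dw → ℝ} {τ : ℕ → ℝ} (hτ : ∀ j, 0 ≤ τ j) (L : Measure (ℝ × E dz × E dw))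
    {Ys : ℕ → Ω → ℝ} {Zs : ℕ → Ω → E dz} {Ws : ℕ → Ω → E dw} {ϑhat : Ω → E k} {ω : Ω}
    (hsol : ∀ i, sol (Zs i ω) = φ (Zs i ω) ϑ₀) (hfin : ∀ i, taylorEnvelope φ ϑ₀ r (Zs i ω) < ⊤)
    (hball : ϑhat ω ∈ Metric.ball ϑ₀ r) {m n : ℕ} (hn : 0 < n) {K T : ℝ} (hT : 0 < T)
    (hK : √n * ‖ϑhat ω - ϑ₀‖ ≤ K) :
    n * |testStat Ys Zs Ws f τ φ ϑhat m n ω - ‖wvec τ m fun j =>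
        sampleMean (fun i ω => (Ys i ω, Zs i ω, Ws i ω)) (score sol f j) n ω‖ ^ 2|
      ≤ 4 * (1 + K) ^ 4 * remBound L (fun i ω => (Ys i ω, Zs i ω, Ws i ω)) (score sol f) (instr f)
        (gradObs φ ϑ₀) (envObs φ ϑ₀ r) τ m n T ω := by
  set X : ℕ → Ω → ℝ × E dz × E dw := fun i ω => (Ys i ω, Zs i ω, Ws i ω) with hX
  set δ : E k := ϑhat ω - ϑ₀ with hδ
  set ρ : ℕ → ℝ := fun j =>
    (n : ℝ)⁻¹ * ∑ i ∈ Finset.range n, taylorRem φ ϑ₀ (Zs i ω) (ϑhat ω) * f j (Ws i ω) with hρ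
  set g : Fin k → ℕ → ℝ := fun l j => ∫ v, gradObs φ ϑ₀ l v * instr f j v ∂L with hgdef
  set N : Fin k → ℕ → ℝ := fun l j =>
    sampleMean X (fun v => gradObs φ ϑ₀ l v * instr f j v) n ω - g l j with hN
  -- Since `sol` agrees with `φ` at `ϑ₀` on the sample, the estimated residual is the true error
  -- minus the gradient term minus the Taylor remainder.
  have hterm : ∀ i j, (Ys i ω - φ (Zs i ω) (ϑhat ω)) * f j (Ws i ω)
      = score sol f j (X i ω) - (∑ l, δ l * (gradObs φ ϑ₀ l (X i ω) * instr f j (X i ω))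
        + taylorRem φ ϑ₀ (Zs i ω) (ϑhat ω) * f j (Ws i ω)) := by
    intro i j
    have e : ∑ l, δ l * (gradObs φ ϑ₀ l (X i ω) * instr f j (X i ω))
        = ⟪partialGrad (φ (Zs i ω)) ϑ₀, δ⟫ * f j (Ws i ω) := by
      simp only [partialGrad, PiLp.inner_apply, RCLike.inner_apply, conj_trivial, Finset.sum_mul]
      refine Finset.sum_congr rfl fun l _ => ?_
      simp only [gradObs, instr, hX]; ring
    rw [e]
    simp only [score, taylorRem, hX, ← hδ, hsol]; ring
  have hB : ∀ j, (n : ℝ)⁻¹ * ∑ i ∈ Finset.range n, (Ys i ω - φ (Zs i ω) (ϑhat ω)) * f j (Ws i ω)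
      = sampleMean X (score sol f j) n ω + -1 * (∑ l, δ l * (g l j + N l j) + ρ j) := by
    intro j
    simp only [hterm, Finset.sum_sub_distrib, Finset.sum_add_distrib, hN, add_sub_cancel]
    have : ∑ l, δ l * sampleMean X (fun v => gradObs φ ϑ₀ l v * instr f j v) n ω
        = (n : ℝ)⁻¹ * ∑ i ∈ Finset.range n,
          ∑ l, δ l * (gradObs φ ϑ₀ l (X i ω) * instr f j (X i ω)) := by
      rw [Finset.sum_comm, Finset.mul_sum]
      refine Finset.sum_congr rfl fun l _ => ?_
      rw [← Finset.mul_sum, sampleMean]; ring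
    rw [this]
    simp only [sampleMean, hρ]; ring
  have hstat : testStat Ys Zs Ws f τ φ ϑhat m n ω
      = ‖wvec τ m (fun j => sampleMean X (score sol f j) n ω)
        - (∑ l, δ l • (wvec τ m (g l) + wvec τ m (N l)) + wvec τ m ρ)‖ ^ 2 := by
    have e : wvec τ m (fun j => sampleMean X (score sol f j) n ω)
        - (∑ l, δ l • (wvec τ m (g l) + wvec τ m (N l)) + wvec τ m ρ)
        = wvec τ m fun j => (n : ℝ)⁻¹ * ∑ i ∈ Finset.range n,
          (Ys i ω - φ (Zs i ω) (ϑhat ω)) * f j (Ws i ω) := by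
      rw [funext hB, wvec_add τ m (fun j => sampleMean X (score sol f j) n ω)
        (fun j => -1 * (∑ l, δ l * (g l j + N l j) + ρ j)), wvec_smul τ m (-1)
        (fun j => ∑ l, δ l * (g l j + N l j) + ρ j),
        wvec_add τ m (fun j => ∑ l, δ l * (g l j + N l j)) ρ,
        wvec_sum τ m Finset.univ (fun l j => δ l * (g l j + N l j)), neg_one_smul, ← sub_eq_add_neg]
      congr 2
      refine Finset.sum_congr rfl fun l _ => ?_
      rw [wvec_smul τ m (δ l) (fun j => g l j + N l j), wvec_add τ m (g l) (N l)]
    rw [e, norm_sq_wvec hτ, testStat]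
    simp only [sq_abs]
  -- The remainder depends on the data through the estimator, so it is not a sample mean of a fixed
  -- function. Replacing it by the envelope factors out `‖δ‖²` and leaves such a mean.
  have hρle : ‖wvec τ m ρ‖ ≤ ‖δ‖ ^ 2 *
      ‖wvec τ m fun j => sampleMean X (fun v => envObs φ ϑ₀ r v * |instr f j v|) n ω‖ := by
    have h1 : ‖wvec τ m ρ‖ ≤ ‖wvec τ m fun j => ‖δ‖ ^ 2 *
        sampleMean X (fun v => envObs φ ϑ₀ r v * |instr f j v|) n ω‖ := by
      refine norm_wvec_le hτ m fun j => ?_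
      simp only [hρ, sampleMean, abs_mul]
      rw [abs_of_nonneg (by positivity : (0 : ℝ) ≤ (n : ℝ)⁻¹), mul_left_comm, Finset.mul_sum]
      gcongr
      refine (Finset.abs_sum_le_sum_abs _ _).trans (Finset.sum_le_sum fun i _ => ?_)
      rw [abs_mul]
      have := abs_taylorRem_le_taylorEnvelope (hg (Zs i ω)) hO (hfin i) hball
      calc _ ≤ (taylorEnvelope φ ϑ₀ r (Zs i ω)).toReal * ‖ϑhat ω - ϑ₀‖ ^ 2 * |f j (Ws i ω)| := by
            gcongr
        _ = _ := by simp only [envObs, instr, hX, hδ]; ring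
    refine h1.trans_eq ?_
    rw [wvec_smul, norm_smul, Real.norm_of_nonneg (by positivity)]
  rw [hstat]
  refine abs_norm_sq_perturb_le hn hT (norm_nonneg δ) hK (fun l => ?_) hρle
  simpa using PiLp.norm_apply_le δ l

end Main

/-! ### Identification of the normalizing constants and growth conditions. -/

section Conclusion

variable {Ω : Type*} {mΩ : MeasurableSpace Ω} {P : Measure Ω} [IsProbabilityMeasure P]
  {dz dw k : ℕ}

lemma IsIIDSample.isIID {Y : Ω → ℝ} {Z : Ω → E dz} {W : Ω → E dw} {Ys : ℕ → Ω → ℝ}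
    {Zs : ℕ → Ω → E dz} {Ws : ℕ → Ω → E dw} (h : IsIIDSample P Y Z W Ys Zs Ws) :
    IsIID P (fun i ω => (Ys i ω, Zs i ω, Ws i ω)) (P.map fun ω => (Y ω, Z ω, W ω)) :=
  ⟨h.indep, fun i => (h.ident i).aemeasurable_fst, fun i => (h.ident i).map_eq⟩

lemma aemeasurable_testStat {Ys : ℕ → Ω → ℝ} {Zs : ℕ → Ω → E dz} {Ws : ℕ → Ω → E dw}
    (h : ∀ i, AEMeasurable (fun ω => (Ys i ω, Zs i ω, Ws i ω)) P) {f : ℕ → E dw → ℝ}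
    (hf : ∀ j, Measurable (f j)) (τ : ℕ → ℝ) {φ : E dz → E k → ℝ}
    (hφ : Measurable fun q : E dz × E k => φ q.1 q.2) {ϑhat : Ω → E k} (hϑ : Measurable ϑhat)
    (m n : ℕ) : AEMeasurable (testStat Ys Zs Ws f τ φ ϑhat m n) P := by
  have h1 : ∀ i j, AEMeasurable (fun ω => (Ys i ω - φ (Zs i ω) (ϑhat ω)) * f j (Ws i ω)) P := by
    intro i j
    have hY : AEMeasurable (Ys i) P := (h i).fst
    have hZ : AEMeasurable (Zs i) P := (h i).snd.fst
    have hW : AEMeasurable (Ws i) P := (h i).snd.snd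
    exact (hY.sub (hφ.comp_aemeasurable (hZ.prodMk hϑ.aemeasurable))).mul
      ((hf j).comp_aemeasurable hW)
  unfold testStat
  refine Finset.aemeasurable_fun_sum _ fun j _ => AEMeasurable.const_mul ?_ _
  simp only [sq_abs]
  exact ((Finset.aemeasurable_fun_sum _ fun i _ => h1 i j).const_mul _).pow_const 2

lemma covFrob_eq {Y : Ω → ℝ} {Z : Ω → E dz} {W : Ω → E dw} {sol : E dz → ℝ}
    {f : ℕ → E dw → ℝ} {τ : ℕ → ℝ} (hT : Measurable fun ω => (Y ω, Z ω, W ω)) {κ : ℝ}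
    (hS : ScoreBounds (P.map fun ω => (Y ω, Z ω, W ω)) (score sol f) (instr f) κ)
    (hτ : AssumptionWeights τ) (m : ℕ)
    (hmem : MemLp id 4 ((P.map fun ω => (Y ω, Z ω, W ω)).map (scoreVec (score sol f) τ m))) :
    covFrob P (err Y Z sol) W f τ m
      = √(covHS ((P.map fun ω => (Y ω, Z ω, W ω)).map (scoreVec (score sol f) τ m))) := by
  have := Measure.isProbabilityMeasure_map (μ := P) hT.aemeasurable
  rw [hS.covHS_scoreVec hτ m hmem, covFrob]
  congr 1
  refine Finset.sum_congr rfl fun j _ => Finset.sum_congr rfl fun l _ => ?_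
  rw [covEntry_eq hT hS.measurable_V, mul_pow, mul_pow, Real.sq_sqrt (hτ.pos j).le,
    Real.sq_sqrt (hτ.pos l).le]

lemma covTrace_eq {Y : Ω → ℝ} {Z : Ω → E dz} {W : Ω → E dw} {sol : E dz → ℝ}
    {f : ℕ → E dw → ℝ} {τ : ℕ → ℝ} (hT : Measurable fun ω => (Y ω, Z ω, W ω)) {κ : ℝ}
    (hS : ScoreBounds (P.map fun ω => (Y ω, Z ω, W ω)) (score sol f) (instr f) κ)
    (hτ : AssumptionWeights τ) (m : ℕ) :
    covTrace P (err Y Z sol) W f τ m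
      = ∫ v, ‖scoreVec (score sol f) τ m v‖ ^ 2 ∂(P.map fun ω => (Y ω, Z ω, W ω)) := by
  have := Measure.isProbabilityMeasure_map (μ := P) hT.aemeasurable
  have hi : ∀ j, Integrable (fun v => score sol f j v ^ 2) (P.map fun ω => (Y ω, Z ω, W ω)) :=
    fun j => ((hS.memLp_V j).mono_exponent (p := 2) (by norm_num)).integrable_sq
  simp only [scoreVec, norm_sq_wvec fun j => (hτ.pos j).le]
  rw [integral_finsetSum _ fun j _ => (hi j).const_mul _, covTrace]
  refine Finset.sum_congr rfl fun j _ => ?_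
  rw [covEntry_eq hT hS.measurable_V, Real.mul_self_sqrt (hτ.pos j).le, integral_const_mul]
  simp only [sq]

/-- The fluctuation of the diagonal part of the statistic is bounded in mean square. -/
lemma integral_sq_diag_le {S : Type*} [MeasurableSpace S] {L : Measure S} {X : ℕ → Ω → S}
    (h : IsIID P X L) {V b : ℕ → S → ℝ} {κ : ℝ} (hS : ScoreBounds L V b κ) {τ : ℕ → ℝ}
    (hτ : AssumptionWeights τ) {m n : ℕ} (hn : 0 < n)
    (hmn : (∑ j ∈ Finset.range m, τ j) ^ 2 ≤ n) :
    Integrable (fun ω => (sampleMean X (fun v => ‖scoreVec V τ m v‖ ^ 2) n ω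
      - ∫ v, ‖scoreVec V τ m v‖ ^ 2 ∂L) ^ 2) P ∧
    ∫ ω, (sampleMean X (fun v => ‖scoreVec V τ m v‖ ^ 2) n ω
      - ∫ v, ‖scoreVec V τ m v‖ ^ 2 ∂L) ^ 2 ∂P ≤ κ := by
  have hn' : (0 : ℝ) < n := by exact_mod_cast hn
  have hm : Measurable fun v => ‖scoreVec V τ m v‖ ^ 2 :=
    (measurable_scoreVec hS.measurable_V τ m).norm.pow_const 2
  obtain ⟨i4, b4⟩ := hS.integral_norm_pow_four_le hτ m
  have e : ∀ v, (‖scoreVec V τ m v‖ ^ 2) ^ 2 = ‖scoreVec V τ m v‖ ^ 4 := fun v => by ring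
  have h2 : MemLp (fun v => ‖scoreVec V τ m v‖ ^ 2) 2 L :=
    (memLp_two_iff_integrable_sq hm.aestronglyMeasurable).2 (by simpa only [e] using i4)
  refine ⟨((h.memLp_sampleMean h2 n).sub (memLp_const _)).integrable_sq,
    (h.integral_sq_sampleMean_sub_le hm h2 hn).trans ?_⟩
  simp only [e]
  rw [inv_mul_le_iff₀ hn']
  have := hS.one_le
  calc _ ≤ κ * (∑ j ∈ Finset.range m, τ j) ^ 2 := b4
    _ ≤ κ * n := by gcongr
    _ = _ := mul_comm _ _

/-- The growth conditions on the truncation parameter. -/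
lemma eventually_growth {τ : ℕ → ℝ} (hτ : AssumptionWeights τ) {m : ℕ → ℕ}
    (hm : ∀ᶠ n in atTop, 0 < m n)
    (h : (fun n => (∑ j ∈ Finset.range (m n), τ j) ^ 3) =o[atTop] fun n => (n : ℝ)) :
    (∀ᶠ n in atTop, 1 ≤ ∑ j ∈ Finset.range (m n), τ j ∧
      (∑ j ∈ Finset.range (m n), τ j) ^ 2 ≤ n) ∧
    Tendsto (fun n : ℕ => (∑ j ∈ Finset.range (m n), τ j) ^ 2 / n) atTop (𝓝 0) := by
  -- The first weight equals `1`, so the sum is at least `1` and its square is at most its cube; the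
  -- square is then also `o(n)`.
  have h1 : ∀ᶠ n in atTop, 1 ≤ ∑ j ∈ Finset.range (m n), τ j := by
    filter_upwards [hm] with n hn
    rw [← hτ.first]
    exact Finset.single_le_sum (f := τ) (fun j _ => (hτ.pos j).le) (Finset.mem_range.2 hn)
  have h23 : ∀ᶠ n in atTop, (∑ j ∈ Finset.range (m n), τ j) ^ 2
      ≤ (∑ j ∈ Finset.range (m n), τ j) ^ 3 :=
    h1.mono fun n hn => pow_le_pow_right₀ hn (by norm_num)
  refine ⟨?_, ?_⟩
  · filter_upwards [h1, h23, h.bound one_pos] with n hn1 hn2 hn3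
    refine ⟨hn1, hn2.trans ?_⟩
    have := (le_abs_self _).trans hn3
    simpa using this
  · refine tendsto_of_tendsto_of_tendsto_of_le_of_le' tendsto_const_nhds h.tendsto_div_nhds_zero
      (Eventually.of_forall fun n => by positivity) ?_
    filter_upwards [h23] with n hn
    gcongr

end Conclusion

end IVTest

/-! ### Assembly of the limit theorem and the negligible terms. -/

theorem mainTheorem3 {Ω : Type*} {mΩ : MeasurableSpace Ω} (P : Measure Ω) [IsProbabilityMeasure P]
    {dz dw k : ℕ}
    -- the model and the sample
    (Y : Ω → ℝ) (Z : Ω → E dz) (W : Ω → E dw) (sol : E dz → ℝ)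
    (hmodel : IsIVModel P Y Z W sol)
    (Ys : ℕ → Ω → ℝ) (Zs : ℕ → Ω → E dz) (Ws : ℕ → Ω → E dw)
    (hsample : IsIIDSample P Y Z W Ys Zs Ws)
    -- the basis functions and the weights
    (ν : E dw → ℝ) (hν : IsProbDensity ν)
    (f : ℕ → E dw → ℝ) (hf : IsONB ν f)
    (hA1 : AssumptionBasis P W ν f)
    (hA2 : AssumptionMoment P (err Y Z sol) W)
    (hA3 : AssumptionNonsingular P Z W)
    (τ : ℕ → ℝ) (hA4 : AssumptionWeights τ)
    -- the parametric family and the estimator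
    (Θ : Set (E k)) (hΘ : IsCompact Θ) (φ : E dz → E k → ℝ)
    (ϑ₀ : E k) (ϑhat : ℕ → Ω → E k)
    (hA5 : AssumptionParametric P Z sol Θ φ ϑ₀ ϑhat)
    -- the growth of the truncation parameter
    (m : ℕ → ℕ)
    (hm₁ : Tendsto (fun n => covFrob P (err Y Z sol) W f τ (m n)) atTop atTop)
    (hm₂ : (fun n => (∑ j ∈ Finset.range (m n), τ j) ^ 3) =o[atTop] fun n => (n : ℝ))
    -- the null hypothesis
    (hnull : ParametricNull P Z sol Θ φ) :
    TendstoInDistribution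
      (fun (n : ℕ) (ω : Ω) => (√2 * covFrob P (err Y Z sol) W f τ (m n))⁻¹ *
        ((n : ℝ) * testStat Ys Zs Ws f τ φ (ϑhat n) (m n) n ω
          - covTrace P (err Y Z sol) W f τ (m n)))
      atTop (id : ℝ → ℝ) (fun _ => P) (gaussianReal 0 1) := by
  set X : ℕ → Ω → ℝ × E dz × E dw := fun i ω => (Ys i ω, Zs i ω, Ws i ω) with hX
  set L : Measure (ℝ × E dz × E dw) := P.map fun ω => (Y ω, Z ω, W ω) with hL
  have hmeas : Measurable fun ω => (Y ω, Z ω, W ω) :=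
    hmodel.measurable_Y.prodMk (hmodel.measurable_Z.prodMk hmodel.measurable_W)
  have hiid : IsIID P X L := hsample.isIID
  have := hiid.isProb
  obtain ⟨κ, hS⟩ := exists_scoreBounds hmodel hν hf hA1 hA2
  rw [← hL] at hS
  obtain ⟨r, hr, hball, hGm, hGfin, hG4, hpm, hp4⟩ :=
    exists_parametric_bounds hmodel.measurable_Z hA5
  have hκ := hS.one_le
  have hτ0 : ∀ j, 0 ≤ τ j := fun j => (hA4.pos j).le
  have hZL : Measurable fun v : ℝ × E dz × E dw => v.2.1 := measurable_snd.fst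
  have hpL : ∀ l, Measurable (gradObs (dw := dw) φ ϑ₀ l) := fun l => (hpm l).comp hZL
  have hGL : Measurable (envObs (dw := dw) φ ϑ₀ r) := (hGm.comp hZL).ennreal_toReal
  obtain ⟨C, hC⟩ := integral_remBound_le (p := gradObs (dw := dw) φ ϑ₀) hiid hS hpL
    (fun l => (memLp_map_measure_iff (hpL l).aestronglyMeasurable hmeas.aemeasurable).2 (hp4 l))
    hGL ((memLp_map_measure_iff hGL.aestronglyMeasurable hmeas.aemeasurable).2 hG4) hA4
  set V : ℕ → ℝ × E dz × E dw → ℝ := score sol f with hV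
  set T : ℕ → ℝ := fun n => ∑ j ∈ Finset.range (m n), τ j with hT
  set ς : ℕ → ℝ := fun n => covFrob P (err Y Z sol) W f τ (m n) with hς
  set D : ℕ → Ω → ℝ := fun n ω => sampleMean X (fun v => ‖scoreVec V τ (m n) v‖ ^ 2) n ω
    - ∫ v, ‖scoreVec V τ (m n) v‖ ^ 2 ∂L with hD
  set R : ℕ → Ω → ℝ := fun n ω =>
    remBound L X V (instr f) (gradObs φ ϑ₀) (envObs φ ϑ₀ r) τ (m n) n (T n) ω with hR
  have hTnn : ∀ n, 0 ≤ T n := fun n => Finset.sum_nonneg fun j _ => hτ0 j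
  have hς0 : ∀ n, 0 ≤ ς n := fun n => Real.sqrt_nonneg _
  -- For `m n = 0` the Frobenius norm is an empty sum, which divergence excludes eventually.
  have hmpos : ∀ᶠ n in atTop, 0 < m n := by
    filter_upwards [hm₁.eventually_gt_atTop 0] with n hn
    refine Nat.pos_of_ne_zero fun h0 => ?_
    simp [hς, h0, covFrob] at hn
  obtain ⟨hgr, hT2⟩ := eventually_growth hA4 hmpos hm₂
  have hcent := fun n => hS.isCenteredIID_scoreVec hA4 hiid (m n)
  have hcov : ∀ n, ς n = √(covHS (L.map (scoreVec V τ (m n)))) := fun n =>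
    covFrob_eq hmeas hS hA4 (m n) (hcent n).memLp
  have hclt := tendstoInDistribution_offDiag hcent (zero_lt_one.trans_le hκ)
    (fun n => hS.quad_scoreVec_le hA4 (m n) (hcent n).memLp)
    (q := fun n => κ * T n ^ 2) (fun n => by
      rw [integral_map (measurable_scoreVec hS.measurable_V τ (m n)).aemeasurable
        (by fun_prop)]
      exact (hS.integral_norm_pow_four_le hA4 (m n)).2)
    (by simpa only [mul_div_assoc, mul_zero] using! hT2.const_mul κ)
    (tendsto_atTop.2 fun b => by
      filter_upwards [hm₁.eventually_ge_atTop (max b 1)] with n hn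
      have h1 : 1 ≤ ς n := (le_max_right _ _).trans hn
      have h2 : ς n ^ 2 = covHS (L.map (scoreVec V τ (m n))) := by
        rw [hcov n, Real.sq_sqrt]
        by_contra hneg
        rw [hcov n, Real.sqrt_eq_zero_of_nonpos (not_le.1 hneg).le] at h1
        linarith
      rw [← h2]
      exact ((le_max_left _ _).trans hn).trans (by nlinarith))
  simp only [← hcov] at hclt
  -- Splitting `n‖a‖²` into diagonal and off-diagonal sums: `μ` centres the diagonal, and `√2 / (n
  -- ς) = (√2 ς)⁻¹ * (2 / n)` matches the normalization of the off-diagonal limit theorem.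
  have hid : ∀ n ω, 0 < n → (√2 * ς n)⁻¹ * ((n : ℝ) * testStat Ys Zs Ws f τ φ (ϑhat n) (m n) n ω
      - covTrace P (err Y Z sol) W f τ (m n))
      - √2 / (n * ς n) * offDiag (fun i => scoreVec V τ (m n) (X i ω)) n
      = (√2 * ς n)⁻¹ * (D n ω + n * (testStat Ys Zs Ws f τ φ (ϑhat n) (m n) n ω
        - ‖wvec τ (m n) fun j => sampleMean X (V j) n ω‖ ^ 2)) := by
    intro n ω hn
    have hn' : (n : ℝ) ≠ 0 := by positivity
    rw [wvec_sampleMean, norm_smul, mul_pow, norm_sq_psum, covTrace_eq hmeas hS hA4]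
    simp only [hD, sampleMean, norm_inv, Real.norm_natCast]
    have e2 : √2 / (n * ς n) = (√2 * ς n)⁻¹ * (2 * (n : ℝ)⁻¹) := by
      rw [mul_inv, div_eq_mul_inv, mul_inv]
      have : √2 = (√2)⁻¹ * 2 := by
        rw [eq_inv_mul_iff_mul_eq₀ (by positivity)]; exact Real.mul_self_sqrt (by norm_num)
      nth_rewrite 1 [this]; ring
    rw [e2]
    field_simp
    ring
  have hsolL : ∀ᵐ ω ∂P, ∀ i, sol (Zs i ω) = φ (Zs i ω) ϑ₀ := by
    refine hiid.ae_all (s := fun v => sol v.2.1 = φ v.2.1 ϑ₀) ?_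
    refine (ae_map_iff hmeas.aemeasurable (measurableSet_eq_fun (hmodel.measurable_sol.comp hZL)
      (hA5.measurable_φ.comp (hZL.prodMk measurable_const)))).2 (hA5.eq_of_null hnull)
  have hfinL : ∀ᵐ ω ∂P, ∀ i, taylorEnvelope φ ϑ₀ r (Zs i ω) < ⊤ := by
    refine hiid.ae_all (s := fun v => taylorEnvelope φ ϑ₀ r v.2.1 < ⊤) ?_
    exact (ae_map_iff hmeas.aemeasurable
      (measurableSet_lt (hGm.comp hZL) measurable_const)).2 hGfin
  -- Slutsky's lemma: it remains to show that the difference in `hid` vanishes in probability.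
  refine tendstoInDistribution_of_tendstoInMeasure_sub _ _ hclt ?_ fun n =>
    ((aemeasurable_testStat hiid.aemeasurable hf.1 τ hA5.measurable_φ (hA5.measurable_ϑhat n) (m n)
      n).const_mul _ |>.sub_const _).const_mul _
  have hc : Tendsto (fun n => (√2 * ς n)⁻¹) atTop (𝓝 0) :=
    tendsto_inv_atTop_zero.comp (hm₁.const_mul_atTop (by positivity))
  refine tendstoInMeasure_zero_of_le (Q := fun n ω => 1 + D n ω ^ 2 + R n ω) hc (C := 1 + κ + C)
    ?_ ?_
  · filter_upwards [hgr, eventually_gt_atTop 0] with n ⟨hn1, hn2⟩ hn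
    obtain ⟨iR, bR⟩ : Integrable (fun ω => R n ω) P ∧ ∫ ω, R n ω ∂P ≤ C :=
      hC (m n) n hn hn1 hn2
    obtain ⟨iD, bD⟩ : Integrable (fun ω => D n ω ^ 2) P ∧ ∫ ω, D n ω ^ 2 ∂P ≤ κ :=
      integral_sq_diag_le hiid hS hA4 hn hn2
    refine ⟨inv_nonneg.2 (mul_nonneg (Real.sqrt_nonneg _) (hς0 n)), fun ω => ?_,
      ((integrable_const 1).add iD).add iR, ?_⟩
    · have := remBound_nonneg (L := L) (X := X) (V := V) (b := instr f) (p := gradObs φ ϑ₀)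
        (G := envObs φ ϑ₀ r) (τ := τ) (m := m n) (n := n) (hTnn n) ω
      positivity
    · have i1 : Integrable (fun ω => 1 + D n ω ^ 2) P := (integrable_const 1).add iD
      rw [integral_add i1 iR, integral_add (integrable_const 1) iD]
      simp only [integral_const, probReal_univ, one_smul]
      exact add_le_add (add_le_add le_rfl bD) bR
  · intro η hη
    obtain ⟨K₀, hK₀⟩ := hA5.rate η hη
    -- The constant provided by the rate of the estimator may be negative.
    set K := max K₀ 0 with hK
    refine ⟨1 + 4 * (1 + K) ^ 4, by positivity, ?_⟩
    -- Off the exceptional event the estimator eventually lies in the ball where the Taylor bound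
    -- holds.
    have hKr : ∀ᶠ n : ℕ in atTop, K * (√(n : ℝ))⁻¹ < r := by
      have : Tendsto (fun n : ℕ => K * (√(n : ℝ))⁻¹) atTop (𝓝 (K * 0)) :=
        (tendsto_inv_atTop_zero.comp
          (Real.tendsto_sqrt_atTop.comp tendsto_natCast_atTop_atTop)).const_mul K
      exact this.eventually_lt_const (by simpa using hr)
    filter_upwards [hK₀, hKr, hgr, eventually_gt_atTop 0] with n hn1 hn2 ⟨hT1, _⟩ hn
    refine ⟨_, hn1, ?_⟩
    filter_upwards [hsolL, hfinL] with ω hω1 hω2 hω3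
    have hsn : 0 < √(n : ℝ) := Real.sqrt_pos.2 (by exact_mod_cast hn)
    have hle : ‖ϑhat n ω - ϑ₀‖ ≤ K * (√(n : ℝ))⁻¹ :=
      (not_lt.1 hω3).trans (by gcongr; exact le_max_left _ _)
    have hmem : ϑhat n ω ∈ Metric.ball ϑ₀ r := by
      rw [mem_ball_iff_norm]; exact hle.trans_lt hn2
    have hKn : √(n : ℝ) * ‖ϑhat n ω - ϑ₀‖ ≤ K := by
      rw [← div_eq_mul_inv, le_div_iff₀ hsn] at hle
      linarith
    have hb := abs_testStat_sub_le hA5.twice_diff hball hτ0 L hω1 hω2 hmem (m := m n) hn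
      (f := f) (Ys := Ys) (Ws := Ws) (zero_lt_one.trans_le hT1) hKn
    simp only [Pi.sub_apply]
    rw [hid n ω hn, abs_mul, abs_of_nonneg (inv_nonneg.2 (mul_nonneg (Real.sqrt_nonneg 2) (hς0 n)))]
    refine mul_le_mul_of_nonneg_left ?_
      (inv_nonneg.2 (mul_nonneg (Real.sqrt_nonneg 2) (hς0 n)))
    have hRn : 0 ≤ R n ω := remBound_nonneg (hTnn n) ω
    have hDn : |D n ω| ≤ 1 + D n ω ^ 2 := by
      rw [← sq_abs]; nlinarith [sq_nonneg (|D n ω| - 1), abs_nonneg (D n ω)]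
    have hK4 : 0 ≤ 4 * (1 + K) ^ 4 := by positivity
    calc _ ≤ |D n ω| + n * |testStat Ys Zs Ws f τ φ (ϑhat n) (m n) n ω
          - ‖wvec τ (m n) fun j => sampleMean X (V j) n ω‖ ^ 2| := by
          refine (abs_add_le _ _).trans (le_of_eq ?_)
          rw [abs_mul, Nat.abs_cast]
      _ ≤ (1 + D n ω ^ 2) + 4 * (1 + K) ^ 4 * R n ω := add_le_add hDn hb
      _ ≤ _ := by nlinarith [sq_nonneg (D n ω), mul_nonneg hK4 (sq_nonneg (D n ω))]
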